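/- **Setting.** There are $n=3f+1$ replicas, a static set of at most $f$ of which is Byzantine; channels between correct replicas are reliable and authenticated, signatures are unforgeable and the hash function is collision-free. The network is partially synchronous: for a bound $\Delta>0$ known to the replicas and an unknown time GST, a message sent between correct replicas at time $t$ is delivered by time $\max(t,\mathrm{GST})+\Delta$. Local computation takes no time, and only finitely many events happen in bounded time. Correct replicas run the Autobahn protocol with certified tips: * *Lanes.* Each replica puts the client requests it receives, in order, into nonempty batches, and broadcasts them as a chain of *cars* (position, batch, hash of the preceding car). A car is sent once the preceding one has a proof of availability (PoA), i.e. $f+1$ votes, and carries this PoA; when no request is waiting, a PoA may also be broadcast on its own. Replicas vote in order and at most once per lane and position, and record the newest certified tip of every lane. * *Consensus.* In slot $s$, view $v$, the leader is replica $fs+v \bmod n$ (round-robin, with an offset of $f$ per slot). A ticket for view $0$ of slot $s$ is a leader-signed proposal of slot $s-1$ (nothing if $s$ is the first slot), together with a CommitQC of slot $s-k$ if at most $k$ slots may run in parallel; a ticket for view $v>0$ is a timeout certificate (TC), i.e. $2f+1$ Timeouts, of view $v-1$. A replica that first observes a ticket for a view enters the view, starts a timer of $10\Delta$, and forwards the ticket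 to all replicas. In view $0$ the leader broadcasts a Prepare with its ticket and the cut of its $n$ newest certified tips as soon as at least $n-f$ of them are newer than in the proposal of slot $s-1$ in its ticket. In a later view it proposes the winning cut of the TC, or its current cut if there is none; the winning cut is the higher by view (the first on ties) of the highest PrepareQC in the TC and the highest cut that is the latest prepared one of $f+1$ of the TC's senders. Replicas answer the first valid Prepare of their view with a Prep-Vote; $2f+1$ Prep-Votes form a PrepareQC, whose broadcast (Confirm) is acknowledged; $2f+1$ acknowledgements, or all $n$ Prep-Votes (the fast path, for which the leader waits a time of at most $\Delta$ after the first $2f+1$ votes), form a CommitQC, which is broadcast. A replica commits a slot upon receiving a CommitQC. * *View change.* A replica that has not committed broadcasts a Timeout (with its latest PrepareQC and its latest prepared proposal) when its timer expires or when $f+1$ replicas complained about its current or a later view, and takes no further part in this or earlier views. A replica that has committed the slot answers Timeouts with the CommitQC. * *Execution.* Replicas fetch missing history of the tips of proposals they voted for or committed from the replicas that certified the tip. Slots are executed in order: once the history is present, all proposals in the history of the committed cut's tips at positions beyond the last executed one of their lane are appended to the log, in an order given by a fixed deterministic function. **Clients.** A correct client sends its request to some replica and, as long as it is not answered ($f+1$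 matching responses, so that some correct replica has executed the request), to further replicas that it has not yet tried. **Theorem (Liveness).** Assume that there is a continuous stream of client requests, in that every correct replica receives client requests infinitely often. Then in every execution: 1. every client request received by a correct replica $h$ is afterwards included in a data proposal $d$ of $h$'s lane, and every correct replica eventually commits $d$ (i.e. commits a cut with a tip whose history contains $d$) and executes $d$; 2. every request of a correct client is contained in some data proposal that every correct replica eventually commits and executes. -/

import Mathlib

/-!
A timed, message-passing model of the Autobahn Byzantine fault tolerant replication protocol:
`n = 3f+1` replicas, data lanes of certified cars, slot-parallel two-phase consensus on cuts of the
lanes with a fast path, timeouts and view changes, data synchronization and execution.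
Lane positions start at `1`, slots and views at `0`.
-/

namespace Autobahn

/-- The `n = 3f+1` replicas. -/
abbrev Replica (f : ℕ) := Fin (3 * f + 1)

/-! ### Data proposals, certificates and consensus proposals -/

/-- A data proposal `⟨pos, B, parent⟩` of the lane of replica `lane`; `parent` is the hash of the
preceding proposal of the lane (`none` for the first one). -/
structure DataProp (f : ℕ) (Req Dig : Type*) where
  lane : Replica f
  pos : ℕ
  batch : List Req
  parent : Option Dig

/-- A proof of availability: the votes of `signers` for the proposal with hash `dig`. -/
structure PoA (f : ℕ) (Dig : Type*) where
  lane : Replica f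
  pos : ℕ
  dig : Dig
  signers : Finset (Replica f)

/-- A cut: for every lane its latest certified tip (`none`: nothing certified yet). -/
abbrev Cut (f : ℕ) (Dig : Type*) := Replica f → Option (PoA f Dig)

/-- The lane position of an optional tip, `0` if there is none. -/
def tipPos {f : ℕ} {Dig : Type*} (c : Option (PoA f Dig)) : ℕ := c.elim 0 PoA.pos

/-- A consensus proposal `⟨s, v, cut⟩`. -/
structure Proposal (f : ℕ) (Dig : Type*) where
  slot : ℕ
  view : ℕ
  cut : Cut f Dig

/-- Prep-Votes of `signers` for `prop`. -/
structure PrepareQC (f : ℕ) (Dig : Type*) where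
  prop : Proposal f Dig
  signers : Finset (Replica f)

/-- A fast certificate consists of Prep-Votes, a slow one of Confirm-Acks, of `signers`. -/
structure CommitQC (f : ℕ) (Dig : Type*) where
  prop : Proposal f Dig
  fast : Bool
  signers : Finset (Replica f)

/-- The contents of a Timeout message, besides slot and view. -/
structure Complaint (f : ℕ) (Dig : Type*) where
  highQC : Option (PrepareQC f Dig)
  highProp : Option (Proposal f Dig)

/-- A timeout certificate: the Timeout messages for `(slot, view)`, listed by their senders. -/
structure TC (f : ℕ) (Dig : Type*) where
  slot : ℕ
  view : ℕ
  complaints : Replica f → Option (Complaint f Dig)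

/-- A ticket. In view `0` of a slot it is a leader-signed proposal of the preceding slot and, if the
number of parallel slots is bounded by `k`, a CommitQC of the slot `k` earlier; in a later view it
is a timeout certificate of the preceding view. -/
inductive Ticket (f : ℕ) (Dig : Type*)
  | start (prev : Option (Proposal f Dig)) (gate : Option (CommitQC f Dig))
  | tc (T : TC f Dig)

/-- The messages exchanged by replicas. -/
inductive Msg (f : ℕ) (Req Dig : Type*)
  | car (d : DataProp f Req Dig) (cert : Option (PoA f Dig))
  | carVote (lane : Replica f) (pos : ℕ) (dig : Dig)
  | poa (c : PoA f Dig)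
  | ticket (s v : ℕ) (T : Ticket f Dig)
  | prepare (P : Proposal f Dig) (T : Ticket f Dig)
  | prepVote (P : Proposal f Dig)
  | confirm (Q : PrepareQC f Dig)
  | confirmAck (P : Proposal f Dig)
  | commit (Q : CommitQC f Dig)
  | timeout (s v : ℕ) (b : Complaint f Dig)
  | sync (c : PoA f Dig) (lo : ℕ)
  | syncReply (ds : List (DataProp f Req Dig))

/-- The statements that replicas sign. -/
inductive Stmt (f : ℕ) (Req Dig : Type*)
  | car (d : DataProp f Req Dig)
  | carVote (lane : Replica f) (pos : ℕ) (dig : Dig)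
  | proposal (P : Proposal f Dig)
  | prepVote (P : Proposal f Dig)
  | confirmAck (P : Proposal f Dig)
  | timeout (s v : ℕ) (b : Complaint f Dig)

/-- Round-robin leaders; the schedule of consecutive slots is offset by `f`. -/
def leader {f : ℕ} (s v : ℕ) : Replica f := Fin.ofNat (3 * f + 1) (f * s + v)

/-- The parameters of a deployment: a collision-free hash function, a deterministic function that
zips the new proposals of all lanes into one list, the delay bound `Δ` known to the replicas, the
short time for which a leader waits for a fast quorum, and an optional bound on the number of slots
that run in parallel (`some 1`: strictly sequential slots; `none`: unbounded). -/
structure Config (f : ℕ) (Req Dig : Type*) where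
  hash : DataProp f Req Dig → Dig
  hash_injective : Function.Injective hash
  zip : (Replica f → List (DataProp f Req Dig)) → List (DataProp f Req Dig)
  zip_perm : ∀ g, (zip g).Perm ((List.finRange (3 * f + 1)).flatMap g)
  Δ : ℝ
  Δ_pos : 0 < Δ
  fastWait : ℝ
  fastWait_nonneg : 0 ≤ fastWait
  fastWait_le : fastWait ≤ Δ
  maxParallel : Option ℕ
  maxParallel_pos : ∀ k, maxParallel = some k → 1 ≤ k

section Signatures

variable {f : ℕ} {Req Dig : Type*}

/-- Signatures contained in a proof of availability. -/
def PoA.sigs (c : PoA f Dig) : Set (Replica f × Stmt f Req Dig) :=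
  {p | p.1 ∈ c.signers ∧ p.2 = .carVote c.lane c.pos c.dig}

/-- Signatures contained in a consensus proposal signed by its leader. -/
def Proposal.sigs (P : Proposal f Dig) : Set (Replica f × Stmt f Req Dig) :=
  {p | p = (leader P.slot P.view, .proposal P) ∨ ∃ l c, P.cut l = some c ∧ p ∈ c.sigs}

def PrepareQC.sigs (Q : PrepareQC f Dig) : Set (Replica f × Stmt f Req Dig) :=
  {p | p.1 ∈ Q.signers ∧ p.2 = .prepVote Q.prop}

def CommitQC.sigs (Q : CommitQC f Dig) : Set (Replica f × Stmt f Req Dig) :=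
  {p | p.1 ∈ Q.signers ∧ p.2 = if Q.fast then .prepVote Q.prop else .confirmAck Q.prop}

def Complaint.sigs (b : Complaint f Dig) : Set (Replica f × Stmt f Req Dig) :=
  {p | (∃ Q, b.highQC = some Q ∧ p ∈ Q.sigs) ∨ ∃ P, b.highProp = some P ∧ p ∈ P.sigs}

def TC.sigs (T : TC f Dig) : Set (Replica f × Stmt f Req Dig) :=
  {p | ∃ r b, T.complaints r = some b ∧ (p = (r, .timeout T.slot T.view b) ∨ p ∈ b.sigs)}

def Ticket.sigs : Ticket f Dig → Set (Replica f × Stmt f Req Dig)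
  | .start prev gate =>
      {p | (∃ P, prev = some P ∧ p ∈ P.sigs) ∨ ∃ Q, gate = some Q ∧ p ∈ Q.sigs}
  | .tc T => T.sigs

/-- All signatures contained in a message sent by `src`. -/
def Msg.sigs (src : Replica f) : Msg f Req Dig → Set (Replica f × Stmt f Req Dig)
  | .car d cert => {p | p = (d.lane, .car d) ∨ ∃ c, cert = some c ∧ p ∈ c.sigs}
  | .carVote l i x => {(src, .carVote l i x)}
  | .poa c => c.sigs
  | .ticket _ _ T => T.sigs
  | .prepare P T => P.sigs ∪ T.sigs
  | .prepVote P => {(src, .prepVote P)}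
  | .confirm Q => Q.sigs
  | .confirmAck P => {(src, .confirmAck P)}
  | .commit Q => Q.sigs
  | .timeout s v b => {p | p = (src, .timeout s v b) ∨ p ∈ b.sigs}
  | .sync c _ => c.sigs
  | .syncReply ds => {p | ∃ d ∈ ds, p = (d.lane, .car d)}

end Signatures

/-! ### Validity of certificates, tickets and proposals -/

section Validity

variable {f : ℕ} {Req Dig : Type*}

def PoA.Valid (c : PoA f Dig) : Prop := f + 1 ≤ c.signers.card

def PrepareQC.Valid (Q : PrepareQC f Dig) : Prop := 2 * f + 1 ≤ Q.signers.card

def CommitQC.Valid (Q : CommitQC f Dig) : Prop :=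
  if Q.fast then Q.signers = Finset.univ else 2 * f + 1 ≤ Q.signers.card

def Proposal.CutValid (P : Proposal f Dig) : Prop :=
  ∀ l c, P.cut l = some c → c.lane = l ∧ c.Valid

def Complaint.Valid (b : Complaint f Dig) (s v : ℕ) : Prop :=
  (∀ Q, b.highQC = some Q → Q.Valid ∧ Q.prop.slot = s ∧ Q.prop.view ≤ v) ∧
  (∀ P, b.highProp = some P → P.slot = s ∧ P.view ≤ v)

def TC.Valid (T : TC f Dig) : Prop :=
  (Finset.univ.filter fun r => (T.complaints r).isSome).card = 2 * f + 1 ∧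
  ∀ r b, T.complaints r = some b → b.Valid T.slot T.view

/-- `cut` is carried by a PrepareQC of view `w` in `T`. -/
def TC.QCFor (T : TC f Dig) (cut : Cut f Dig) (w : ℕ) : Prop :=
  ∃ r b Q, T.complaints r = some b ∧ b.highQC = some Q ∧ Q.prop.cut = cut ∧ Q.prop.view = w

/-- `cut` is the highest prepared proposal, in a view `≥ w`, of `f+1` of the replicas in `T`. A cut
that was proposed again in a later view counts as the same proposal. -/
def TC.PropFor (T : TC f Dig) (cut : Cut f Dig) (w : ℕ) : Prop :=
  ∃ S : Finset (Replica f), S.card = f + 1 ∧ ∀ r ∈ S, ∃ b P,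
    T.complaints r = some b ∧ b.highProp = some P ∧ P.cut = cut ∧ w ≤ P.view

/-- `cut` is the winning proposal of `T`: the highest among the PrepareQCs in `T` and the proposals
that are present `f+1` times in `T`, where a PrepareQC wins ties. -/
def TC.Wins (T : TC f Dig) (cut : Cut f Dig) : Prop :=
  (∃ w, T.QCFor cut w ∧ (∀ cut' w', T.QCFor cut' w' → w' ≤ w) ∧
      ∀ cut' w', T.PropFor cut' w' → w' ≤ w) ∨
  (∃ w, T.PropFor cut w ∧ (∀ cut' w', T.QCFor cut' w' → w' < w) ∧
      ∀ cut' w', T.PropFor cut' w' → w' ≤ w)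

def TC.NoWinner (T : TC f Dig) : Prop := ∀ cut, ¬ T.Wins cut

/-- The CommitQC that the start of slot `s` requires when parallelism is bounded. -/
def Config.GateValid (cfg : Config f Req Dig) (s : ℕ) (gate : Option (CommitQC f Dig)) : Prop :=
  match cfg.maxParallel with
  | none => gate = none
  | some k => if s < k then gate = none else ∃ Q, gate = some Q ∧ Q.Valid ∧ Q.prop.slot + k = s

/-- `T` is a valid ticket for slot `s`, view `v`. The first slot needs no preceding proposal. -/
def Config.TicketValid (cfg : Config f Req Dig) (s v : ℕ) : Ticket f Dig → Prop
  | .start prev gate => v = 0 ∧ cfg.GateValid s gate ∧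
      if s = 0 then prev = none else ∃ P, prev = some P ∧ P.slot + 1 = s ∧ P.CutValid
  | .tc T => T.Valid ∧ T.slot = s ∧ T.view + 1 = v

/-- A Prepare message is valid: its ticket and its tips are, and after a view change it carries the
winning proposal, if there is one. Coverage is not enforced. -/
def Config.PrepareValid (cfg : Config f Req Dig) (P : Proposal f Dig) (T : Ticket f Dig) : Prop :=
  cfg.TicketValid P.slot P.view T ∧ P.CutValid ∧
  ∀ C, T = .tc C → C.Wins P.cut ∨ C.NoWinner

/-- `ds` lists, from oldest to newest, the ancestors of `tip` in lane `l` (`tip` included) at the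
positions exceeding `lo`. -/
def Config.Segment (cfg : Config f Req Dig) (l : Replica f) (lo : ℕ) (tip : Option (PoA f Dig))
    (ds : List (DataProp f Req Dig)) : Prop :=
  ds.length = tipPos tip - lo ∧
  (∀ i d, ds[i]? = some d → d.lane = l ∧ d.pos = lo + 1 + i) ∧
  (∀ i d e, ds[i]? = some d → ds[i + 1]? = some e → e.parent = some (cfg.hash d)) ∧
  (∀ d c, ds.getLast? = some d → tip = some c → cfg.hash d = c.dig)

/-- `d` belongs to the history of the tip `c`: it is `c`'s proposal or an ancestor of it. -/
def Config.InHistory (cfg : Config f Req Dig) (c : PoA f Dig) (d : DataProp f Req Dig) : Prop :=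
  ∃ lo ds, cfg.Segment c.lane lo (some c) ds ∧ d ∈ ds

end Validity

/-! ### Replica state -/

/-- The local state of a replica. -/
structure RState (f : ℕ) (Req Dig : Type*) where
  /-- All messages received so far, with their (authenticated) senders. -/
  inbox : Set (Replica f × Msg f Req Dig)
  /-- Client requests that were received but not yet put into a batch. -/
  pool : List Req
  /-- The proposals of the replica's own lane, oldest first. -/
  own : List (DataProp f Req Dig)
  /-- The proof of availability of the last of them, once formed. -/
  ownCert : Option (PoA f Dig)
  /-- The data proposals the replica voted for, by lane and position. -/
  lanes : Replica f → ℕ → Option (DataProp f Req Dig)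
  /-- The latest certified tips. -/
  tips : Cut f Dig
  /-- The current view of every slot. -/
  view : ℕ → ℕ
  /-- When the timer of the current view of a slot expires; `none` before the slot's first ticket. -/
  deadline : ℕ → Option ℝ
  /-- One more than the largest view of a slot that the replica complained about (`0`: none); it
  takes no further part in the views `< givenUp s` of slot `s`. -/
  givenUp : ℕ → ℕ
  /-- The latest proposal of every slot that the replica sent a Prep-Vote for. -/
  prop : ℕ → Option (Proposal f Dig)
  /-- The latest PrepareQC of every slot that the replica acknowledged. -/
  conf : ℕ → Option (PrepareQC f Dig)
  /-- As leader of slot and view: the proposal sent. -/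
  led : ℕ → ℕ → Option (Proposal f Dig)
  /-- As leader of slot and view: until when to wait for a fast quorum. -/
  fastAt : ℕ → ℕ → Option ℝ
  /-- As leader: the slots and views in which a Confirm or fast Commit was sent. -/
  settled : Set (ℕ × ℕ)
  /-- As leader: the slots and views in which a slow Commit was sent. -/
  finished : Set (ℕ × ℕ)
  /-- The commit certificate of every locally committed slot. -/
  committed : ℕ → Option (CommitQC f Dig)
  /-- The Timeouts (sender, slot, view) that were answered with a CommitQC. -/
  helped : Set (Replica f × ℕ × ℕ)
  /-- The tips whose missing history was requested. -/
  asked : Set (PoA f Dig)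
  /-- The synchronization requests that were answered. -/
  answered : Set (Replica f × PoA f Dig × ℕ)
  /-- The next slot to execute. -/
  next : ℕ
  /-- The last executed position of every lane. -/
  lastCommit : Replica f → ℕ
  /-- The executed data proposals in order. The log of requests is the concatenation of their
  batches. -/
  log : List (DataProp f Req Dig)

/-- The initial state. -/
def RState.initial (f : ℕ) (Req Dig : Type*) : RState f Req Dig where
  inbox := ∅
  pool := []
  own := []
  ownCert := none
  lanes := fun _ _ => none
  tips := fun _ => none
  view := fun _ => 0
  deadline := fun _ => none
  givenUp := fun _ => 0
  prop := fun _ => none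
  conf := fun _ => none
  led := fun _ _ => none
  fastAt := fun _ _ => none
  settled := ∅
  finished := ∅
  committed := fun _ => none
  helped := ∅
  asked := ∅
  answered := ∅
  next := 0
  lastCommit := fun _ => 0
  log := []

section Protocol

variable {f : ℕ} {Req Dig : Type*}

/-- The data proposals in a replica's possession. -/
def RState.store (σ : RState f Req Dig) : Set (DataProp f Req Dig) :=
  {d | (∃ src cert, (src, .car d cert) ∈ σ.inbox) ∨
       ∃ src ds, (src, .syncReply ds) ∈ σ.inbox ∧ d ∈ ds}

/-- The next data proposal of replica `r`, with batch `B`. -/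
def Config.newCar (cfg : Config f Req Dig) (r : Replica f) (σ : RState f Req Dig) (B : List Req) :
    DataProp f Req Dig :=
  ⟨r, σ.own.length + 1, B, σ.own.getLast?.map cfg.hash⟩

/-- `d` extends a proposal that the replica voted for (or starts its lane), and `cert` is the proof
of availability of that parent. -/
def Config.FollowsParent (cfg : Config f Req Dig) (σ : RState f Req Dig) (d : DataProp f Req Dig)
    (cert : Option (PoA f Dig)) : Prop :=
  (d.pos = 1 ∧ d.parent = none ∧ cert = none) ∨
  ∃ i p c, σ.lanes d.lane i = some p ∧ d.pos = i + 1 ∧ d.parent = some (cfg.hash p) ∧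
    cert = some c ∧ c.Valid ∧ c.lane = d.lane ∧ c.pos = i ∧ c.dig = cfg.hash p

/-- Record the certified tip `c` if it is newer than the recorded one of its lane. -/
def improve (tips : Cut f Dig) (c : PoA f Dig) : Cut f Dig :=
  if tipPos (tips c.lane) < c.pos then Function.update tips c.lane (some c) else tips

/-- Lane coverage: at least `n - f` of the tips are newer than those in the preceding proposal. -/
def Covers (tips : Cut f Dig) (prev : Option (Proposal f Dig)) : Prop :=
  2 * f + 1 ≤ (Finset.univ.filter fun l =>
    tipPos (prev.elim none fun P => P.cut l) < tipPos (tips l)).card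

/-- The tickets for slot `s`, view `v`, that a replica observed: contained in a Prepare, forwarded
by some replica, or assembled from received messages. -/
inductive Config.Sees (cfg : Config f Req Dig) (σ : RState f Req Dig) :
    ℕ → ℕ → Ticket f Dig → Prop
  | inPrepare {src : Replica f} {P : Proposal f Dig} {T : Ticket f Dig}
      (hmem : (src, .prepare P T) ∈ σ.inbox) (hT : cfg.TicketValid P.slot P.view T) :
      Config.Sees cfg σ P.slot P.view T
  | forwarded {src : Replica f} {s v : ℕ} {T : Ticket f Dig}
      (hmem : (src, .ticket s v T) ∈ σ.inbox) (hT : cfg.TicketValid s v T) :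
      Config.Sees cfg σ s v T
  | preceding {s : ℕ} {prev : Option (Proposal f Dig)} {gate : Option (CommitQC f Dig)}
      (hT : cfg.TicketValid s 0 (.start prev gate))
      (hprev : ∀ P, prev = some P → ∃ T, cfg.PrepareValid P T ∧
        (leader P.slot P.view, .prepare P T) ∈ σ.inbox)
      (hgate : ∀ Q, gate = some Q → σ.committed Q.prop.slot = some Q) :
      Config.Sees cfg σ s 0 (.start prev gate)
  | timeouts {s v : ℕ} {C : TC f Dig}
      (hT : cfg.TicketValid s v (.tc C))
      (hmem : ∀ q b, C.complaints q = some b → (q, .timeout C.slot C.view b) ∈ σ.inbox) :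
      Config.Sees cfg σ s v (.tc C)

/-- Send `m` to every replica (including oneself). -/
def toAll (m : Msg f Req Dig) : Set (Replica f × Msg f Req Dig) := {p | p.2 = m}

/-- Send `m` to `q` only. -/
def toOne (q : Replica f) (m : Msg f Req Dig) : Set (Replica f × Msg f Req Dig) := {(q, m)}

/-- `cfg.Act t r σ σ' out`: at time `t` the protocol lets the correct replica `r` pass from the
local state `σ` to `σ'` while sending the messages `out` (destination, message). -/
inductive Config.Act (cfg : Config f Req Dig) (t : ℝ) (r : Replica f) :
    RState f Req Dig → RState f Req Dig → Set (Replica f × Msg f Req Dig) → Prop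
  /-- Broadcast the next car: a nonempty batch of waiting requests (oldest first), once the
  preceding car is certified. -/
  | proposeCar (σ : RState f Req Dig) (B rest : List Req)
      (hB : B ≠ []) (hpool : σ.pool = B ++ rest)
      (hready : σ.own = [] ∨ σ.ownCert ≠ none) :
      Config.Act cfg t r σ
        { σ with pool := rest, own := σ.own ++ [cfg.newCar r σ B], ownCert := none }
        (toAll (.car (cfg.newCar r σ B) σ.ownCert))
  /-- Vote for a car: in order, and at most once per lane and position. -/
  | voteCar (σ : RState f Req Dig) (d : DataProp f Req Dig) (cert : Option (PoA f Dig))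
      (hmem : (d.lane, .car d cert) ∈ σ.inbox)
      (hnew : σ.lanes d.lane d.pos = none)
      (hpar : cfg.FollowsParent σ d cert) :
      Config.Act cfg t r σ
        { σ with
          lanes := Function.update σ.lanes d.lane
            (Function.update (σ.lanes d.lane) d.pos (some d))
          tips := cert.elim σ.tips (improve σ.tips) }
        (toOne d.lane (.carVote d.lane d.pos (cfg.hash d)))
  /-- Assemble the proof of availability of the latest own car. If no request is waiting, it may be
  broadcast on its own; in any case it is attached to the next car. -/
  | certifyCar (σ : RState f Req Dig) (d : DataProp f Req Dig) (S : Finset (Replica f))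
      (out : Set (Replica f × Msg f Req Dig))
      (hlast : σ.own.getLast? = some d) (hcert : σ.ownCert = none)
      (hS : S.card = f + 1)
      (hvotes : ∀ q ∈ S, (q, .carVote r d.pos (cfg.hash d)) ∈ σ.inbox)
      (hout : out = ∅ ∨ (σ.pool = [] ∧ out = toAll (.poa ⟨r, d.pos, cfg.hash d, S⟩))) :
      Config.Act cfg t r σ
        { σ with
          ownCert := some ⟨r, d.pos, cfg.hash d, S⟩
          tips := improve σ.tips ⟨r, d.pos, cfg.hash d, S⟩ }
        out
  /-- Learn a certified tip from a broadcast proof of availability. -/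
  | learnTip (σ : RState f Req Dig) (src : Replica f) (c : PoA f Dig)
      (hmem : (src, .poa c) ∈ σ.inbox) (hc : c.Valid)
      (hnew : tipPos (σ.tips c.lane) < c.pos) :
      Config.Act cfg t r σ { σ with tips := improve σ.tips c } ∅
  /-- Enter a view upon first observing a ticket for it: start its timer and forward the ticket. -/
  | enter (σ : RState f Req Dig) (s v : ℕ) (T : Ticket f Dig)
      (hopen : σ.committed s = none) (hsee : cfg.Sees σ s v T)
      (hlate : σ.view s < v ∨ (v = 0 ∧ σ.view s = 0 ∧ σ.deadline s = none)) :
      Config.Act cfg t r σ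
        { σ with
          view := Function.update σ.view s v
          deadline := Function.update σ.deadline s (some (t + 10 * cfg.Δ)) }
        (toAll (.ticket s v T))
  /-- The leader of view `0` proposes its local cut, once there is coverage. -/
  | propose (σ : RState f Req Dig) (s : ℕ) (prev : Option (Proposal f Dig))
      (gate : Option (CommitQC f Dig))
      (hlead : r = leader s 0) (hopen : σ.committed s = none)
      (hview : σ.view s = 0) (hent : σ.deadline s ≠ none) (hup : σ.givenUp s = 0)
      (hled : σ.led s 0 = none)
      (hsee : cfg.Sees σ s 0 (.start prev gate)) (hcov : Covers σ.tips prev) :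
      Config.Act cfg t r σ
        { σ with
          led := Function.update σ.led s (Function.update (σ.led s) 0 (some ⟨s, 0, σ.tips⟩)) }
        (toAll (.prepare ⟨s, 0, σ.tips⟩ (.start prev gate)))
  /-- The leader of a later view proposes the winning proposal of the timeout certificate, or its
  local cut if there is no winning proposal. -/
  | repropose (σ : RState f Req Dig) (s v : ℕ) (C : TC f Dig) (cut : Cut f Dig)
      (hlead : r = leader s v) (hopen : σ.committed s = none)
      (hview : σ.view s = v) (hup : σ.givenUp s ≤ v)
      (hled : σ.led s v = none)
      (hsee : cfg.Sees σ s v (.tc C))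
      (hcut : C.Wins cut ∨ (C.NoWinner ∧ cut = σ.tips)) :
      Config.Act cfg t r σ
        { σ with
          led := Function.update σ.led s (Function.update (σ.led s) v (some ⟨s, v, cut⟩)) }
        (toAll (.prepare ⟨s, v, cut⟩ (.tc C)))
  /-- Vote for a valid Prepare of the current view, at most once per view. -/
  | prepVote (σ : RState f Req Dig) (P : Proposal f Dig) (T : Ticket f Dig)
      (hmem : (leader P.slot P.view, .prepare P T) ∈ σ.inbox) (hP : cfg.PrepareValid P T)
      (hopen : σ.committed P.slot = none)
      (hview : σ.view P.slot = P.view) (hent : σ.deadline P.slot ≠ none)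
      (hup : σ.givenUp P.slot ≤ P.view)
      (honce : ∀ P', σ.prop P.slot = some P' → P'.view < P.view) :
      Config.Act cfg t r σ
        { σ with prop := Function.update σ.prop P.slot (some P) }
        (toOne (leader P.slot P.view) (.prepVote P))
  /-- The leader has `n - f` Prep-Votes: wait briefly for the remaining ones. -/
  | awaitFast (σ : RState f Req Dig) (P : Proposal f Dig) (S : Finset (Replica f))
      (hled : σ.led P.slot P.view = some P) (hopen : σ.committed P.slot = none)
      (hview : σ.view P.slot = P.view) (hnew : σ.fastAt P.slot P.view = none)
      (hS : 2 * f + 1 ≤ S.card) (hvotes : ∀ q ∈ S, (q, .prepVote P) ∈ σ.inbox) :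
      Config.Act cfg t r σ
        { σ with
          fastAt := Function.update σ.fastAt P.slot
            (Function.update (σ.fastAt P.slot) P.view (some (t + cfg.fastWait))) }
        ∅
  /-- Fast path: the leader has all `n` Prep-Votes. -/
  | fastCommit (σ : RState f Req Dig) (P : Proposal f Dig)
      (hled : σ.led P.slot P.view = some P) (hopen : σ.committed P.slot = none)
      (hview : σ.view P.slot = P.view) (hnew : (P.slot, P.view) ∉ σ.settled)
      (hvotes : ∀ q, (q, .prepVote P) ∈ σ.inbox) :
      Config.Act cfg t r σ
        { σ with settled := insert (P.slot, P.view) σ.settled }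
        (toAll (.commit ⟨P, true, Finset.univ⟩))
  /-- Slow path: the wait is over and the leader broadcasts a PrepareQC. -/
  | confirm (σ : RState f Req Dig) (P : Proposal f Dig) (S : Finset (Replica f)) (a : ℝ)
      (hled : σ.led P.slot P.view = some P) (hopen : σ.committed P.slot = none)
      (hview : σ.view P.slot = P.view) (hnew : (P.slot, P.view) ∉ σ.settled)
      (hwait : σ.fastAt P.slot P.view = some a) (ha : a ≤ t)
      (hS : 2 * f + 1 ≤ S.card) (hvotes : ∀ q ∈ S, (q, .prepVote P) ∈ σ.inbox) :
      Config.Act cfg t r σ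
        { σ with settled := insert (P.slot, P.view) σ.settled }
        (toAll (.confirm ⟨P, S⟩))
  /-- Acknowledge a PrepareQC of the current view, at most once per view. -/
  | confirmAck (σ : RState f Req Dig) (Q : PrepareQC f Dig)
      (hmem : (leader Q.prop.slot Q.prop.view, .confirm Q) ∈ σ.inbox) (hQ : Q.Valid)
      (hopen : σ.committed Q.prop.slot = none)
      (hview : σ.view Q.prop.slot = Q.prop.view) (hup : σ.givenUp Q.prop.slot ≤ Q.prop.view)
      (honce : ∀ Q', σ.conf Q.prop.slot = some Q' → Q'.prop.view < Q.prop.view) :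
      Config.Act cfg t r σ
        { σ with conf := Function.update σ.conf Q.prop.slot (some Q) }
        (toOne (leader Q.prop.slot Q.prop.view) (.confirmAck Q.prop))
  /-- The leader broadcasts the CommitQC assembled from `n - f` acknowledgements. -/
  | slowCommit (σ : RState f Req Dig) (P : Proposal f Dig) (S : Finset (Replica f))
      (hled : σ.led P.slot P.view = some P) (hopen : σ.committed P.slot = none)
      (hview : σ.view P.slot = P.view) (hnew : (P.slot, P.view) ∉ σ.finished)
      (hS : 2 * f + 1 ≤ S.card) (hacks : ∀ q ∈ S, (q, .confirmAck P) ∈ σ.inbox) :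
      Config.Act cfg t r σ
        { σ with finished := insert (P.slot, P.view) σ.finished }
        (toAll (.commit ⟨P, false, S⟩))
  /-- Commit a slot upon receiving a CommitQC of any view. -/
  | commit (σ : RState f Req Dig) (src : Replica f) (Q : CommitQC f Dig)
      (hmem : (src, .commit Q) ∈ σ.inbox) (hQ : Q.Valid)
      (hopen : σ.committed Q.prop.slot = none) :
      Config.Act cfg t r σ
        { σ with committed := Function.update σ.committed Q.prop.slot (some Q) } ∅
  /-- The timer of the current view expires: complain. -/
  | timeout (σ : RState f Req Dig) (s : ℕ) (a : ℝ)
      (hopen : σ.committed s = none) (ha : σ.deadline s = some a) (hat : a ≤ t)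
      (hup : σ.givenUp s ≤ σ.view s) :
      Config.Act cfg t r σ
        { σ with givenUp := Function.update σ.givenUp s (σ.view s + 1) }
        (toAll (.timeout s (σ.view s) ⟨σ.conf s, σ.prop s⟩))
  /-- Join the mutiny against a view about which `f+1` replicas complained. -/
  | join (σ : RState f Req Dig) (s v : ℕ) (S : Finset (Replica f))
      (hopen : σ.committed s = none) (hview : σ.view s ≤ v) (hup : σ.givenUp s ≤ v)
      (hS : S.card = f + 1)
      (hmem : ∀ q ∈ S, ∃ b : Complaint f Dig, b.Valid s v ∧ (q, .timeout s v b) ∈ σ.inbox) :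
      Config.Act cfg t r σ
        { σ with
          view := Function.update σ.view s v
          givenUp := Function.update σ.givenUp s (v + 1) }
        (toAll (.timeout s v ⟨σ.conf s, σ.prop s⟩))
  /-- Answer a Timeout for a committed slot with the CommitQC. -/
  | help (σ : RState f Req Dig) (q : Replica f) (s v : ℕ) (b : Complaint f Dig)
      (Q : CommitQC f Dig)
      (hmem : (q, .timeout s v b) ∈ σ.inbox) (hcom : σ.committed s = some Q)
      (hnew : (q, s, v) ∉ σ.helped) :
      Config.Act cfg t r σ
        { σ with helped := insert (q, s, v) σ.helped } (toOne q (.commit Q))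
  /-- Request the missing history of a tip of a committed or voted-for proposal from the replicas
  that certified the tip. -/
  | sync (σ : RState f Req Dig) (P : Proposal f Dig) (l : Replica f) (c : PoA f Dig)
      (hP : σ.prop P.slot = some P ∨ ∃ Q, σ.committed P.slot = some Q ∧ Q.prop = P)
      (hc : P.cut l = some c) (hnew : c ∉ σ.asked)
      (hmiss : ¬ ∃ ds, cfg.Segment l (σ.lastCommit l) (some c) ds ∧ ∀ d ∈ ds, d ∈ σ.store) :
      Config.Act cfg t r σ
        { σ with asked := insert c σ.asked }
        {p | p.1 ∈ c.signers ∧ p.2 = .sync c (σ.lastCommit l)}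
  /-- Answer a request for the history of a tip that the replica voted for. -/
  | syncReply (σ : RState f Req Dig) (q : Replica f) (c : PoA f Dig) (lo : ℕ)
      (d : DataProp f Req Dig)
      (hmem : (q, .sync c lo) ∈ σ.inbox) (hd : σ.lanes c.lane c.pos = some d)
      (hdig : cfg.hash d = c.dig) (hnew : (q, c, lo) ∉ σ.answered) :
      Config.Act cfg t r σ
        { σ with answered := insert (q, c, lo) σ.answered }
        (toOne q (.syncReply
          ((List.range' (lo + 1) (c.pos - lo)).filterMap (σ.lanes c.lane))))
  /-- Execute the next slot, once it is committed and the new history of its tips is in possession: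
  append the zipped new proposals to the log. Old tips are ignored. -/
  | execute (σ : RState f Req Dig) (Q : CommitQC f Dig)
      (segs : Replica f → List (DataProp f Req Dig))
      (hcom : σ.committed σ.next = some Q)
      (hseg : ∀ l, cfg.Segment l (σ.lastCommit l) (Q.prop.cut l) (segs l))
      (hstore : ∀ l, ∀ d ∈ segs l, d ∈ σ.store) :
      Config.Act cfg t r σ
        { σ with
          next := σ.next + 1
          lastCommit := fun l => max (σ.lastCommit l) (tipPos (Q.prop.cut l))
          log := σ.log ++ cfg.zip segs }
        ∅

/-! ### Executions -/

/-- The events of an execution: nothing happens, a message of `src` is delivered at `dst`, a client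
request arrives at `r`, or the correct replica `r` takes a step and sends `out`. -/
inductive Event (f : ℕ) (Req Dig : Type*)
  | idle
  | deliver (src dst : Replica f) (m : Msg f Req Dig)
  | request (r : Replica f) (x : Req)
  | act (r : Replica f) (out : Set (Replica f × Msg f Req Dig))

/-- The effect of the event `e` at time `t` on the local states. (The states recorded for Byzantine
replicas have no meaning: they take no steps of the protocol and send what they like.) -/
def Config.Step (cfg : Config f Req Dig) (t : ℝ) (st st' : Replica f → RState f Req Dig) :
    Event f Req Dig → Prop
  | .idle => st' = st
  | .deliver src dst m => st' = Function.update st dst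
      { st dst with inbox := insert (src, m) (st dst).inbox }
  | .request r x => st' = Function.update st r { st r with pool := (st r).pool ++ [x] }
  | .act r out => ∃ σ', cfg.Act t r (st r) σ' out ∧ st' = Function.update st r σ'

/-- An execution under partial synchrony with a static Byzantine adversary. The event `ev i` happens
at time `time i` and leads from the states `st i` to `st (i + 1)`. -/
structure Execution (cfg : Config f Req Dig) where
  /-- The faulty replicas. -/
  byz : Finset (Replica f)
  byz_card : byz.card ≤ f
  /-- The global stabilization time. -/
  GST : ℝ
  time : ℕ → ℝ
  st : ℕ → Replica f → RState f Req Dig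
  ev : ℕ → Event f Req Dig
  time_zero : time 0 = 0
  time_mono : Monotone time
  /-- Only finitely many events happen in a bounded time. -/
  time_unbounded : Filter.Tendsto time Filter.atTop Filter.atTop
  start : ∀ r, st 0 r = RState.initial f Req Dig
  step : ∀ i, cfg.Step (time i) (st i) (st (i + 1)) (ev i)
  /-- Only correct replicas take steps of the protocol. -/
  act_correct : ∀ i r out, ev i = .act r out → r ∉ byz
  /-- Correct replicas act without delay: no time passes while a protocol step is possible. -/
  urgent : ∀ i t r, r ∉ byz → time i ≤ t → t < time (i + 1) →
    ¬ ∃ σ' out, cfg.Act t r (st (i + 1) r) σ' out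
  /-- Authenticated channels: a message delivered from a correct replica was sent by it. -/
  authentic : ∀ i src dst m, ev i = .deliver src dst m → src ∉ byz →
    ∃ j < i, ∃ out, ev j = .act src out ∧ (dst, m) ∈ out
  /-- Unforgeable signatures: a message of a Byzantine replica contains no signature of a correct
  replica except those that it already issued. -/
  unforgeable : ∀ i src dst m, ev i = .deliver src dst m → src ∈ byz →
    ∀ r σ, r ∉ byz → (r, σ) ∈ m.sigs src →
      ∃ j < i, ∃ out, ev j = .act r out ∧ ∃ p ∈ out, (r, σ) ∈ p.2.sigs r
  /-- Reliable channels between correct replicas, with delay at most `Δ` after `GST`. -/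
  delivery : ∀ i r out, ev i = .act r out → ∀ dst m, (dst, m) ∈ out → dst ∉ byz →
    ∃ j, i < j ∧ ev j = .deliver r dst m ∧ time j ≤ max (time i) GST + cfg.Δ

/-- The data proposal `d` is committed: it is in the history of a tip of a committed cut. -/
def RState.CommittedData (cfg : Config f Req Dig) (σ : RState f Req Dig)
    (d : DataProp f Req Dig) : Prop :=
  ∃ s Q l c, σ.committed s = some Q ∧ Q.prop.cut l = some c ∧ c.lane = l ∧ cfg.InHistory c d

/-- Every correct replica eventually has committed and executed `d` (for good). -/
def Execution.Finalized {cfg : Config f Req Dig} (E : Execution cfg) (d : DataProp f Req Dig) :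
    Prop :=
  ∀ r, r ∉ E.byz → ∀ᶠ j in Filter.atTop, (E.st j r).CommittedData cfg d ∧ d ∈ (E.st j r).log

/-- A continuous stream of requests: every correct replica keeps receiving client requests. -/
def Execution.ContinuousStream {cfg : Config f Req Dig} (E : Execution cfg) : Prop :=
  ∀ r, r ∉ E.byz → ∃ᶠ i in Filter.atTop, ∃ x, E.ev i = .request r x

/-- Some correct replica executes `x`. This is what a client can rely on that obtained matching
responses of `f+1` replicas. -/
def Execution.Answered {cfg : Config f Req Dig} (E : Execution cfg) (x : Req) : Prop :=
  ∃ j r, r ∉ E.byz ∧ ∃ d ∈ (E.st j r).log, x ∈ d.batch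

/-- The request `x` is issued by a correct client: it is sent to some replica, and as long as it is
not answered it is sent to further replicas until every replica has received it. -/
def Execution.CorrectClient {cfg : Config f Req Dig} (E : Execution cfg) (x : Req) : Prop :=
  (∃ i r, E.ev i = .request r x) ∧
  ∀ i r, E.ev i = .request r x →
    E.Answered x ∨
    (∃ j r', E.ev j = .request r' x ∧ ∀ k ≤ i, E.ev k ≠ .request r' x) ∨
    ∀ r', ∃ k ≤ i, E.ev k = .request r' x

end Protocol

end Autobahn

namespace Autobahn

variable {f : ℕ} {Req Dig : Type*} {cfg : Config f Req Dig} (E : Execution cfg)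

/-! ### Indices, steps and messages -/

namespace Execution

theorem exists_time_gt (t : ℝ) : ∃ k, t < E.time k :=
  (E.time_unbounded.eventually_gt_atTop t).exists

open Classical in
/-- The number of events up to time `t`: the state at the end of time `t` is `st (idx t)`. -/
noncomputable def idx (t : ℝ) : ℕ := Nat.find (E.exists_time_gt t)

theorem lt_idx {j : ℕ} {t : ℝ} : j < E.idx t ↔ E.time j ≤ t := by
  classical
  constructor
  · intro h
    exact not_lt.1 (Nat.find_min (E.exists_time_gt t) h)
  · intro h
    by_contra hc
    have h1 : t < E.time (E.idx t) := Nat.find_spec (E.exists_time_gt t)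
    exact absurd (h1.trans_le (E.time_mono (not_lt.1 hc))) (not_lt.2 h)

theorem idx_mono {t t' : ℝ} (h : t ≤ t') : E.idx t ≤ E.idx t' := by
  by_contra hc
  have := E.lt_idx.1 (not_le.1 hc)
  have h2 := E.lt_idx.2 (this.trans h)
  exact lt_irrefl _ h2

theorem lt_idx_time (i : ℕ) : i < E.idx (E.time i) := E.lt_idx.2 le_rfl

theorem time_nonneg (i : ℕ) : 0 ≤ E.time i := by
  rw [← E.time_zero]; exact E.time_mono (Nat.zero_le i)

theorem quiet {t : ℝ} (ht : 0 ≤ t) {r : Replica f} (hr : r ∉ E.byz) {σ' : RState f Req Dig}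
    {out : Set (Replica f × Msg f Req Dig)} : ¬ cfg.Act t r (E.st (E.idx t) r) σ' out := by
  have h0 : 0 < E.idx t := E.lt_idx.2 (by rw [E.time_zero]; exact ht)
  obtain ⟨j, hj⟩ := Nat.exists_eq_succ_of_ne_zero h0.ne'
  have h1 : E.time j ≤ t := E.lt_idx.1 (by omega)
  have h2 : t < E.time (j + 1) := by
    by_contra hc
    have := E.lt_idx.2 (not_lt.1 hc)
    omega
  intro h
  rw [hj] at h
  exact E.urgent j t r hr h1 h2 ⟨σ', out, h⟩

theorem act_step {i : ℕ} {r : Replica f} {out : Set (Replica f × Msg f Req Dig)}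
    (h : E.ev i = .act r out) :
    cfg.Act (E.time i) r (E.st i r) (E.st (i + 1) r) out := by
  have := E.step i
  rw [h] at this
  obtain ⟨σ', h1, h2⟩ := this
  rw [h2, Function.update_self]
  exact h1

theorem step_cases (i : ℕ) (q : Replica f) :
    E.st (i + 1) q = E.st i q ∨
    (∃ src m, E.ev i = .deliver src q m ∧
      E.st (i + 1) q = { E.st i q with inbox := insert (src, m) (E.st i q).inbox }) ∨
    (∃ x, E.ev i = .request q x ∧
      E.st (i + 1) q = { E.st i q with pool := (E.st i q).pool ++ [x] }) ∨
    ∃ out, E.ev i = .act q out ∧ cfg.Act (E.time i) q (E.st i q) (E.st (i + 1) q) out := by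
  have hs := E.step i
  cases he : E.ev i with
  | idle => rw [he] at hs; left; rw [show E.st (i + 1) = E.st i from hs]
  | deliver src dst m =>
    rw [he] at hs
    have hs' : E.st (i + 1) = _ := hs
    by_cases hq : q = dst
    · subst hq
      right; left
      exact ⟨src, m, rfl, by rw [hs', Function.update_self]⟩
    · left; rw [hs', Function.update_of_ne hq]
  | request r x =>
    rw [he] at hs
    have hs' : E.st (i + 1) = _ := hs
    by_cases hq : q = r
    · subst hq
      right; right; left
      exact ⟨x, rfl, by rw [hs', Function.update_self]⟩
    · left; rw [hs', Function.update_of_ne hq]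
  | act r out =>
    by_cases hq : q = r
    · subst hq
      right; right; right
      exact ⟨out, rfl, E.act_step he⟩
    · rw [he] at hs
      obtain ⟨σ', -, h2⟩ := hs
      left; rw [h2, Function.update_of_ne hq]

/-- Induction along an execution for the state of one replica. -/
theorem induct (q : Replica f) {I : ℕ → RState f Req Dig → Prop}
    (init : I 0 (RState.initial f Req Dig))
    (mono : ∀ i σ, I i σ → I (i + 1) σ)
    (recv : ∀ i σ src m, I i σ → I i { σ with inbox := insert (src, m) σ.inbox })
    (req : ∀ i σ x, I i σ → I i { σ with pool := σ.pool ++ [x] })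
    (act : ∀ i σ σ' out, E.ev i = .act q out → cfg.Act (E.time i) q σ σ' out →
      E.st i q = σ → E.st (i + 1) q = σ' → I i σ → I (i + 1) σ') :
    ∀ i, I i (E.st i q) := by
  intro i
  induction i with
  | zero => rw [E.start]; exact init
  | succ i ih =>
    rcases E.step_cases i q with h | ⟨src, m, -, h⟩ | ⟨x, -, h⟩ | ⟨out, he, h⟩
    · rw [h]; exact mono _ _ ih
    · rw [h]; exact mono _ _ (recv _ _ _ _ ih)
    · rw [h]; exact mono _ _ (req _ _ _ ih)
    · exact act i _ _ out he h rfl rfl ih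

/-- Relations between earlier and later states of a replica. -/
theorem state_rel (q : Replica f) {R : RState f Req Dig → RState f Req Dig → Prop}
    (refl : ∀ σ, R σ σ) (trans : ∀ a b c, R a b → R b c → R a c)
    (recv : ∀ σ src m, R σ { σ with inbox := insert (src, m) σ.inbox })
    (req : ∀ σ x, R σ { σ with pool := σ.pool ++ [x] })
    (act : ∀ t σ σ' out, cfg.Act t q σ σ' out → R σ σ') {i j : ℕ} (hij : i ≤ j) :
    R (E.st i q) (E.st j q) := by
  induction j, hij using Nat.le_induction with
  | base => exact refl _
  | succ j _ ih =>
    refine trans _ _ _ ih ?_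
    rcases E.step_cases j q with h | ⟨src, m, -, h⟩ | ⟨x, -, h⟩ | ⟨out, he, h⟩
    · rw [h]; exact refl _
    · rw [h]; exact recv _ _ _
    · rw [h]; exact req _ _
    · exact act _ _ _ _ h

/-- `r` sent `m` to `q` before the event `i`. -/
def Sent (i : ℕ) (r q : Replica f) (m : Msg f Req Dig) : Prop :=
  ∃ j < i, ∃ out, E.ev j = .act r out ∧ (q, m) ∈ out

/-- `r` sent `m` to someone before the event `i`. -/
def Said (i : ℕ) (r : Replica f) (m : Msg f Req Dig) : Prop := ∃ q, E.Sent i r q m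

variable {E}

theorem Sent.mono {i j : ℕ} (hij : i ≤ j) {r q : Replica f} {m : Msg f Req Dig}
    (h : E.Sent i r q m) : E.Sent j r q m := by
  obtain ⟨k, hk, h⟩ := h
  exact ⟨k, hk.trans_le hij, h⟩

theorem Said.mono {i j : ℕ} (hij : i ≤ j) {r : Replica f} {m : Msg f Req Dig}
    (h : E.Said i r m) : E.Said j r m := by
  obtain ⟨q, h⟩ := h
  exact ⟨q, h.mono hij⟩

theorem Sent.now {i : ℕ} {r q : Replica f} {m : Msg f Req Dig}
    {out : Set (Replica f × Msg f Req Dig)} (h : E.ev i = .act r out) (hm : (q, m) ∈ out) :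
    E.Sent (i + 1) r q m := ⟨i, Nat.lt_succ_self i, out, h, hm⟩

theorem Sent.said {i : ℕ} {r q : Replica f} {m : Msg f Req Dig} (h : E.Sent i r q m) :
    E.Said i r m := ⟨q, h⟩

theorem Sent.correct {i : ℕ} {r q : Replica f} {m : Msg f Req Dig} (h : E.Sent i r q m) :
    r ∉ E.byz := by
  obtain ⟨j, -, out, h, -⟩ := h
  exact E.act_correct _ _ _ h

theorem Sent.act {i : ℕ} {r q : Replica f} {m : Msg f Req Dig} (h : E.Sent i r q m) :
    ∃ j < i, ∃ out, E.ev j = .act r out ∧ (q, m) ∈ out ∧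
      cfg.Act (E.time j) r (E.st j r) (E.st (j + 1) r) out := by
  obtain ⟨j, hj, out, h, hm⟩ := h
  exact ⟨j, hj, out, h, hm, E.act_step h⟩

variable (E)

theorem inbox_mono (q : Replica f) {i j : ℕ} (hij : i ≤ j) :
    (E.st i q).inbox ⊆ (E.st j q).inbox := by
  refine E.state_rel q (R := fun σ σ' => σ.inbox ⊆ σ'.inbox) (fun _ => subset_rfl)
    (fun _ _ _ => Set.Subset.trans) (fun _ _ _ => Set.subset_insert _ _) (fun _ _ => subset_rfl)
    ?_ hij
  intro t σ σ' out h
  cases h <;> exact subset_rfl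

theorem deliver_of_mem_inbox {i : ℕ} {q src : Replica f} {m : Msg f Req Dig}
    (h : (src, m) ∈ (E.st i q).inbox) : ∃ j < i, E.ev j = .deliver src q m := by
  induction i with
  | zero => rw [E.start] at h; exact absurd h (Set.notMem_empty _)
  | succ i ih =>
    have mk : (src, m) ∈ (E.st i q).inbox → ∃ j < i + 1, E.ev j = .deliver src q m := fun h => by
      obtain ⟨j, hj, h⟩ := ih h
      exact ⟨j, hj.trans (Nat.lt_succ_self i), h⟩
    rcases E.step_cases i q with h' | ⟨src', m', he, h'⟩ | ⟨x, -, h'⟩ | ⟨out, he, h'⟩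
    · rw [h'] at h; exact mk h
    · rw [h'] at h
      rcases h with h | h
      · cases h; exact ⟨i, Nat.lt_succ_self i, he⟩
      · exact mk h
    · rw [h'] at h; exact mk h
    · apply mk
      generalize E.st (i + 1) q = σ' at h' h
      cases h' <;> exact h

theorem sent_of_mem_inbox {i : ℕ} {q src : Replica f} {m : Msg f Req Dig}
    (h : (src, m) ∈ (E.st i q).inbox) (hs : src ∉ E.byz) : E.Sent i src q m := by
  obtain ⟨j, hj, he⟩ := E.deliver_of_mem_inbox h
  obtain ⟨k, hk, out, h1, h2⟩ := E.authentic j src q m he hs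
  exact ⟨k, hk.trans hj, out, h1, h2⟩

/-- The latest arrival time of a message sent at time `t`. -/
def late (t : ℝ) : ℝ := max t E.GST + cfg.Δ

theorem lt_late (t : ℝ) : t < E.late t :=
  (le_max_left t E.GST).trans_lt (lt_add_of_pos_right _ cfg.Δ_pos)

theorem late_of_le {t : ℝ} (h : E.GST ≤ t) : E.late t = t + cfg.Δ := by
  rw [late, max_eq_left h]

variable {E}

theorem Sent.arrives {t : ℝ} {r q : Replica f} {m : Msg f Req Dig}
    (h : E.Sent (E.idx t) r q m) (hq : q ∉ E.byz) {t' : ℝ} (ht : E.late t ≤ t') :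
    (r, m) ∈ (E.st (E.idx t') q).inbox := by
  obtain ⟨j, hj, out, he, hm⟩ := h
  obtain ⟨k, hk, h1, h2⟩ := E.delivery j r out he q m hm hq
  have h3 : E.time k ≤ t' := by
    refine h2.trans (le_trans ?_ ht)
    unfold late
    have := E.lt_idx.1 hj
    gcongr
  have h4 := E.lt_idx.2 h3
  refine E.inbox_mono q h4 ?_
  rcases E.step_cases k q with h' | ⟨src', m', he', h'⟩ | ⟨x, he', h'⟩ | ⟨out, he', h'⟩
  · have := E.step k
    rw [h1] at this
    have hs' : E.st (k + 1) = _ := this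
    rw [hs', Function.update_self]
    exact Set.mem_insert _ _
  · rw [h1] at he'; cases he'; rw [h']; exact Set.mem_insert _ _
  · rw [h1] at he'; cases he'
  · rw [h1] at he'; cases he'

end Execution

/-! ### Quorums -/

theorem Execution.exists_correct {S : Finset (Replica f)} (hS : f + 1 ≤ S.card) :
    ∃ r ∈ S, r ∉ E.byz := by
  by_contra hc
  push Not at hc
  have := Finset.card_le_card (show S ⊆ E.byz from hc)
  have := E.byz_card
  omega

theorem Execution.exists_correct_inter {S S' : Finset (Replica f)} (hS : 2 * f + 1 ≤ S.card)
    (hS' : 2 * f + 1 ≤ S'.card) : ∃ r, r ∈ S ∧ r ∈ S' ∧ r ∉ E.byz := by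
  have h1 := Finset.card_union_add_card_inter S S'
  have h2 : (S ∪ S').card ≤ 3 * f + 1 := by
    simpa using Finset.card_le_univ (S ∪ S')
  obtain ⟨r, hr, h⟩ := E.exists_correct (S := S ∩ S') (by omega)
  rw [Finset.mem_inter] at hr
  exact ⟨r, hr.1, hr.2, h⟩

theorem Execution.card_correct : 2 * f + 1 ≤ (Finset.univ \ E.byz : Finset (Replica f)).card := by
  have h1 := Finset.card_sdiff_add_card (Finset.univ) E.byz
  have h2 := E.byz_card
  rw [Finset.union_eq_left.2 (Finset.subset_univ _)] at h1
  simp only [Finset.card_univ, Fintype.card_fin] at h1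
  omega

theorem Execution.card_correct_filter {S : Finset (Replica f)} (hS : 2 * f + 1 ≤ S.card) :
    ∃ S' ⊆ S, S'.card = f + 1 ∧ ∀ r ∈ S', r ∉ E.byz := by
  have h1 := Finset.le_card_sdiff E.byz S
  have h2 := E.byz_card
  obtain ⟨S', h3, h4⟩ := Finset.exists_subset_card_eq (s := S \ E.byz) (n := f + 1) (by omega)
  exact ⟨S', h3.trans Finset.sdiff_subset, h4, fun r hr => (Finset.mem_sdiff.1 (h3 hr)).2⟩

end Autobahn

namespace Autobahn

variable {f : ℕ} {Req Dig : Type*} {cfg : Config f Req Dig}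

/-! ### What a sent message tells about its sender -/

namespace Config.Act

variable {t : ℝ} {r q : Replica f} {σ σ' : RState f Req Dig} {out : Set (Replica f × Msg f Req Dig)}

theorem single (h : cfg.Act t r σ σ' out) : ∃ m, ∀ p ∈ out, p.2 = m := by
  cases h
  case certifyCar d S _ _ _ _ hout =>
    rcases hout with rfl | ⟨-, rfl⟩
    · exact ⟨.poa ⟨r, d.pos, cfg.hash d, S⟩, fun p hp => absurd hp (Set.notMem_empty _)⟩
    · exact ⟨_, fun p hp => hp⟩
  case commit Q _ _ _ => exact ⟨.commit Q, fun p hp => absurd hp (Set.notMem_empty _)⟩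
  case learnTip c _ _ _ => exact ⟨.poa c, fun p hp => absurd hp (Set.notMem_empty _)⟩
  case awaitFast P S _ _ _ _ _ _ => exact ⟨.prepVote P, fun p hp => absurd hp (Set.notMem_empty _)⟩
  case execute Q _ _ _ _ => exact ⟨.commit Q, fun p hp => absurd hp (Set.notMem_empty _)⟩
  case sync => exact ⟨_, fun p hp => hp.2⟩
  all_goals first
    | exact ⟨_, fun p hp => hp⟩
    | exact ⟨_, fun p hp => congrArg Prod.snd (Set.mem_singleton_iff.1 hp)⟩

theorem of_car {d : DataProp f Req Dig} {cert : Option (PoA f Dig)}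
    (h : cfg.Act t r σ σ' out) (hm : (q, Msg.car d cert) ∈ out) :
    ∃ B rest, d = cfg.newCar r σ B ∧ cert = σ.ownCert ∧ (σ.own = [] ∨ σ.ownCert ≠ none) ∧
      σ' = { σ with pool := rest, own := σ.own ++ [d], ownCert := none } := by
  cases h <;> try simp [toAll, toOne] at hm
  case proposeCar B rest hB hpool hready =>
    obtain ⟨rfl, rfl⟩ := hm
    exact ⟨B, rest, rfl, rfl, hready, rfl⟩
  case certifyCar hout =>
    rcases hout with rfl | ⟨-, rfl⟩ <;> simp [toAll] at hm

theorem of_carVote {l : Replica f} {p : ℕ} {x : Dig}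
    (h : cfg.Act t r σ σ' out) (hm : (q, Msg.carVote l p x) ∈ out) :
    ∃ d, σ'.lanes l p = some d ∧ cfg.hash d = x := by
  cases h <;> try simp [toAll, toOne] at hm
  case voteCar d cert hmem hnew hpar =>
    obtain ⟨rfl, rfl, rfl, rfl⟩ := hm
    exact ⟨d, by simp, rfl⟩
  case certifyCar hout =>
    rcases hout with rfl | ⟨-, rfl⟩ <;> simp [toAll] at hm

theorem of_poa {c : PoA f Dig} (h : cfg.Act t r σ σ' out) (hm : (q, Msg.poa c) ∈ out) :
    ∀ q ∈ c.signers, (q, .carVote c.lane c.pos c.dig) ∈ σ.inbox := by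
  cases h <;> try simp [toAll, toOne] at hm
  case certifyCar d S hlast hcert hS hvotes hout =>
    rcases hout with rfl | ⟨-, rfl⟩ <;> simp [toAll] at hm
    subst hm
    exact hvotes

theorem of_ticket {s v : ℕ} {T : Ticket f Dig} (h : cfg.Act t r σ σ' out)
    (hm : (q, Msg.ticket s v T) ∈ out) :
    (∀ p, (p, Msg.ticket s v T) ∈ out) ∧ σ.committed s = none ∧ cfg.Sees σ s v T ∧
      σ' = { σ with view := Function.update σ.view s v
                    deadline := Function.update σ.deadline s (some (t + 10 * cfg.Δ)) } := by
  cases h <;> try simp [toAll, toOne] at hm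
  case certifyCar hout =>
    rcases hout with rfl | ⟨-, rfl⟩ <;> simp [toAll] at hm
  case enter hopen hsee hlate =>
    obtain ⟨rfl, rfl, rfl⟩ := hm
    exact ⟨fun p => rfl, hopen, hsee, rfl⟩

theorem of_prepare {P : Proposal f Dig} {T : Ticket f Dig} (h : cfg.Act t r σ σ' out)
    (hm : (q, Msg.prepare P T) ∈ out) :
    (∀ p, (p, Msg.prepare P T) ∈ out) ∧ r = leader P.slot P.view ∧
      cfg.Sees σ P.slot P.view T ∧ σ.led P.slot P.view = none ∧ σ'.led P.slot P.view = some P ∧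
      (P.cut = σ.tips ∧ (∀ C, T = .tc C → C.NoWinner) ∨ ∃ C, T = .tc C ∧ C.Wins P.cut) := by
  cases h <;> try simp [toAll, toOne] at hm
  case certifyCar hout =>
    rcases hout with rfl | ⟨-, rfl⟩ <;> simp [toAll] at hm
  case propose hled hsee hcov =>
    obtain ⟨rfl, rfl⟩ := hm
    exact ⟨fun p => rfl, ‹_›, hsee, hled, by simp, .inl ⟨rfl, by simp⟩⟩
  case repropose hled hsee hcut =>
    obtain ⟨rfl, rfl⟩ := hm
    refine ⟨fun p => rfl, ‹_›, hsee, hled, by simp, ?_⟩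
    rcases hcut with h | ⟨h1, h2⟩
    · exact .inr ⟨_, rfl, h⟩
    · exact .inl ⟨h2, fun C hC => by cases hC; exact h1⟩

theorem of_prepVote {P : Proposal f Dig} (h : cfg.Act t r σ σ' out)
    (hm : (q, Msg.prepVote P) ∈ out) :
    q = leader P.slot P.view ∧
    (∃ T, (leader P.slot P.view, .prepare P T) ∈ σ.inbox ∧ cfg.PrepareValid P T) ∧
      σ.committed P.slot = none ∧ σ.view P.slot = P.view ∧ σ.deadline P.slot ≠ none ∧
      σ.givenUp P.slot ≤ P.view ∧ (∀ P', σ.prop P.slot = some P' → P'.view < P.view) ∧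
      σ' = { σ with prop := Function.update σ.prop P.slot (some P) } := by
  cases h <;> try simp [toAll, toOne] at hm
  case certifyCar hout =>
    rcases hout with rfl | ⟨-, rfl⟩ <;> simp [toAll] at hm
  case prepVote T hmem hP hopen hview hent hup honce =>
    obtain ⟨rfl, rfl⟩ := hm
    exact ⟨rfl, ⟨T, hmem, hP⟩, hopen, hview, hent, hup, honce, rfl⟩

theorem of_confirm {Q : PrepareQC f Dig} (h : cfg.Act t r σ σ' out)
    (hm : (q, Msg.confirm Q) ∈ out) :
    (∀ p, (p, Msg.confirm Q) ∈ out) ∧ σ.led Q.prop.slot Q.prop.view = some Q.prop ∧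
      Q.Valid ∧ ∀ p ∈ Q.signers, (p, .prepVote Q.prop) ∈ σ.inbox := by
  cases h <;> try simp [toAll, toOne] at hm
  case certifyCar hout =>
    rcases hout with rfl | ⟨-, rfl⟩ <;> simp [toAll] at hm
  case confirm hS hvotes =>
    subst hm
    exact ⟨fun p => rfl, ‹_›, hS, hvotes⟩

theorem of_confirmAck {P : Proposal f Dig} (h : cfg.Act t r σ σ' out)
    (hm : (q, Msg.confirmAck P) ∈ out) :
    q = leader P.slot P.view ∧ ∃ Q : PrepareQC f Dig, Q.prop = P ∧ Q.Valid ∧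
      (leader P.slot P.view, .confirm Q) ∈ σ.inbox ∧ σ.givenUp P.slot ≤ P.view ∧
      σ' = { σ with conf := Function.update σ.conf P.slot (some Q) } := by
  cases h <;> try simp [toAll, toOne] at hm
  case certifyCar hout =>
    rcases hout with rfl | ⟨-, rfl⟩ <;> simp [toAll] at hm
  case confirmAck Q hmem hQ hopen hview hup honce =>
    obtain ⟨rfl, rfl⟩ := hm
    exact ⟨rfl, Q, rfl, hQ, hmem, hup, rfl⟩

theorem of_commit {Q : CommitQC f Dig} (h : cfg.Act t r σ σ' out)
    (hm : (q, Msg.commit Q) ∈ out) :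
    (∀ p ∈ Q.signers, (p, if Q.fast then .prepVote Q.prop else .confirmAck Q.prop) ∈ σ.inbox) ∨
      ∃ s, σ.committed s = some Q := by
  cases h <;> try simp [toAll, toOne] at hm
  case certifyCar hout =>
    rcases hout with rfl | ⟨-, rfl⟩ <;> simp [toAll] at hm
  case fastCommit hvotes =>
    subst hm
    exact .inl fun p _ => by simpa using hvotes p
  case slowCommit hacks =>
    subst hm
    exact .inl fun p hp => by simpa using hacks p hp
  case help hcom hnew =>
    obtain ⟨-, rfl⟩ := hm
    exact .inr ⟨_, hcom⟩

theorem of_timeout {s v : ℕ} {b : Complaint f Dig} (h : cfg.Act t r σ σ' out)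
    (hm : (q, Msg.timeout s v b) ∈ out) :
    (∀ p, (p, Msg.timeout s v b) ∈ out) ∧
      b = ⟨σ.conf s, σ.prop s⟩ ∧ σ.committed s = none ∧ σ.givenUp s ≤ v ∧ σ'.givenUp s = v + 1 ∧
      σ.view s ≤ v ∧
      ((σ.view s = v ∧ ∃ a, σ.deadline s = some a ∧ a ≤ t) ∨
        ∃ S : Finset (Replica f), S.card = f + 1 ∧
          ∀ p ∈ S, ∃ b : Complaint f Dig, (p, .timeout s v b) ∈ σ.inbox) := by
  cases h <;> try simp [toAll, toOne] at hm
  case certifyCar hout =>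
    rcases hout with rfl | ⟨-, rfl⟩ <;> simp [toAll] at hm
  case timeout a hopen ha hat hup =>
    obtain ⟨rfl, rfl, rfl⟩ := hm
    exact ⟨fun p => rfl, rfl, hopen, hup, by simp, le_rfl, .inl ⟨rfl, _, ha, hat⟩⟩
  case join S hopen hview hup hS hmem =>
    obtain ⟨rfl, rfl, rfl⟩ := hm
    exact ⟨fun p => rfl, rfl, hopen, hup, by simp, hview,
      .inr ⟨S, hS, fun p hp => (hmem p hp).imp fun b hb => hb.2⟩⟩

theorem of_sync {c : PoA f Dig} {lo : ℕ} (h : cfg.Act t r σ σ' out)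
    (hm : (q, Msg.sync c lo) ∈ out) :
    ∃ (P : Proposal f Dig) (l : Replica f), P.cut l = some c ∧
      (σ.prop P.slot = some P ∨ ∃ Q, σ.committed P.slot = some Q ∧ Q.prop = P) := by
  cases h <;> try simp [toAll, toOne] at hm
  case certifyCar hout =>
    rcases hout with rfl | ⟨-, rfl⟩ <;> simp [toAll] at hm
  case sync P l c hP hc hnew hmiss =>
    obtain ⟨-, rfl, rfl⟩ := hm
    exact ⟨P, l, hc, hP⟩

end Config.Act

/-! ### Fields that only grow -/

/-- The part of the local state that only grows. -/
structure RState.Le (σ σ' : RState f Req Dig) : Prop where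
  lanes : ∀ l p d, σ.lanes l p = some d → σ'.lanes l p = some d
  view : ∀ s, σ.view s ≤ σ'.view s
  givenUp : ∀ s, σ.givenUp s ≤ σ'.givenUp s
  prop : ∀ s P, σ.prop s = some P → ∃ P', σ'.prop s = some P' ∧ P.view ≤ P'.view
  conf : ∀ s P, σ.conf s = some P → ∃ P', σ'.conf s = some P' ∧ P.prop.view ≤ P'.prop.view
  committed : ∀ s Q, σ.committed s = some Q → σ'.committed s = some Q
  led : ∀ s v P, σ.led s v = some P → σ'.led s v = some P
  tips : ∀ l, tipPos (σ.tips l) ≤ tipPos (σ'.tips l)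
  own : σ.own <+: σ'.own
  next : σ.next ≤ σ'.next
  lastCommit : ∀ l, σ.lastCommit l ≤ σ'.lastCommit l
  log : σ.log <+: σ'.log
  store : σ.store ⊆ σ'.store
  own_eq : σ'.own.length = σ.own.length → (∀ d ∈ σ.ownCert, d ∈ σ'.ownCert)
  deadline_eq : ∀ s, σ'.view s = σ.view s → ∀ a, σ.deadline s = some a → σ'.deadline s = some a

theorem tipPos_le_improve (tips : Cut f Dig) (c : PoA f Dig) (l : Replica f) :
    tipPos (tips l) ≤ tipPos (improve tips c l) := by
  unfold improve
  split_ifs with h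
  · by_cases hl : l = c.lane
    · subst hl; simpa [tipPos] using h.le
    · rw [Function.update_of_ne hl]
  · exact le_rfl

theorem pos_le_improve (tips : Cut f Dig) (c : PoA f Dig) :
    c.pos ≤ tipPos (improve tips c c.lane) := by
  unfold improve
  split_ifs with h
  · simp [tipPos]
  · exact not_lt.1 h

theorem improve_eq (tips : Cut f Dig) (c c' : PoA f Dig) (l : Replica f)
    (h : improve tips c l = some c') : tips l = some c' ∨ (l = c.lane ∧ c' = c) := by
  unfold improve at h
  split_ifs at h
  · by_cases hl : l = c.lane
    · subst hl; right; simpa using h.symm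
    · rw [Function.update_of_ne hl] at h; exact .inl h
  · exact .inl h

theorem RState.Le.refl (σ : RState f Req Dig) : σ.Le σ where
  lanes _ _ _ h := h
  view _ := le_rfl
  givenUp _ := le_rfl
  prop _ P h := ⟨P, h, le_rfl⟩
  conf _ P h := ⟨P, h, le_rfl⟩
  committed _ _ h := h
  led _ _ _ h := h
  tips _ := le_rfl
  own := List.prefix_rfl
  next := le_rfl
  lastCommit _ := le_rfl
  log := List.prefix_rfl
  store := subset_rfl
  own_eq _ _ h := h
  deadline_eq _ _ _ h := h

theorem RState.Le.trans {a b c : RState f Req Dig} (h : a.Le b) (h' : b.Le c) : a.Le c where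
  lanes l p d hd := h'.lanes _ _ _ (h.lanes _ _ _ hd)
  view s := (h.view s).trans (h'.view s)
  givenUp s := (h.givenUp s).trans (h'.givenUp s)
  prop s P hP := by
    obtain ⟨P', h1, h2⟩ := h.prop s P hP
    obtain ⟨P'', h3, h4⟩ := h'.prop s P' h1
    exact ⟨P'', h3, h2.trans h4⟩
  conf s P hP := by
    obtain ⟨P', h1, h2⟩ := h.conf s P hP
    obtain ⟨P'', h3, h4⟩ := h'.conf s P' h1
    exact ⟨P'', h3, h2.trans h4⟩
  committed s Q hQ := h'.committed _ _ (h.committed _ _ hQ)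
  led s v P hP := h'.led _ _ _ (h.led _ _ _ hP)
  tips l := (h.tips l).trans (h'.tips l)
  own := h.own.trans h'.own
  next := h.next.trans h'.next
  lastCommit l := (h.lastCommit l).trans (h'.lastCommit l)
  log := h.log.trans h'.log
  store := h.store.trans h'.store
  own_eq he d hd := by
    have h1 := h.own.length_le
    have h2 := h'.own.length_le
    exact h'.own_eq (by omega) d (h.own_eq (by omega) d hd)
  deadline_eq s he a ha := by
    have h1 := h.view s
    have h2 := h'.view s
    exact h'.deadline_eq s (by omega) a (h.deadline_eq s (by omega) a ha)

theorem RState.store_subset {σ σ' : RState f Req Dig} (h : σ.inbox ⊆ σ'.inbox) :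
    σ.store ⊆ σ'.store := by
  rintro d (⟨src, cert, hd⟩ | ⟨src, ds, hd, hm⟩)
  · exact .inl ⟨src, cert, h hd⟩
  · exact .inr ⟨src, ds, h hd, hm⟩

theorem update_update_of_none {α β γ : Type*} [DecidableEq α] [DecidableEq β]
    {F : α → β → Option γ} {a a' : α} {b b' : β} {x : Option γ} {y : γ} (h : F a b = none)
    (h' : F a' b' = some y) :
    Function.update F a (Function.update (F a) b x) a' b' = some y := by
  by_cases ha : a' = a
  · subst ha
    rw [Function.update_self]
    by_cases hb : b' = b
    · subst hb; rw [h] at h'; cases h'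
    · rwa [Function.update_of_ne hb]
  · rwa [Function.update_of_ne ha]

theorem Config.Act.le {t : ℝ} {r : Replica f} {σ σ' : RState f Req Dig}
    {out : Set (Replica f × Msg f Req Dig)} (h : cfg.Act t r σ σ' out) : σ.Le σ' := by
  cases h
  case proposeCar =>
    exact { RState.Le.refl σ with own := List.prefix_append _ _, own_eq := by simp }
  case voteCar d cert hmem hnew hpar =>
    refine { RState.Le.refl σ with lanes := ?_, tips := ?_ }
    · intro l p d' hd'
      exact update_update_of_none hnew hd'
    · intro l
      cases cert with
      | none => exact le_rfl
      | some c => exact tipPos_le_improve _ _ _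
  case certifyCar hout _ _ _ _ =>
    exact { RState.Le.refl σ with
      tips := fun l => tipPos_le_improve _ _ _
      own_eq := fun _ d hd => by simp_all }
  case learnTip => exact { RState.Le.refl σ with tips := fun l => tipPos_le_improve _ _ _ }
  case enter s v T hopen hsee hlate =>
    refine { RState.Le.refl σ with view := ?_, deadline_eq := ?_ }
    · intro s'
      by_cases hs : s' = s
      · subst hs; simp; omega
      · simp [hs]
    · intro s' h' a ha
      by_cases hs : s' = s
      · subst hs
        simp at h'
        rcases hlate with h | ⟨-, -, h⟩
        · omega
        · rw [h] at ha; cases ha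
      · simpa [hs] using ha
  case propose hled _ _ =>
    exact { RState.Le.refl σ with led := fun s' v' P h' => update_update_of_none hled h' }
  case repropose hled _ _ =>
    exact { RState.Le.refl σ with led := fun s' v' P h' => update_update_of_none hled h' }
  case prepVote P T hmem hP hopen hview hent hup honce =>
    refine { RState.Le.refl σ with prop := ?_ }
    intro s P' h'
    by_cases hs : s = P.slot
    · subst hs; exact ⟨P, by simp, (honce _ h').le⟩
    · exact ⟨P', by simpa [hs] using h', le_rfl⟩
  case confirmAck Q hmem hQ hopen hview hup honce =>
    refine { RState.Le.refl σ with conf := ?_ }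
    intro s Q' h'
    by_cases hs : s = Q.prop.slot
    · subst hs; exact ⟨Q, by simp, (honce _ h').le⟩
    · exact ⟨Q', by simpa [hs] using h', le_rfl⟩
  case commit src Q hmem hQ hopen =>
    refine { RState.Le.refl σ with committed := ?_ }
    intro s Q' h'
    by_cases hs : s = Q.prop.slot
    · subst hs; rw [hopen] at h'; cases h'
    · simpa [hs] using h'
  case timeout s a hopen ha hat hup =>
    refine { RState.Le.refl σ with givenUp := ?_ }
    intro s'
    by_cases hs : s' = s
    · subst hs; simp; omega
    · simp [hs]
  case join s v S hopen hview hup hS hmem =>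
    refine { RState.Le.refl σ with givenUp := ?_, view := ?_, deadline_eq := fun _ _ _ h => h }
    · intro s'
      by_cases hs : s' = s
      · subst hs; simp; omega
      · simp [hs]
    · intro s'
      by_cases hs : s' = s
      · subst hs; simp; omega
      · simp [hs]
  case sync => exact { RState.Le.refl σ with log := List.prefix_rfl }
  case execute =>
    exact { RState.Le.refl σ with
      next := Nat.le_succ _
      lastCommit := fun l => le_max_left _ _
      log := List.prefix_append _ _ }
  all_goals exact { RState.Le.refl σ with }

theorem Execution.le (E : Execution cfg) (q : Replica f) {i j : ℕ} (hij : i ≤ j) :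
    (E.st i q).Le (E.st j q) :=
  E.state_rel q RState.Le.refl (fun _ _ _ => RState.Le.trans)
    (fun σ _ _ => { RState.Le.refl σ with store := RState.store_subset (Set.subset_insert _ _) })
    (fun σ _ => { RState.Le.refl σ with }) (fun _ _ _ _ h => h.le) hij

end Autobahn

namespace Autobahn

variable {f : ℕ} {Req Dig : Type*} {cfg : Config f Req Dig} (E : Execution cfg)

/-! ### Where the local state comes from -/

namespace Execution

/-- `r` enters view `v` of slot `s` with the event `j`. -/
def EntersAt (j : ℕ) (r : Replica f) (s v : ℕ) : Prop :=
  ∃ T out, E.ev j = .act r out ∧ (r, Msg.ticket s v T) ∈ out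

theorem committed_origin {i s : ℕ} {r : Replica f} {Q : CommitQC f Dig}
    (h : (E.st i r).committed s = some Q) :
    Q.Valid ∧ Q.prop.slot = s ∧ ∃ src, (src, .commit Q) ∈ (E.st i r).inbox := by
  revert s Q
  refine E.induct r (I := fun _ σ => ∀ {s : ℕ} {Q : CommitQC f Dig}, σ.committed s = some Q →
    Q.Valid ∧ Q.prop.slot = s ∧ ∃ src, (src, .commit Q) ∈ σ.inbox) ?_ ?_ ?_ ?_ ?_ i
  · intro s Q h; cases h
  · exact fun i σ h => h
  · intro i σ src m h s Q h'
    obtain ⟨h1, h2, src', h3⟩ := h h'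
    exact ⟨h1, h2, src', .inr h3⟩
  · exact fun i σ x h => h
  · intro i σ σ' out he hact hst hst' hI
    cases hact
    case commit src Q hmem hQ hopen =>
      intro s Q' h
      by_cases hs : s = Q.prop.slot
      · subst hs
        simp at h
        subst h
        exact ⟨hQ, rfl, src, hmem⟩
      · simp only [ne_eq, hs, not_false_eq_true, Function.update_of_ne] at h
        exact hI h
    all_goals exact hI

theorem conf_origin {i s : ℕ} {r : Replica f} {Q : PrepareQC f Dig}
    (h : (E.st i r).conf s = some Q) :
    Q.Valid ∧ Q.prop.slot = s ∧ (leader Q.prop.slot Q.prop.view, .confirm Q) ∈ (E.st i r).inbox ∧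
      Q.prop.view ≤ (E.st i r).view s ∧
      E.Sent i r (leader Q.prop.slot Q.prop.view) (.confirmAck Q.prop) := by
  have key := E.induct r (I := fun i σ => ∀ s Q, σ.conf s = some Q →
    Q.Valid ∧ Q.prop.slot = s ∧ (leader Q.prop.slot Q.prop.view, .confirm Q) ∈ σ.inbox ∧
      Q.prop.view ≤ σ.view s ∧
      E.Sent i r (leader Q.prop.slot Q.prop.view) (.confirmAck Q.prop)) ?_ ?_ ?_ ?_ ?_ i
  · exact key s Q h
  · intro s Q h; cases h
  · intro i σ h s Q h'
    obtain ⟨h1, h2, h3, h4, h5⟩ := h s Q h'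
    exact ⟨h1, h2, h3, h4, h5.mono (Nat.le_succ i)⟩
  · intro i σ src m h s Q h'
    obtain ⟨h1, h2, h3, h4⟩ := h s Q h'
    exact ⟨h1, h2, .inr h3, h4⟩
  · exact fun i σ x h => h
  · intro i σ σ' out he hact hst hst' hI
    have hle := hact.le
    have hI : ∀ s Q, σ.conf s = some Q →
        Q.Valid ∧ Q.prop.slot = s ∧ (leader Q.prop.slot Q.prop.view, .confirm Q) ∈ σ.inbox ∧
        Q.prop.view ≤ σ'.view s ∧
        E.Sent (i + 1) r (leader Q.prop.slot Q.prop.view) (.confirmAck Q.prop) := by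
      intro s Q h'
      obtain ⟨h1, h2, h3, h4, h5⟩ := hI s Q h'
      exact ⟨h1, h2, h3, h4.trans (hle.view s), h5.mono (Nat.le_succ i)⟩
    cases hact
    case confirmAck Q hmem hQ hopen hview hup honce =>
      intro s Q' h
      by_cases hs : s = Q.prop.slot
      · subst hs
        simp at h
        subst h
        exact ⟨hQ, rfl, hmem, hview.ge, Sent.now he (Set.mem_singleton _)⟩
      · simp only [ne_eq, hs, not_false_eq_true, Function.update_of_ne] at h
        exact hI _ _ h
    all_goals exact hI

theorem prop_origin {i s : ℕ} {r : Replica f} {P : Proposal f Dig}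
    (h : (E.st i r).prop s = some P) :
    P.slot = s ∧ P.view ≤ (E.st i r).view s ∧ E.Sent i r (leader P.slot P.view) (.prepVote P) := by
  have key := E.induct r (I := fun i σ => ∀ s P, σ.prop s = some P →
    P.slot = s ∧ P.view ≤ σ.view s ∧ E.Sent i r (leader P.slot P.view) (.prepVote P))
      ?_ ?_ ?_ ?_ ?_ i
  · exact key s P h
  · intro s Q h; cases h
  · intro i σ h s Q h'
    obtain ⟨h1, h2, h3⟩ := h s Q h'
    exact ⟨h1, h2, h3.mono (Nat.le_succ i)⟩
  · exact fun i σ src m h => h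
  · exact fun i σ x h => h
  · intro i σ σ' out he hact hst hst' hI
    have hle := hact.le
    have hI : ∀ s P, σ.prop s = some P →
        P.slot = s ∧ P.view ≤ σ'.view s ∧
        E.Sent (i + 1) r (leader P.slot P.view) (.prepVote P) := by
      intro s P h'
      obtain ⟨h1, h2, h3⟩ := hI s P h'
      exact ⟨h1, h2.trans (hle.view s), h3.mono (Nat.le_succ i)⟩
    cases hact
    case prepVote P T hmem hP hopen hview hent hup honce =>
      intro s P' h
      by_cases hs : s = P.slot
      · subst hs
        simp at h
        subst h
        exact ⟨rfl, hview.ge, Sent.now he (Set.mem_singleton _)⟩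
      · simp only [ne_eq, hs, not_false_eq_true, Function.update_of_ne] at h
        exact hI _ _ h
    all_goals exact hI

theorem led_origin {i s v : ℕ} {r : Replica f} {P : Proposal f Dig}
    (h : (E.st i r).led s v = some P) :
    P.slot = s ∧ P.view = v ∧ ∃ T, ∀ q, E.Sent i r q (.prepare P T) := by
  have key := E.induct r (I := fun i σ => ∀ s v P, σ.led s v = some P →
    P.slot = s ∧ P.view = v ∧ ∃ T, ∀ q, E.Sent i r q (.prepare P T)) ?_ ?_ ?_ ?_ ?_ i
  · exact key s v P h
  · intro s v P h; cases h
  · intro i σ h s v P h'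
    obtain ⟨h1, h2, T, h3⟩ := h s v P h'
    exact ⟨h1, h2, T, fun q => (h3 q).mono (Nat.le_succ i)⟩
  · exact fun i σ src m h => h
  · exact fun i σ x h => h
  · intro i σ σ' out he hact hst hst' hI
    have hI : ∀ s v P, σ.led s v = some P →
        P.slot = s ∧ P.view = v ∧ ∃ T, ∀ q, E.Sent (i + 1) r q (.prepare P T) := by
      intro s v P h'
      obtain ⟨h1, h2, T, h3⟩ := hI s v P h'
      exact ⟨h1, h2, T, fun q => (h3 q).mono (Nat.le_succ i)⟩
    have new : ∀ s v P T, (∀ q, (q, Msg.prepare P T) ∈ out) → P.slot = s → P.view = v →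
        ∀ s' v' P', Function.update σ.led s (Function.update (σ.led s) v (some P)) s' v' = some P' →
        P'.slot = s' ∧ P'.view = v' ∧ ∃ T, ∀ q, E.Sent (i + 1) r q (.prepare P' T) := by
      intro s v P T hout h1 h2 s' v' P' h
      by_cases hs : s' = s
      · subst hs
        rw [Function.update_self] at h
        by_cases hv : v' = v
        · subst hv
          rw [Function.update_self] at h
          cases h
          exact ⟨h1, h2, T, fun q => Sent.now he (hout q)⟩
        · rw [Function.update_of_ne hv] at h
          exact hI _ _ _ h
      · rw [Function.update_of_ne hs] at h
        exact hI _ _ _ h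
    cases hact
    case propose s prev gate _ _ _ _ _ _ _ _ =>
      exact new s 0 _ (.start prev gate) (fun q => rfl) rfl rfl
    case repropose s v C cut _ _ _ _ _ _ _ =>
      exact new s v _ (.tc C) (fun q => rfl) rfl rfl
    all_goals exact hI

theorem settled_origin {i s v : ℕ} {r : Replica f} (h : (s, v) ∈ (E.st i r).settled) :
    ∃ P : Proposal f Dig, P.slot = s ∧ P.view = v ∧ (E.st i r).led s v = some P ∧
      ((∃ S, 2 * f + 1 ≤ S.card ∧ ∀ q, E.Sent i r q (.confirm ⟨P, S⟩)) ∨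
        ∀ q, E.Sent i r q (.commit ⟨P, true, Finset.univ⟩)) := by
  have key := E.induct r (I := fun i σ => ∀ s v, (s, v) ∈ σ.settled →
    ∃ P : Proposal f Dig, P.slot = s ∧ P.view = v ∧ σ.led s v = some P ∧
      ((∃ S, 2 * f + 1 ≤ S.card ∧ ∀ q, E.Sent i r q (.confirm ⟨P, S⟩)) ∨
        ∀ q, E.Sent i r q (.commit ⟨P, true, Finset.univ⟩))) ?_ ?_ ?_ ?_ ?_ i
  · exact key s v h
  · intro s v h; cases h
  · intro i σ h s v h'
    obtain ⟨P, h1, h2, h3, h4⟩ := h s v h'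
    refine ⟨P, h1, h2, h3, h4.imp ?_ fun h q => (h q).mono (Nat.le_succ i)⟩
    exact fun ⟨S, hS, h⟩ => ⟨S, hS, fun q => (h q).mono (Nat.le_succ i)⟩
  · exact fun i σ src m h => h
  · exact fun i σ x h => h
  · intro i σ σ' out he hact hst hst' hI
    have hle := hact.le
    have hI : ∀ s v, (s, v) ∈ σ.settled →
        ∃ P : Proposal f Dig, P.slot = s ∧ P.view = v ∧ σ'.led s v = some P ∧
        ((∃ S, 2 * f + 1 ≤ S.card ∧ ∀ q, E.Sent (i + 1) r q (.confirm ⟨P, S⟩)) ∨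
        ∀ q, E.Sent (i + 1) r q (.commit ⟨P, true, Finset.univ⟩)) := by
      intro s v h'
      obtain ⟨P, h1, h2, h3, h4⟩ := hI s v h'
      refine ⟨P, h1, h2, hle.led _ _ _ h3, h4.imp ?_ fun h q => (h q).mono (Nat.le_succ i)⟩
      exact fun ⟨S, hS, h⟩ => ⟨S, hS, fun q => (h q).mono (Nat.le_succ i)⟩
    cases hact
    case fastCommit P hled _ _ _ _ =>
      intro s v h
      rcases h with h | h
      · cases h
        exact ⟨P, rfl, rfl, hled, .inr fun q => Sent.now he rfl⟩
      · exact hI _ _ h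
    case confirm P S a _ _ _ _ _ _ _ _ =>
      intro s v h
      rcases h with h | h
      · cases h
        exact ⟨P, rfl, rfl, ‹_›, .inl ⟨S, ‹_›, fun q => Sent.now he rfl⟩⟩
      · exact hI _ _ h
    all_goals exact hI

theorem finished_origin {i s v : ℕ} {r : Replica f} (h : (s, v) ∈ (E.st i r).finished) :
    ∃ (P : Proposal f Dig) (S : _), P.slot = s ∧ P.view = v ∧ 2 * f + 1 ≤ S.card ∧
      ∀ q, E.Sent i r q (.commit ⟨P, false, S⟩) := by
  have key := E.induct r (I := fun i σ => ∀ s v, (s, v) ∈ σ.finished →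
    ∃ (P : Proposal f Dig) (S : _), P.slot = s ∧ P.view = v ∧ 2 * f + 1 ≤ S.card ∧
      ∀ q, E.Sent i r q (.commit ⟨P, false, S⟩)) ?_ ?_ ?_ ?_ ?_ i
  · exact key s v h
  · intro s v h; cases h
  · intro i σ h s v h'
    obtain ⟨P, S, h1, h2, h3, h4⟩ := h s v h'
    exact ⟨P, S, h1, h2, h3, fun q => (h4 q).mono (Nat.le_succ i)⟩
  · exact fun i σ src m h => h
  · exact fun i σ x h => h
  · intro i σ σ' out he hact hst hst' hI
    have hI : ∀ s v, (s, v) ∈ σ.finished →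
        ∃ (P : Proposal f Dig) (S : _), P.slot = s ∧ P.view = v ∧ 2 * f + 1 ≤ S.card ∧
        ∀ q, E.Sent (i + 1) r q (.commit ⟨P, false, S⟩) := by
      intro s v h'
      obtain ⟨P, S, h1, h2, h3, h4⟩ := hI s v h'
      exact ⟨P, S, h1, h2, h3, fun q => (h4 q).mono (Nat.le_succ i)⟩
    cases hact
    case slowCommit P S _ _ _ _ _ _ =>
      intro s v h
      rcases h with h | h
      · cases h
        exact ⟨P, S, rfl, rfl, ‹_›, fun q => Sent.now he rfl⟩
      · exact hI _ _ h
    all_goals exact hI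

theorem fastAt_origin {i s v : ℕ} {r : Replica f} {a : ℝ} (h : (E.st i r).fastAt s v = some a) :
    ∃ j < i, a = E.time j + cfg.fastWait := by
  have key := E.induct r (I := fun i σ => ∀ s v a, σ.fastAt s v = some a →
    ∃ j < i, a = E.time j + cfg.fastWait) ?_ ?_ ?_ ?_ ?_ i
  · exact key s v a h
  · intro s v a h; cases h
  · intro i σ h s v a h'
    obtain ⟨j, hj, h⟩ := h s v a h'
    exact ⟨j, by omega, h⟩
  · exact fun i σ src m h => h
  · exact fun i σ x h => h
  · intro i σ σ' out he hact hst hst' hI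
    have hI : ∀ s v a, σ.fastAt s v = some a → ∃ j < i + 1, a = E.time j + cfg.fastWait := by
      intro s v a h'
      obtain ⟨j, hj, h⟩ := hI s v a h'
      exact ⟨j, by omega, h⟩
    cases hact
    case awaitFast P S _ _ _ _ _ _ =>
      intro s v a h
      by_cases hs : s = P.slot
      · subst hs
        dsimp only at h
        rw [Function.update_self] at h
        by_cases hv : v = P.view
        · subst hv
          rw [Function.update_self] at h
          cases h
          exact ⟨i, Nat.lt_succ_self i, rfl⟩
        · rw [Function.update_of_ne hv] at h
          exact hI _ _ _ h
      · dsimp only at h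
        rw [Function.update_of_ne hs] at h
        exact hI _ _ _ h
    all_goals exact hI

theorem fastAt_mono {i j s v : ℕ} {r : Replica f} {a : ℝ} (hij : i ≤ j)
    (h : (E.st i r).fastAt s v = some a) : (E.st j r).fastAt s v = some a := by
  refine E.state_rel r (R := fun σ σ' => ∀ s v a, σ.fastAt s v = some a → σ'.fastAt s v = some a)
    (fun _ _ _ _ h => h) (fun _ _ _ h h' s v a ha => h' s v a (h s v a ha)) (fun _ _ _ _ _ _ h => h)
    (fun _ _ _ _ _ h => h) ?_ hij s v a h
  intro t σ σ' out h
  cases h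
  case awaitFast P S hled hopen hview hnew hS hvotes =>
    exact fun s v a h => update_update_of_none hnew h
  all_goals exact fun _ _ _ h => h

theorem helped_origin {i s v : ℕ} {r q : Replica f} (h : (q, s, v) ∈ (E.st i r).helped) :
    ∃ Q, (E.st i r).committed s = some Q ∧ E.Sent i r q (.commit Q) := by
  have key := E.induct r (I := fun i σ => ∀ q s v, (q, s, v) ∈ σ.helped →
    ∃ Q, σ.committed s = some Q ∧ E.Sent i r q (.commit Q)) ?_ ?_ ?_ ?_ ?_ i
  · exact key q s v h
  · intro q s v h; cases h
  · intro i σ h q s v h'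
    obtain ⟨Q, h1, h2⟩ := h q s v h'
    exact ⟨Q, h1, h2.mono (Nat.le_succ i)⟩
  · exact fun i σ src m h => h
  · exact fun i σ x h => h
  · intro i σ σ' out he hact hst hst' hI
    have hle := hact.le
    have hI : ∀ q s v, (q, s, v) ∈ σ.helped →
        ∃ Q, σ'.committed s = some Q ∧ E.Sent (i + 1) r q (.commit Q) := by
      intro q s v h'
      obtain ⟨Q, h1, h2⟩ := hI q s v h'
      exact ⟨Q, hle.committed _ _ h1, h2.mono (Nat.le_succ i)⟩
    cases hact
    case help q' s' v' b Q hmem hcom hnew =>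
      intro q s v h
      rcases h with h | h
      · cases h
        exact ⟨Q, hcom, Sent.now he (Set.mem_singleton _)⟩
      · exact hI _ _ _ h
    all_goals exact hI

theorem asked_origin {i : ℕ} {r : Replica f} {c : PoA f Dig} (h : c ∈ (E.st i r).asked) :
    ∃ (P : Proposal f Dig) (l : Replica f) (lo : ℕ), P.cut l = some c ∧
      lo ≤ (E.st i r).lastCommit l ∧ (∀ q ∈ c.signers, E.Sent i r q (.sync c lo)) ∧
      (E.Sent i r (leader P.slot P.view) (.prepVote P) ∨
        ∃ Q, (E.st i r).committed P.slot = some Q ∧ Q.prop = P) := by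
  have key := E.induct r (I := fun i σ => ∀ c ∈ σ.asked,
    ∃ (P : Proposal f Dig) (l : Replica f) (lo : ℕ), P.cut l = some c ∧
      lo ≤ σ.lastCommit l ∧ (∀ q ∈ c.signers, E.Sent i r q (.sync c lo)) ∧
      (E.Sent i r (leader P.slot P.view) (.prepVote P) ∨
        ∃ Q, σ.committed P.slot = some Q ∧ Q.prop = P)) ?_ ?_ ?_ ?_ ?_ i
  · exact key c h
  · intro c h; cases h
  · intro i σ h c h'
    obtain ⟨P, l, lo, h1, h2, h3, h4⟩ := h c h'
    exact ⟨P, l, lo, h1, h2, fun q hq => (h3 q hq).mono (Nat.le_succ i),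
      h4.imp_left fun h => h.mono (Nat.le_succ i)⟩
  · exact fun i σ src m h => h
  · exact fun i σ x h => h
  · intro i σ σ' out he hact hst hst' hI
    have hle := hact.le
    have hI : ∀ c ∈ σ.asked,
        ∃ (P : Proposal f Dig) (l : Replica f) (lo : ℕ), P.cut l = some c ∧
        lo ≤ σ'.lastCommit l ∧ (∀ q ∈ c.signers, E.Sent (i + 1) r q (.sync c lo)) ∧
        (E.Sent (i + 1) r (leader P.slot P.view) (.prepVote P) ∨
        ∃ Q, σ'.committed P.slot = some Q ∧ Q.prop = P) := by
      intro c h'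
      obtain ⟨P, l, lo, h1, h2, h3, h4⟩ := hI c h'
      refine ⟨P, l, lo, h1, h2.trans (hle.lastCommit l),
        fun q hq => (h3 q hq).mono (Nat.le_succ i), h4.imp (fun h => h.mono (Nat.le_succ i)) ?_⟩
      exact fun ⟨Q, h, h'⟩ => ⟨Q, hle.committed _ _ h, h'⟩
    cases hact
    case sync P l c hP hc hnew hmiss =>
      intro c' h
      rcases h with h | h
      · cases h
        refine ⟨P, l, _, hc, le_rfl, fun q hq => Sent.now he ⟨hq, rfl⟩, hP.imp_left fun h => ?_⟩
        subst hst
        exact (E.prop_origin h).2.2.mono (Nat.le_succ i)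
      · exact hI _ h
    all_goals exact hI

theorem answered_origin {i lo : ℕ} {r q : Replica f} {c : PoA f Dig}
    (h : (q, c, lo) ∈ (E.st i r).answered) :
    ∃ j ≤ i, (∃ d, (E.st j r).lanes c.lane c.pos = some d) ∧
      E.Sent i r q (.syncReply
          ((List.range' (lo + 1) (c.pos - lo)).filterMap ((E.st j r).lanes c.lane))) := by
  have key := E.induct r (I := fun i σ => ∀ q c lo, (q, c, lo) ∈ σ.answered →
    ∃ j ≤ i, (∃ d, (E.st j r).lanes c.lane c.pos = some d) ∧
      E.Sent i r q (.syncReply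
          ((List.range' (lo + 1) (c.pos - lo)).filterMap ((E.st j r).lanes c.lane))))
          ?_ ?_ ?_ ?_ ?_ i
  · exact key q c lo h
  · intro q c lo h; cases h
  · intro i σ h q c lo h'
    obtain ⟨j, hj, h1, h2⟩ := h q c lo h'
    exact ⟨j, by omega, h1, h2.mono (Nat.le_succ i)⟩
  · exact fun i σ src m h => h
  · exact fun i σ x h => h
  · intro i σ σ' out he hact hst hst' hI
    have hI : ∀ q c lo, (q, c, lo) ∈ σ.answered →
        ∃ j ≤ i + 1, (∃ d, (E.st j r).lanes c.lane c.pos = some d) ∧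
        E.Sent (i + 1) r q (.syncReply
          ((List.range' (lo + 1) (c.pos - lo)).filterMap ((E.st j r).lanes c.lane))) := by
      intro q c lo h'
      obtain ⟨j, hj, h1, h2⟩ := hI q c lo h'
      exact ⟨j, by omega, h1, h2.mono (Nat.le_succ i)⟩
    cases hact
    case syncReply q' c' lo' d hmem hd hdig hnew =>
      intro q c lo h
      rcases h with h | h
      · cases h
        subst hst
        exact ⟨i, Nat.le_succ i, ⟨d, hd⟩, Sent.now he (Set.mem_singleton _)⟩
      · exact hI _ _ _ h
    all_goals exact hI

theorem lanes_origin {i p : ℕ} {r l : Replica f} {d : DataProp f Req Dig}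
    (h : (E.st i r).lanes l p = some d) :
    d.lane = l ∧ d.pos = p ∧ (∃ cert, (l, .car d cert) ∈ (E.st i r).inbox) ∧
      ((p = 1 ∧ d.parent = none) ∨ ∃ k d', p = k + 1 ∧ (E.st i r).lanes l k = some d' ∧
        d.parent = some (cfg.hash d') ∧ k ≤ tipPos ((E.st i r).tips l)) ∧
      E.Sent i r l (.carVote l p (cfg.hash d)) := by
  have key := E.induct r (I := fun i σ => ∀ l p d, σ.lanes l p = some d →
    d.lane = l ∧ d.pos = p ∧ (∃ cert, (l, .car d cert) ∈ σ.inbox) ∧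
      ((p = 1 ∧ d.parent = none) ∨ ∃ k d', p = k + 1 ∧ σ.lanes l k = some d' ∧
        d.parent = some (cfg.hash d') ∧ k ≤ tipPos (σ.tips l)) ∧
      E.Sent i r l (.carVote l p (cfg.hash d))) ?_ ?_ ?_ ?_ ?_ i
  · exact key l p d h
  · intro l p d h; cases h
  · intro i σ h l p d h'
    obtain ⟨h1, h2, h3, h4, h5⟩ := h l p d h'
    exact ⟨h1, h2, h3, h4, h5.mono (Nat.le_succ i)⟩
  · intro i σ src m h l p d h'
    obtain ⟨h1, h2, ⟨cert, h3⟩, h4⟩ := h l p d h'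
    exact ⟨h1, h2, ⟨cert, .inr h3⟩, h4⟩
  · exact fun i σ x h => h
  · intro i σ σ' out he hact hst hst' hI
    have hle := hact.le
    have hI : ∀ l p d, σ.lanes l p = some d →
        d.lane = l ∧ d.pos = p ∧ (∃ cert, (l, .car d cert) ∈ σ.inbox) ∧
        ((p = 1 ∧ d.parent = none) ∨ ∃ k d', p = k + 1 ∧ σ'.lanes l k = some d' ∧
        d.parent = some (cfg.hash d') ∧ k ≤ tipPos (σ'.tips l)) ∧
        E.Sent (i + 1) r l (.carVote l p (cfg.hash d)) := by
      intro l p d h'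
      obtain ⟨h1, h2, h3, h4, h5⟩ := hI l p d h'
      refine ⟨h1, h2, h3, h4.imp_right ?_, h5.mono (Nat.le_succ i)⟩
      rintro ⟨k, d', h6, h7, h8, h9⟩
      exact ⟨k, d', h6, hle.lanes _ _ _ h7, h8, h9.trans (hle.tips l)⟩
    cases hact
    case voteCar d cert hmem hnew hpar =>
      intro l p d' h
      by_cases hs : l = d.lane
      · subst hs
        dsimp only at h
        rw [Function.update_self] at h
        by_cases hv : p = d.pos
        · subst hv
          rw [Function.update_self] at h
          cases h
          refine ⟨rfl, rfl, ⟨cert, hmem⟩, ?_, Sent.now he (Set.mem_singleton _)⟩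
          rcases hpar with ⟨h1, h2, h3⟩ | ⟨k, p, c, h1, h2, h3, rfl, h5, h6, h7, h8⟩
          · exact .inl ⟨h1, h2⟩
          · refine .inr ⟨k, p, h2, hle.lanes _ _ _ h1, h3, ?_⟩
            rw [← h7, ← h6]
            exact pos_le_improve _ _
        · rw [Function.update_of_ne hv] at h
          exact hI _ _ _ h
      · dsimp only at h
        rw [Function.update_of_ne hs] at h
        exact hI _ _ _ h
    all_goals exact hI

theorem givenUp_origin {i s v : ℕ} {r : Replica f} (h : (E.st i r).givenUp s = v + 1) :
    ∃ b, ∀ q, E.Sent i r q (.timeout s v b) := by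
  have key := E.induct r (I := fun i σ => ∀ s v, σ.givenUp s = v + 1 →
    ∃ b, ∀ q, E.Sent i r q (.timeout s v b)) ?_ ?_ ?_ ?_ ?_ i
  · exact key s v h
  · intro s v h; cases h
  · intro i σ h s v h'
    obtain ⟨b, hb⟩ := h s v h'
    exact ⟨b, fun q => (hb q).mono (Nat.le_succ i)⟩
  · exact fun i σ src m h => h
  · exact fun i σ x h => h
  · intro i σ σ' out he hact hst hst' hI
    have hI : ∀ s v, σ.givenUp s = v + 1 → ∃ b, ∀ q, E.Sent (i + 1) r q (.timeout s v b) := by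
      intro s v h'
      obtain ⟨b, hb⟩ := hI s v h'
      exact ⟨b, fun q => (hb q).mono (Nat.le_succ i)⟩
    cases hact
    case timeout s a hopen ha hat hup =>
      intro s' v' h
      by_cases hs : s' = s
      · subst hs
        simp at h
        subst h
        exact ⟨_, fun q => Sent.now he rfl⟩
      · simp only [ne_eq, hs, not_false_eq_true, Function.update_of_ne] at h
        exact hI _ _ h
    case join s v S hopen hview hup hS hmem =>
      intro s' v' h
      by_cases hs : s' = s
      · subst hs
        simp at h
        subst h
        exact ⟨_, fun q => Sent.now he rfl⟩
      · simp only [ne_eq, hs, not_false_eq_true, Function.update_of_ne] at h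
        exact hI _ _ h
    all_goals exact hI

theorem view_origin (i s : ℕ) (r : Replica f) :
    (∃ j < i, E.EntersAt j r s ((E.st i r).view s) ∧
        (E.st i r).deadline s = some (E.time j + 10 * cfg.Δ)) ∨
      (E.st i r).givenUp s = (E.st i r).view s + 1 ∨
      ((E.st i r).view s = 0 ∧ (E.st i r).deadline s = none) := by
  have key := E.induct r (I := fun i σ => ∀ s, (∃ j < i, E.EntersAt j r s (σ.view s) ∧
        σ.deadline s = some (E.time j + 10 * cfg.Δ)) ∨ σ.givenUp s = σ.view s + 1 ∨
      (σ.view s = 0 ∧ σ.deadline s = none)) ?_ ?_ ?_ ?_ ?_ i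
  · exact key s
  · exact fun s => .inr (.inr ⟨rfl, rfl⟩)
  · intro i σ h s
    exact (h s).imp_left fun ⟨j, hj, h⟩ => ⟨j, by omega, h⟩
  · exact fun i σ src m h => h
  · exact fun i σ x h => h
  · intro i σ σ' out he hact hst hst' hI
    have hI : ∀ s, (∃ j < i + 1, E.EntersAt j r s (σ.view s) ∧
        σ.deadline s = some (E.time j + 10 * cfg.Δ)) ∨ σ.givenUp s = σ.view s + 1 ∨
        (σ.view s = 0 ∧ σ.deadline s = none) := fun s =>
      (hI s).imp_left fun ⟨j, hj, h⟩ => ⟨j, by omega, h⟩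
    cases hact
    case enter s v T hopen hsee hlate =>
      intro s'
      by_cases hs : s' = s
      · subst hs
        left
        refine ⟨i, Nat.lt_succ_self i, ⟨T, _, he, ?_⟩, ?_⟩
        · simp [toAll]
        · simp
      · simpa only [ne_eq, hs, not_false_eq_true, Function.update_of_ne] using hI s'
    case timeout s a hopen ha hat hup =>
      intro s'
      by_cases hs : s' = s
      · subst hs; simp
      · simpa only [ne_eq, hs, not_false_eq_true, Function.update_of_ne] using hI s'
    case join s v S hopen hview hup hS hmem =>
      intro s'
      by_cases hs : s' = s
      · subst hs; simp
      · simpa only [ne_eq, hs, not_false_eq_true, Function.update_of_ne] using hI s'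
    all_goals exact hI

theorem deadline_origin {i s : ℕ} {r : Replica f} (h : (E.st i r).deadline s ≠ none) :
    ∃ v, ∃ j < i, E.EntersAt j r s v := by
  have key := E.induct r (I := fun i σ => ∀ s, σ.deadline s ≠ none →
    ∃ v, ∃ j < i, E.EntersAt j r s v) ?_ ?_ ?_ ?_ ?_ i
  · exact key s h
  · exact fun s h => absurd rfl h
  · intro i σ h s h'
    obtain ⟨v, j, hj, h⟩ := h s h'
    exact ⟨v, j, by omega, h⟩
  · exact fun i σ src m h => h
  · exact fun i σ x h => h
  · intro i σ σ' out he hact hst hst' hI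
    have hI : ∀ s, σ.deadline s ≠ none → ∃ v, ∃ j < i + 1, E.EntersAt j r s v := by
      intro s h'
      obtain ⟨v, j, hj, h⟩ := hI s h'
      exact ⟨v, j, by omega, h⟩
    cases hact
    case enter s v T hopen hsee hlate =>
      intro s' h
      by_cases hs : s' = s
      · subst hs
        exact ⟨v, i, Nat.lt_succ_self i, T, _, he, rfl⟩
      · simp only [ne_eq, hs, not_false_eq_true, Function.update_of_ne] at h
        exact hI _ h
    all_goals exact hI

theorem givenUp_le (i s : ℕ) (r : Replica f) :
    (E.st i r).givenUp s ≤ (E.st i r).view s + 1 := by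
  have key := E.induct r (I := fun i σ => ∀ s, σ.givenUp s ≤ σ.view s + 1) ?_ ?_ ?_ ?_ ?_ i
  · exact key s
  · exact fun s => Nat.zero_le _
  · exact fun i σ h => h
  · exact fun i σ src m h => h
  · exact fun i σ x h => h
  · intro i σ σ' out he hact hst hst' hI
    have hle := hact.le
    cases hact
    case enter =>
      intro s'
      exact (hI s').trans (Nat.succ_le_succ (hle.view s'))
    case timeout s a hopen ha hat hup =>
      intro s'
      by_cases hs : s' = s
      · subst hs; simp
      · simpa only [ne_eq, hs, not_false_eq_true, Function.update_of_ne] using hI s'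
    case join s v S hopen hview hup hS hmem =>
      intro s'
      by_cases hs : s' = s
      · subst hs; simp
      · simpa only [ne_eq, hs, not_false_eq_true, Function.update_of_ne] using hI s'
    all_goals exact hI

theorem own_origin {i : ℕ} {r : Replica f} :
    (∀ k d, (E.st i r).own[k]? = some d → d.lane = r ∧ d.pos = k + 1 ∧
      ∃ cert, (∀ q, E.Sent i r q (.car d cert)) ∧
        ((k = 0 ∧ d.parent = none ∧ cert = none) ∨ ∃ k' p c, k = k' + 1 ∧
          (E.st i r).own[k']? = some p ∧ d.parent = some (cfg.hash p) ∧ cert = some c ∧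
          c.Valid ∧ c.lane = r ∧ c.pos = k ∧ c.dig = cfg.hash p)) ∧
    ∀ c, (E.st i r).ownCert = some c → c.Valid ∧ c.lane = r ∧
      c.pos = (E.st i r).own.length ∧
      (∃ p, (E.st i r).own.getLast? = some p ∧ c.dig = cfg.hash p) ∧
      ∀ q ∈ c.signers, (q, .carVote c.lane c.pos c.dig) ∈ (E.st i r).inbox := by
  refine E.induct r (I := fun i σ => (∀ k d, σ.own[k]? = some d → d.lane = r ∧ d.pos = k + 1 ∧
      ∃ cert, (∀ q, E.Sent i r q (.car d cert)) ∧
        ((k = 0 ∧ d.parent = none ∧ cert = none) ∨ ∃ k' p c, k = k' + 1 ∧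
          σ.own[k']? = some p ∧ d.parent = some (cfg.hash p) ∧ cert = some c ∧
          c.Valid ∧ c.lane = r ∧ c.pos = k ∧ c.dig = cfg.hash p)) ∧
    ∀ c, σ.ownCert = some c → c.Valid ∧ c.lane = r ∧ c.pos = σ.own.length ∧
      (∃ p, σ.own.getLast? = some p ∧ c.dig = cfg.hash p) ∧
      ∀ q ∈ c.signers, (q, .carVote c.lane c.pos c.dig) ∈ σ.inbox) ?_ ?_ ?_ ?_ ?_ i
  · exact ⟨fun k d h => by simp [RState.initial] at h, fun c h => by cases h⟩
  · intro i σ h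
    refine ⟨fun k d h' => ?_, h.2⟩
    obtain ⟨h1, h2, cert, h3, h4⟩ := h.1 k d h'
    exact ⟨h1, h2, cert, fun q => (h3 q).mono (Nat.le_succ i), h4⟩
  · intro i σ src m h
    refine ⟨h.1, fun c hc => ?_⟩
    obtain ⟨h1, h2, h3, h4, h5⟩ := h.2 c hc
    exact ⟨h1, h2, h3, h4, fun q hq => .inr (h5 q hq)⟩
  · exact fun i σ x h => h
  · intro i σ σ' out he hact hst hst' hI
    have hI1 : ∀ k d, σ.own[k]? = some d → d.lane = r ∧ d.pos = k + 1 ∧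
        ∃ cert, (∀ q, E.Sent (i + 1) r q (.car d cert)) ∧
        ((k = 0 ∧ d.parent = none ∧ cert = none) ∨ ∃ k' p c, k = k' + 1 ∧
          σ.own[k']? = some p ∧ d.parent = some (cfg.hash p) ∧ cert = some c ∧
          c.Valid ∧ c.lane = r ∧ c.pos = k ∧ c.dig = cfg.hash p) := by
      intro k d h'
      obtain ⟨h1, h2, cert, h3, h4⟩ := hI.1 k d h'
      exact ⟨h1, h2, cert, fun q => (h3 q).mono (Nat.le_succ i), h4⟩
    have hI2 := hI.2
    cases hact
    case proposeCar B rest hB hpool hready =>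
      refine ⟨fun k d h => ?_, fun c h => by cases h⟩
      dsimp only at h ⊢
      rcases lt_trichotomy k σ.own.length with hk | hk | hk
      · rw [List.getElem?_append_left hk] at h
        obtain ⟨h1, h2, cert, h3, h4⟩ := hI1 k d h
        refine ⟨h1, h2, cert, h3, h4.imp_right ?_⟩
        rintro ⟨k', p, c, h5, h6, h7⟩
        refine ⟨k', p, c, h5, ?_, h7⟩
        rw [List.getElem?_append_left (by omega)]
        exact h6
      · subst hk
        simp at h
        subst h
        refine ⟨rfl, rfl, σ.ownCert, fun q => Sent.now he rfl, ?_⟩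
        by_cases ho : σ.own = []
        · left
          refine ⟨by simp [ho], by simp [Config.newCar, ho], ?_⟩
          cases hc : σ.ownCert with
          | none => rfl
          | some c =>
            obtain ⟨-, -, -, ⟨p, h1, -⟩, -⟩ := hI2 c hc
            rw [ho] at h1; cases h1
        · right
          obtain ⟨c, hc⟩ := Option.ne_none_iff_exists'.1 (hready.resolve_left ho)
          obtain ⟨h1, h2, h3, ⟨p, h4, h5⟩, -⟩ := hI2 c hc
          have hl := List.length_pos_of_ne_nil ho
          refine ⟨σ.own.length - 1, p, c, by omega, ?_, by simp [Config.newCar, h4], hc, h1, h2,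
            h3, h5⟩
          rw [List.getElem?_append_left (by omega), ← List.getLast?_eq_getElem?]
          exact h4
      · rw [List.getElem?_eq_none (by simp; omega)] at h
        cases h
    case certifyCar d S hlast hcert hS hvotes hout =>
      refine ⟨hI1, fun c h => ?_⟩
      cases h
      refine ⟨hS.ge, rfl, ?_, ⟨d, hlast, rfl⟩, hvotes⟩
      have hne : σ.own ≠ [] := fun h => by rw [h] at hlast; cases hlast
      have hl := List.length_pos_of_ne_nil hne
      rw [List.getLast?_eq_getElem?] at hlast
      have := (hI1 _ _ hlast).2.1
      dsimp only
      omega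
    all_goals exact ⟨hI1, hI2⟩

theorem tips_origin {i : ℕ} {r l : Replica f} {c : PoA f Dig} (h : (E.st i r).tips l = some c) :
    c.lane = l ∧ c.Valid ∧
      ((∃ src d, (src, .car d (some c)) ∈ (E.st i r).inbox) ∨
        (∃ src, (src, .poa c) ∈ (E.st i r).inbox) ∨
        ∀ q ∈ c.signers, (q, .carVote c.lane c.pos c.dig) ∈ (E.st i r).inbox) := by
  have key := E.induct r (I := fun i σ => ∀ l c, σ.tips l = some c → c.lane = l ∧ c.Valid ∧
      ((∃ src d, (src, .car d (some c)) ∈ σ.inbox) ∨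
        (∃ src, (src, .poa c) ∈ σ.inbox) ∨
        ∀ q ∈ c.signers, (q, .carVote c.lane c.pos c.dig) ∈ σ.inbox)) ?_ ?_ ?_ ?_ ?_ i
  · exact key l c h
  · intro l c h; cases h
  · exact fun i σ h => h
  · intro i σ src m h l c hc
    obtain ⟨h1, h2, h3⟩ := h l c hc
    refine ⟨h1, h2, ?_⟩
    rcases h3 with ⟨s, d, h⟩ | ⟨s, h⟩ | h
    · exact .inl ⟨s, d, .inr h⟩
    · exact .inr (.inl ⟨s, .inr h⟩)
    · exact .inr (.inr fun q hq => .inr (h q hq))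
  · exact fun i σ x h => h
  · intro i σ σ' out he hact hst hst' hI
    cases hact
    case voteCar d cert hmem hnew hpar =>
      cases cert with
      | none => exact hI
      | some c =>
        intro l c' h
        rcases improve_eq _ _ _ _ h with h | ⟨rfl, rfl⟩
        · exact hI _ _ h
        · refine ⟨rfl, ?_, .inl ⟨_, _, hmem⟩⟩
          rcases hpar with ⟨-, -, h⟩ | ⟨k, p, c, h1, h2, h3, h4, h5, h6, h7, h8⟩
          · cases h
          · cases h4; exact h5
    case certifyCar d S hlast hcert hS hvotes hout =>
      intro l c' h
      rcases improve_eq _ _ _ _ h with h | ⟨rfl, rfl⟩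
      · exact hI _ _ h
      · exact ⟨rfl, hS.ge, .inr (.inr hvotes)⟩
    case learnTip src c hmem hc hnew =>
      intro l c' h
      rcases improve_eq _ _ _ _ h with h | ⟨rfl, rfl⟩
      · exact hI _ _ h
      · exact ⟨rfl, hc, .inr (.inl ⟨src, hmem⟩)⟩
    all_goals exact hI

end Execution

end Autobahn

namespace Autobahn

variable {f : ℕ} {Req Dig : Type*} {cfg : Config f Req Dig}

/-! ### Genuine signatures -/

/-- The message by which a vote, acknowledgement or complaint is issued. -/
def Stmt.msg : Stmt f Req Dig → Option (Msg f Req Dig)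
  | .car _ => none
  | .carVote l p x => some (.carVote l p x)
  | .proposal _ => none
  | .prepVote P => some (.prepVote P)
  | .confirmAck P => some (.confirmAck P)
  | .timeout s v b => some (.timeout s v b)

namespace Execution

variable (E : Execution cfg)

/-- The signatures of correct replicas in `S` were issued by them before the event `i`. -/
def Genuine (i : ℕ) (S : Set (Replica f × Stmt f Req Dig)) : Prop :=
  ∀ r σ m, (r, σ) ∈ S → r ∉ E.byz → σ.msg = some m → E.Said i r m

/-- All messages received before the event `i` are genuine. -/
def GenuineInbox (i : ℕ) : Prop :=
  ∀ q src m, (src, m) ∈ (E.st i q).inbox → E.Genuine i (m.sigs src)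

variable {E}

theorem Genuine.mono {i j : ℕ} (hij : i ≤ j) {S : Set (Replica f × Stmt f Req Dig)}
    (h : E.Genuine i S) : E.Genuine j S :=
  fun r σ m h1 h2 h3 => (h r σ m h1 h2 h3).mono hij

theorem Genuine.subset {i : ℕ} {S S' : Set (Replica f × Stmt f Req Dig)}
    (h : E.Genuine i S) (hS : S' ⊆ S) : E.Genuine i S' :=
  fun r σ m h1 h2 h3 => h r σ m (hS h1) h2 h3

theorem Genuine.union {i : ℕ} {S S' : Set (Replica f × Stmt f Req Dig)}
    (h : E.Genuine i S) (h' : E.Genuine i S') : E.Genuine i (S ∪ S') :=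
  fun r σ m h1 h2 h3 => h1.elim (fun h1 => h r σ m h1 h2 h3) fun h1 => h' r σ m h1 h2 h3

theorem Said.prepVote_inbox {i : ℕ} {r : Replica f} {P : Proposal f Dig}
    (h : E.Said i r (.prepVote P)) : ∃ j < i, ∃ T,
      (leader P.slot P.view, .prepare P T) ∈ (E.st j r).inbox ∧ cfg.PrepareValid P T := by
  obtain ⟨q, h⟩ := h
  obtain ⟨j, hj, out, he, hm, hact⟩ := h.act
  obtain ⟨-, ⟨T, h⟩, -⟩ := hact.of_prepVote hm
  exact ⟨j, hj, T, h⟩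

theorem Genuine.poa_of_cut {i : ℕ} {P : Proposal f Dig} (h : E.Genuine i P.sigs) {l : Replica f}
    {c : PoA f Dig} (hc : P.cut l = some c) : E.Genuine i c.sigs :=
  h.subset fun _ hp => .inr ⟨l, c, hc, hp⟩

theorem Genuine.proposal_of_cut {i : ℕ} {P : Proposal f Dig}
    (h : ∀ l c, P.cut l = some c → E.Genuine i c.sigs) : E.Genuine i P.sigs := by
  rintro r σ m (h1 | ⟨l, c, hc, h1⟩) h2 h3
  · cases h1; cases h3
  · exact h l c hc r σ m h1 h2 h3

theorem Genuine.prepareQC_voter {i : ℕ} {Q : PrepareQC f Dig} (h : E.Genuine i Q.sigs)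
    (hQ : Q.Valid) : ∃ r, r ∈ Q.signers ∧ r ∉ E.byz ∧ E.Said i r (.prepVote Q.prop) := by
  obtain ⟨r, hr, hc⟩ := E.exists_correct (S := Q.signers)
    (by unfold PrepareQC.Valid at hQ; omega)
  exact ⟨r, hr, hc, h r (.prepVote Q.prop) _ ⟨hr, rfl⟩ hc rfl⟩

theorem genuine_of_votes {i : ℕ} {q : Replica f} (hK : E.GenuineInbox i) {S : Finset (Replica f)}
    {σ : Stmt f Req Dig} {m : Msg f Req Dig} (hσ : ∀ p, (p, σ) ∈ m.sigs p)
    (h : ∀ p ∈ S, (p, m) ∈ (E.st i q).inbox) : E.Genuine i {p | p.1 ∈ S ∧ p.2 = σ} := by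
  rintro r σ' m' ⟨h1, h2⟩ h3 h4
  dsimp only at h1 h2
  subst h2
  exact hK q r m (h r h1) r σ' m' (hσ r) h3 h4

theorem Said.prepVote_sigs {i : ℕ} (hK : ∀ j ≤ i, E.GenuineInbox j) {r : Replica f}
    {P : Proposal f Dig} (h : E.Said i r (.prepVote P)) : E.Genuine i P.sigs := by
  obtain ⟨j, hj, T, h, -⟩ := h.prepVote_inbox
  exact ((hK j hj.le r _ _ h).subset Set.subset_union_left).mono hj.le

theorem Said.confirmAck_voter {i : ℕ} (hK : ∀ j ≤ i, E.GenuineInbox j) {r : Replica f}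
    {P : Proposal f Dig} (h : E.Said i r (.confirmAck P)) :
    ∃ Q : PrepareQC f Dig, Q.prop = P ∧ Q.Valid ∧ E.Genuine i Q.sigs := by
  obtain ⟨q, h⟩ := h
  obtain ⟨j, hj, out, he, hm, hact⟩ := h.act
  obtain ⟨-, Q, h1, h2, h3, -⟩ := hact.of_confirmAck hm
  exact ⟨Q, h1, h2, (hK j hj.le r _ _ h3).mono hj.le⟩

theorem Genuine.commitQC_voter {i : ℕ} (hK : ∀ j ≤ i, E.GenuineInbox j) {Q : CommitQC f Dig}
    (h : E.Genuine i Q.sigs) (hQ : Q.Valid) :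
    ∃ r, r ∉ E.byz ∧ E.Said i r (.prepVote Q.prop) := by
  unfold CommitQC.Valid at hQ
  have hcard : f + 1 ≤ Q.signers.card := by
    split_ifs at hQ
    · rw [hQ, Finset.card_univ, Fintype.card_fin]; omega
    · omega
  obtain ⟨r, hr, hc⟩ := E.exists_correct hcard
  by_cases hf : Q.fast = true
  · exact ⟨r, hc, h r (.prepVote Q.prop) _ ⟨hr, by simp [hf]⟩ hc rfl⟩
  · obtain ⟨Q', h1, h2, h3⟩ := Said.confirmAck_voter hK
      (h r (.confirmAck Q.prop) _ ⟨hr, by simp [hf]⟩ hc rfl)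
    obtain ⟨r', -, h4, h5⟩ := h3.prepareQC_voter h2
    exact ⟨r', h4, h1 ▸ h5⟩

theorem genuine_committed {i : ℕ} (hK : E.GenuineInbox i) {r : Replica f} {s : ℕ}
    {Q : CommitQC f Dig} (h : (E.st i r).committed s = some Q) : E.Genuine i Q.sigs := by
  obtain ⟨-, -, src, h⟩ := E.committed_origin h
  exact hK r _ _ h

theorem genuine_tips {i : ℕ} (hK : E.GenuineInbox i) {r l : Replica f} {c : PoA f Dig}
    (h : (E.st i r).tips l = some c) : E.Genuine i c.sigs := by
  obtain ⟨-, -, ⟨src, d, h⟩ | ⟨src, h⟩ | h⟩ := E.tips_origin h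
  · exact (hK r _ _ h).subset fun p hp => .inr ⟨c, rfl, hp⟩
  · exact hK r _ _ h
  · exact genuine_of_votes hK (fun p => by exact rfl) h

theorem genuine_sees {i : ℕ} (hK : E.GenuineInbox i) {r : Replica f} {s v : ℕ} {T : Ticket f Dig}
    (h : cfg.Sees (E.st i r) s v T) : E.Genuine i T.sigs := by
  cases h with
  | inPrepare hmem hT => exact (hK r _ _ hmem).subset Set.subset_union_right
  | forwarded hmem hT => exact hK r _ _ hmem
  | preceding hT hprev hgate =>
    rintro q σ m (⟨P, hP, h⟩ | ⟨Q, hQ, h⟩) h2 h3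
    · obtain ⟨T, -, h4⟩ := hprev P hP
      exact hK r _ _ h4 q σ m (.inl h) h2 h3
    · exact genuine_committed hK (hgate Q hQ) q σ m h h2 h3
  | timeouts hT hmem =>
    rintro q σ m ⟨p, b, hb, h⟩ h2 h3
    exact hK r _ _ (hmem p b hb) q σ m h h2 h3

theorem genuine_complaint {i : ℕ} (hK : ∀ j ≤ i, E.GenuineInbox j) (r : Replica f) (s : ℕ) :
    E.Genuine i (Complaint.sigs ⟨(E.st i r).conf s, (E.st i r).prop s⟩) := by
  rintro q σ m (⟨Q, hQ, h⟩ | ⟨P, hP, h⟩) h2 h3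
  · obtain ⟨-, -, h4, -⟩ := E.conf_origin hQ
    exact hK i le_rfl r _ _ h4 q σ m h h2 h3
  · exact Said.prepVote_sigs hK (E.prop_origin hP).2.2.said q σ m h h2 h3

theorem TC.QCFor.genuine {C : TC f Dig} {cut : Cut f Dig} {w i : ℕ} (h : C.QCFor cut w)
    (hg : E.Genuine i C.sigs) (hC : C.Valid) : ∃ Q : PrepareQC f Dig, Q.Valid ∧
      E.Genuine i Q.sigs ∧ Q.prop.cut = cut ∧ Q.prop.view = w ∧ Q.prop.slot = C.slot ∧
      w ≤ C.view := by
  obtain ⟨r, b, Q, h1, h2, h3, h4⟩ := h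
  obtain ⟨h5, h6, h7⟩ := (hC.2 r b h1).1 Q h2
  exact ⟨Q, h5, hg.subset fun p hp => ⟨r, b, h1, .inr (.inl ⟨Q, h2, hp⟩)⟩, h3, h4, h6, h4 ▸ h7⟩

theorem Genuine.tc_complaint {C : TC f Dig} {i : ℕ} {r : Replica f} {b : Complaint f Dig}
    (hg : E.Genuine i C.sigs) (hb : C.complaints r = some b) (hr : r ∉ E.byz) :
    E.Said i r (.timeout C.slot C.view b) :=
  hg r (.timeout C.slot C.view b) _ ⟨r, b, hb, .inl rfl⟩ hr rfl

theorem Said.timeout_state {i s v : ℕ} {r : Replica f} {b : Complaint f Dig}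
    (h : E.Said i r (.timeout s v b)) :
    ∃ j < i, b = ⟨(E.st j r).conf s, (E.st j r).prop s⟩ := by
  obtain ⟨q, h⟩ := h
  obtain ⟨j, hj, out, he, hm, hact⟩ := h.act
  exact ⟨j, hj, (hact.of_timeout hm).2.1⟩

theorem TC.PropFor.voter {C : TC f Dig} {cut : Cut f Dig} {w i : ℕ} (h : C.PropFor cut w)
    (hg : E.Genuine i C.sigs) (hC : C.Valid) : ∃ r P, r ∉ E.byz ∧ E.Said i r (.prepVote P) ∧
      P.cut = cut ∧ w ≤ P.view ∧ P.slot = C.slot ∧ P.view ≤ C.view := by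
  obtain ⟨S, h1, h2⟩ := h
  obtain ⟨r, hr, hc⟩ := E.exists_correct h1.ge
  obtain ⟨b, P, h3, h4, h5, h6⟩ := h2 r hr
  obtain ⟨h7, h8⟩ := (hC.2 r b h3).2 P h4
  obtain ⟨j, hj, h9⟩ := (hg.tc_complaint h3 hc).timeout_state
  rw [h9] at h4
  exact ⟨r, P, hc, (E.prop_origin h4).2.2.said.mono hj.le, h5, h6, h7, h8⟩

theorem TC.Wins.voter {C : TC f Dig} {cut : Cut f Dig} {i : ℕ} (h : C.Wins cut)
    (hg : E.Genuine i C.sigs) (hC : C.Valid) : ∃ r P, r ∉ E.byz ∧ E.Said i r (.prepVote P) ∧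
      P.cut = cut ∧ P.slot = C.slot ∧ P.view ≤ C.view := by
  rcases h with ⟨w, h, -⟩ | ⟨w, h, -⟩
  · obtain ⟨Q, h1, h2, h3, h4, h5, h6⟩ := TC.QCFor.genuine h hg hC
    obtain ⟨r, -, h7, h8⟩ := h2.prepareQC_voter h1
    exact ⟨r, Q.prop, h7, h8, h3, h5, h4 ▸ h6⟩
  · obtain ⟨r, P, h1, h2, h3, -, h4, h5⟩ := TC.PropFor.voter h hg hC
    exact ⟨r, P, h1, h2, h3, h4, h5⟩

theorem ticketValid_of_sees {σ : RState f Req Dig} {s v : ℕ} {T : Ticket f Dig}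
    (h : cfg.Sees σ s v T) : cfg.TicketValid s v T := by
  cases h <;> assumption

theorem genuine_out {i : ℕ} (hK : ∀ j ≤ i, E.GenuineInbox j) {r q : Replica f}
    {out : Set (Replica f × Msg f Req Dig)} {m : Msg f Req Dig} (he : E.ev i = .act r out)
    (hm : (q, m) ∈ out) : E.Genuine (i + 1) (m.sigs r) := by
  have hact := E.act_step he
  have hi := hK i le_rfl
  have direct : ∀ σ : Stmt f Req Dig, σ.msg = some m → E.Genuine (i + 1) {(r, σ)} := by
    rintro σ hσ r' σ' m' h1 h2 h3
    cases h1
    rw [h3] at hσ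
    cases hσ
    exact (Sent.now he hm).said
  cases m with
  | car d cert =>
    obtain ⟨B, rest, -, h1, -⟩ := hact.of_car hm
    rintro r' σ m (h | ⟨c, hc, h⟩) h2 h3
    · cases h; cases h3
    · rw [h1] at hc
      have := (E.own_origin.2 c hc).2.2.2.2
      exact (genuine_of_votes (σ := .carVote c.lane c.pos c.dig) hi (fun p => by exact rfl) this).mono
        (Nat.le_succ i) r' σ m h h2 h3
  | carVote l p x => exact direct _ rfl
  | poa c =>
    exact (genuine_of_votes (σ := .carVote c.lane c.pos c.dig) hi (fun p => by exact rfl)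
      (hact.of_poa hm)).mono (Nat.le_succ i)
  | ticket s v T => exact (genuine_sees hi (hact.of_ticket hm).2.2.1).mono (Nat.le_succ i)
  | prepare P T =>
    obtain ⟨-, -, h1, -, -, h2⟩ := hact.of_prepare hm
    have h3 := genuine_sees hi h1
    refine Genuine.mono (Nat.le_succ i) (Genuine.union (Genuine.proposal_of_cut fun l c hc => ?_) h3)
    rcases h2 with ⟨h2, -⟩ | ⟨C, rfl, h2⟩
    · rw [h2] at hc
      exact genuine_tips hi hc
    · obtain ⟨r', P', -, h4, h5, -⟩ := TC.Wins.voter h2 h3 (ticketValid_of_sees h1).1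
      exact (Said.prepVote_sigs hK h4).poa_of_cut (h5 ▸ hc)
  | prepVote P => exact direct _ rfl
  | confirm Q =>
    exact (genuine_of_votes (σ := .prepVote Q.prop) hi (fun p => by exact rfl)
      (hact.of_confirm hm).2.2.2).mono (Nat.le_succ i)
  | confirmAck P => exact direct _ rfl
  | commit Q =>
    rcases hact.of_commit hm with h | ⟨s, h⟩
    · refine Genuine.mono (Nat.le_succ i) ?_
      refine genuine_of_votes (σ := if Q.fast then .prepVote Q.prop else .confirmAck Q.prop) hi
        (fun p => ?_) h
      split_ifs <;> rfl
    · exact (genuine_committed hi h).mono (Nat.le_succ i)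
  | timeout s v b =>
    have hd := direct (.timeout s v b) rfl
    have hb := (genuine_complaint hK r s).mono (Nat.le_succ i)
    rw [← (hact.of_timeout hm).2.1] at hb
    exact hd.union hb
  | sync c lo =>
    refine Genuine.mono (Nat.le_succ i) ?_
    obtain ⟨P, l, h1, h2 | ⟨Q, h2, rfl⟩⟩ := hact.of_sync hm
    · exact (Said.prepVote_sigs hK (E.prop_origin h2).2.2.said).poa_of_cut h1
    · obtain ⟨r', -, h3⟩ := (genuine_committed hi h2).commitQC_voter hK (E.committed_origin h2).1
      exact (Said.prepVote_sigs hK h3).poa_of_cut h1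
  | syncReply ds =>
    rintro r' σ m ⟨d, -, h⟩ h2 h3
    cases h; cases h3

variable (E)

theorem genuineInbox (i : ℕ) : E.GenuineInbox i := by
  induction i using Nat.strong_induction_on with
  | _ i ih =>
    intro q src m h r σ m' h1 h2 h3
    obtain ⟨j, hj, he⟩ := E.deliver_of_mem_inbox h
    by_cases hs : src ∈ E.byz
    · obtain ⟨k, hk, out, he', p, hp, h4⟩ := E.unforgeable j src q m he hs r σ h2 h1
      exact (genuine_out (fun j' hj' => ih j' (by omega)) he' (q := p.1) (m := p.2) hp
        r σ m' h4 h2 h3).mono (by omega)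
    · obtain ⟨k, hk, out, he', hp⟩ := E.authentic j src q m he hs
      exact (genuine_out (fun j' hj' => ih j' (by omega)) he' hp r σ m' h1 h2 h3).mono (by omega)

variable {E}

/-- Correct replicas propose valid Prepares. -/
theorem Sent.prepareValid {i : ℕ} {r q : Replica f} {P : Proposal f Dig} {T : Ticket f Dig}
    (h : E.Sent i r q (.prepare P T)) : cfg.PrepareValid P T := by
  obtain ⟨j, hj, out, he, hm, hact⟩ := h.act
  obtain ⟨-, -, h1, -, -, h2⟩ := hact.of_prepare hm
  have h3 := genuine_sees (E.genuineInbox j) h1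
  have h4 := ticketValid_of_sees h1
  rcases h2 with ⟨h2, h5⟩ | ⟨C, rfl, h2⟩
  · refine ⟨h4, fun l c hc => ?_, fun C hC => .inr (h5 C hC)⟩
    rw [h2] at hc
    have := E.tips_origin hc
    exact ⟨this.1, this.2.1⟩
  · refine ⟨h4, ?_, fun C' hC' => by cases hC'; exact .inl h2⟩
    obtain ⟨r', P', -, h5, h6, -⟩ := TC.Wins.voter h2 h3 h4.1
    obtain ⟨k, hk, T', -, h7⟩ := h5.prepVote_inbox
    intro l c hc
    exact h7.2.1 l c (h6 ▸ hc)

end Execution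

end Autobahn

namespace Autobahn

variable {f : ℕ} {Req Dig : Type*} {cfg : Config f Req Dig}

/-! ### Agreement -/

theorem TC.exists_wins {C : TC f Dig} (hC : C.Valid) {cut : Cut f Dig} {w : ℕ}
    (h : C.QCFor cut w ∨ C.PropFor cut w) : ∃ cut', C.Wins cut' := by
  classical
  have hq : ∀ cut w, C.QCFor cut w → w ≤ C.view := by
    rintro cut w ⟨r, b, Q, h1, h2, -, rfl⟩
    exact ((hC.2 r b h1).1 Q h2).2.2
  have hp : ∀ cut w, C.PropFor cut w → w ≤ C.view := by
    rintro cut w ⟨S, h1, h2⟩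
    obtain ⟨r, hr⟩ := Finset.card_pos.1 (by omega : 0 < S.card)
    obtain ⟨b, P, h3, h4, -, h5⟩ := h2 r hr
    exact h5.trans ((hC.2 r b h3).2 P h4).2
  let p : ℕ → Prop := fun w => (∃ cut, C.QCFor cut w) ∨ ∃ cut, C.PropFor cut w
  have hb : ∀ w, p w → w ≤ C.view := fun w hw =>
    hw.elim (fun ⟨c, h⟩ => hq c w h) fun ⟨c, h⟩ => hp c w h
  have hw : p w := h.imp (fun h => ⟨cut, h⟩) fun h => ⟨cut, h⟩
  have hm : p (Nat.findGreatest p C.view) := Nat.findGreatest_spec (hb w hw) hw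
  have hmax : ∀ w, p w → w ≤ Nat.findGreatest p C.view := fun w hw =>
    Nat.le_findGreatest (hb w hw) hw
  by_cases hQ : ∃ cut, C.QCFor cut (Nat.findGreatest p C.view)
  · obtain ⟨c, hc⟩ := hQ
    exact ⟨c, .inl ⟨_, hc, fun c' w' h' => hmax _ (.inl ⟨c', h'⟩),
      fun c' w' h' => hmax _ (.inr ⟨c', h'⟩)⟩⟩
  · obtain ⟨c, hc⟩ := hm.resolve_left hQ
    refine ⟨c, .inr ⟨_, hc, fun c' w' h' => ?_, fun c' w' h' => hmax _ (.inr ⟨c', h'⟩)⟩⟩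
    refine lt_of_le_of_ne (hmax _ (.inl ⟨c', h'⟩)) fun he => hQ ⟨c', he ▸ h'⟩

namespace Execution

variable {E : Execution cfg}

theorem Said.correct {i : ℕ} {r : Replica f} {m : Msg f Req Dig} (h : E.Said i r m) :
    r ∉ E.byz := h.elim fun _ h => h.correct

theorem single_msg {j : ℕ} {r q q' : Replica f} {m m' : Msg f Req Dig}
    {out out' : Set (Replica f × Msg f Req Dig)} (he : E.ev j = .act r out) (hm : (q, m) ∈ out)
    (he' : E.ev j = .act r out') (hm' : (q', m') ∈ out') : m = m' := by
  rw [he] at he'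
  cases he'
  obtain ⟨m0, h⟩ := (E.act_step he).single
  exact (h _ hm).trans (h _ hm').symm

theorem Said.prepVote_unique {i i' : ℕ} {r : Replica f} {P P' : Proposal f Dig}
    (h : E.Said i r (.prepVote P)) (h' : E.Said i' r (.prepVote P')) (hs : P.slot = P'.slot)
    (hv : P.view = P'.view) : P = P' := by
  obtain ⟨q, h⟩ := h
  obtain ⟨q', h'⟩ := h'
  obtain ⟨j, -, out, he, hm, hact⟩ := h.act
  obtain ⟨j', -, out', he', hm', hact'⟩ := h'.act
  obtain ⟨-, -, -, -, -, -, h1, h2⟩ := hact.of_prepVote hm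
  obtain ⟨-, -, -, -, -, -, h1', h2'⟩ := hact'.of_prepVote hm'
  rcases lt_trichotomy j j' with hj | hj | hj
  · obtain ⟨P'', h3, h4⟩ := (E.le r (Nat.succ_le_of_lt hj)).prop P.slot P (by rw [h2]; simp)
    have := h1' P'' (hs ▸ h3)
    omega
  · subst hj
    have := single_msg he hm he' hm'
    cases this
    rfl
  · obtain ⟨P'', h3, h4⟩ := (E.le r (Nat.succ_le_of_lt hj)).prop P'.slot P' (by rw [h2']; simp)
    have := h1 P'' (hs ▸ h3)
    omega

theorem Said.highProp_of_prepVote {i i' v : ℕ} {r : Replica f} {P : Proposal f Dig}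
    {b : Complaint f Dig} (h : E.Said i r (.prepVote P))
    (h' : E.Said i' r (.timeout P.slot v b)) (hv : P.view ≤ v) :
    ∃ P', b.highProp = some P' ∧ P.view ≤ P'.view := by
  obtain ⟨q, h⟩ := h
  obtain ⟨q', h'⟩ := h'
  obtain ⟨j, -, out, he, hm, hact⟩ := h.act
  obtain ⟨j', -, out', he', hm', hact'⟩ := h'.act
  obtain ⟨-, -, -, -, -, h0, h1, h2⟩ := hact.of_prepVote hm
  obtain ⟨-, hb, -, -, hg, -⟩ := hact'.of_timeout hm'
  subst hb
  rcases lt_trichotomy j j' with hj | hj | hj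
  · exact (E.le r (Nat.succ_le_of_lt hj)).prop P.slot P (by rw [h2]; simp)
  · subst hj
    have := single_msg he hm he' hm'
    cases this
  · have := (E.le r (show j' + 1 ≤ j from hj)).givenUp P.slot
    omega

theorem Said.highQC_of_confirmAck {i i' v : ℕ} {r : Replica f} {P : Proposal f Dig}
    {b : Complaint f Dig} (h : E.Said i r (.confirmAck P))
    (h' : E.Said i' r (.timeout P.slot v b)) (hv : P.view ≤ v) :
    ∃ Q, b.highQC = some Q ∧ P.view ≤ Q.prop.view := by
  obtain ⟨q, h⟩ := h
  obtain ⟨q', h'⟩ := h'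
  obtain ⟨j, -, out, he, hm, hact⟩ := h.act
  obtain ⟨j', -, out', he', hm', hact'⟩ := h'.act
  obtain ⟨-, Q, hQ, -, -, h1, h2⟩ := hact.of_confirmAck hm
  obtain ⟨-, hb, -, -, hg, -⟩ := hact'.of_timeout hm'
  subst hb
  rcases lt_trichotomy j j' with hj | hj | hj
  · obtain ⟨Q', h3, h4⟩ :=
      (E.le r (Nat.succ_le_of_lt hj)).conf P.slot Q (by rw [h2]; simp)
    exact ⟨Q', h3, hQ ▸ h4⟩
  · subst hj
    have := single_msg he hm he' hm'
    cases this
  · have := (E.le r (show j' + 1 ≤ j from hj)).givenUp P.slot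
    omega

theorem Genuine.prepareQC_unique {i i' : ℕ} {Q Q' : PrepareQC f Dig} (h : E.Genuine i Q.sigs)
    (hQ : Q.Valid) (h' : E.Genuine i' Q'.sigs) (hQ' : Q'.Valid) (hs : Q.prop.slot = Q'.prop.slot)
    (hv : Q.prop.view = Q'.prop.view) : Q.prop = Q'.prop := by
  obtain ⟨r, h1, h2, h3⟩ := E.exists_correct_inter hQ hQ'
  exact Said.prepVote_unique (h r (.prepVote Q.prop) _ ⟨h1, rfl⟩ h3 rfl)
    (h' r (.prepVote Q'.prop) _ ⟨h2, rfl⟩ h3 rfl) hs hv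

/-- A vote in a later view is justified by a genuine timeout certificate. -/
theorem Said.prepVote_tc {i : ℕ} {r : Replica f} {P : Proposal f Dig}
    (h : E.Said i r (.prepVote P)) (hv : 0 < P.view) : ∃ j < i, ∃ C : TC f Dig, C.Valid ∧
      E.Genuine j C.sigs ∧ C.slot = P.slot ∧ C.view + 1 = P.view ∧
      (C.Wins P.cut ∨ C.NoWinner) := by
  obtain ⟨j, hj, T, h1, h2⟩ := h.prepVote_inbox
  have h3 := (E.genuineInbox j r _ _ h1).subset Set.subset_union_right
  obtain ⟨h4, -, h5⟩ := h2
  cases T with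
  | start prev gate => exact absurd h4.1 hv.ne'
  | tc C => exact ⟨j, hj, C, h4.1, h3, h4.2.1, h4.2.2, h5 C rfl⟩

/-- A cut that is locked in view `w₀` of a slot is voted for in all later views. -/
theorem lock {s w₀ : ℕ} {X : Cut f Dig}
    (hQ : ∀ i (Q : PrepareQC f Dig), Q.Valid → E.Genuine i Q.sigs → Q.prop.slot = s →
      Q.prop.view = w₀ → Q.prop.cut = X)
    (hT : ∀ i (C : TC f Dig), C.Valid → E.Genuine i C.sigs → C.slot = s → w₀ ≤ C.view →
      (∃ cut w, w₀ ≤ w ∧ C.QCFor cut w) ∨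
      ((∀ i r P, E.Said i r (.prepVote P) → P.slot = s → P.view = w₀ → P.cut = X) ∧
        ∀ r b, r ∉ E.byz → C.complaints r = some b →
          ∃ P, b.highProp = some P ∧ w₀ ≤ P.view)) :
    ∀ v i r (P : Proposal f Dig), E.Said i r (.prepVote P) → P.slot = s → P.view = v → w₀ < v →
      P.cut = X := by
  intro v
  induction v using Nat.strong_induction_on with
  | _ v ih =>
    intro i r P h hs hv hw
    obtain ⟨j, -, C, hC, hg, h1, h2, h3⟩ := h.prepVote_tc (by omega)
    have qc : ∀ cut w, C.QCFor cut w → w₀ ≤ w → cut = X := by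
      intro cut w h4 h5
      obtain ⟨Q, h6, h7, h8, h9, h10, h11⟩ := TC.QCFor.genuine h4 hg hC
      rcases h5.eq_or_lt with h5 | h5
      · rw [← h8]
        exact hQ j Q h6 h7 (by omega) (by omega)
      · obtain ⟨r', -, h12, h13⟩ := h7.prepareQC_voter h6
        rw [← h8]
        exact ih w (by omega) j r' Q.prop h13 (by omega) h9 h5
    rcases hT j C hC hg (by omega) (by omega) with ⟨cut, w, h4, h5⟩ | ⟨h4, h5⟩
    · have hex := TC.exists_wins hC (.inl h5)
      rcases h3 with (⟨w', h6, h7, h8⟩ | ⟨w', h6, h7, h8⟩) | h3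
      · exact qc _ _ h6 (h4.trans (h7 _ _ h5))
      · have h9 := h7 _ _ h5
        obtain ⟨r', P', -, h11, h12, h13, h14, h15⟩ := TC.PropFor.voter h6 hg hC
        rw [← h12]
        exact ih P'.view (by omega) j r' P' h11 (by omega) rfl (by omega)
      · exact absurd hex.choose_spec (h3 _)
    · have pv : ∀ i r P, E.Said i r (.prepVote P) → P.slot = s → w₀ ≤ P.view →
          P.view < v → P.cut = X := by
        intro i r P h6 h7 h8 h9
        rcases h8.eq_or_lt with h8 | h8
        · exact h4 i r P h6 h7 h8.symm
        · exact ih P.view h9 i r P h6 h7 rfl h8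
      have hp : C.PropFor X w₀ := by
        obtain ⟨S, h6, h7, h8⟩ := E.card_correct_filter hC.1.ge
        refine ⟨S, h7, fun q hq => ?_⟩
        obtain ⟨b, hb⟩ := Option.isSome_iff_exists.1 (Finset.mem_filter.1 (h6 hq)).2
        obtain ⟨P', h9, h10⟩ := h5 q b (h8 q hq) hb
        obtain ⟨h11, h12⟩ := (hC.2 q b hb).2 P' h9
        obtain ⟨k, hk, h13⟩ := (hg.tc_complaint hb (h8 q hq)).timeout_state
        have h14 := h9
        rw [h13] at h14
        exact ⟨b, P', hb, h9, pv k q P' (E.prop_origin h14).2.2.said (by omega) h10 (by omega), h10⟩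
      have hex := TC.exists_wins hC (.inr hp)
      rcases h3 with (⟨w', h6, h7, h8⟩ | ⟨w', h6, h7, h8⟩) | h3
      · exact qc _ _ h6 (h8 _ _ hp)
      · have h9 := h8 _ _ hp
        obtain ⟨r', P', -, h11, h12, h13, h14, h15⟩ := TC.PropFor.voter h6 hg hC
        rw [← h12]
        exact pv j r' P' h11 (by omega) (by omega) (by omega)
      · exact absurd hex.choose_spec (h3 _)

theorem Genuine.commitQC_sig {i : ℕ} {Q : CommitQC f Dig} (h : E.Genuine i Q.sigs)
    {r : Replica f} (hr : r ∈ Q.signers) (hc : r ∉ E.byz) :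
    E.Said i r (if Q.fast then .prepVote Q.prop else .confirmAck Q.prop) := by
  by_cases hf : Q.fast = true
  · rw [if_pos hf]
    exact h r (.prepVote Q.prop) _ ⟨hr, by simp [hf]⟩ hc rfl
  · rw [if_neg hf]
    exact h r (.confirmAck Q.prop) _ ⟨hr, by simp [hf]⟩ hc rfl

theorem Genuine.commitQC_voter' {i : ℕ} {Q : CommitQC f Dig}
    (h : E.Genuine i Q.sigs) (hQ : Q.Valid) : ∃ r, r ∉ E.byz ∧ E.Said i r (.prepVote Q.prop) :=
  h.commitQC_voter (fun j _ => E.genuineInbox j) hQ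

theorem Genuine.commitQC_lock {i : ℕ} {Q : CommitQC f Dig} (h : E.Genuine i Q.sigs)
    (hQ : Q.Valid) {i' : ℕ} {r : Replica f} {P : Proposal f Dig} (hP : E.Said i' r (.prepVote P))
    (hs : P.slot = Q.prop.slot) (hv : Q.prop.view < P.view) : P.cut = Q.prop.cut := by
  unfold CommitQC.Valid at hQ
  refine lock (s := Q.prop.slot) (w₀ := Q.prop.view) ?_ ?_ P.view i' r P hP hs rfl hv
  · intro k Q' h1 h2 h3 h4
    congr 1
    by_cases hf : Q.fast = true
    · rw [if_pos hf] at hQ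
      obtain ⟨q, -, h5, h6⟩ := h2.prepareQC_voter h1
      have h7 := h.commitQC_sig (hQ ▸ Finset.mem_univ q) h5
      rw [if_pos hf] at h7
      exact h6.prepVote_unique h7 h3 h4
    · rw [if_neg hf] at hQ
      obtain ⟨q, h5, h6⟩ := E.exists_correct (S := Q.signers) (by omega)
      have h7 := h.commitQC_sig h5 h6
      rw [if_neg hf] at h7
      obtain ⟨Q'', h8, h9, h10⟩ := h7.confirmAck_voter fun j _ => E.genuineInbox j
      rw [← h8]
      exact h2.prepareQC_unique h1 h10 h9 (by rw [h3, h8]) (by rw [h4, h8])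
  · intro k C hC hg h1 h2
    by_cases hf : Q.fast = true
    · rw [if_pos hf] at hQ
      refine .inr ⟨fun k r P h3 h4 h5 => ?_, fun r b h3 h4 => ?_⟩
      · have h7 := h.commitQC_sig (hQ ▸ Finset.mem_univ r) h3.correct
        rw [if_pos hf] at h7
        rw [h3.prepVote_unique h7 h4 h5]
      · have h7 := h.commitQC_sig (hQ ▸ Finset.mem_univ r) h3
        rw [if_pos hf] at h7
        have h8 := hg.tc_complaint h4 h3
        rw [h1] at h8
        exact h7.highProp_of_prepVote h8 h2
    · rw [if_neg hf] at hQ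
      obtain ⟨q, h5, h6, h7⟩ := E.exists_correct_inter hQ hC.1.ge
      obtain ⟨b, hb⟩ := Option.isSome_iff_exists.1 (Finset.mem_filter.1 h6).2
      have h8 := h.commitQC_sig h5 h7
      rw [if_neg hf] at h8
      have h9 := hg.tc_complaint hb h7
      rw [h1] at h9
      obtain ⟨Q', h10, h11⟩ := h8.highQC_of_confirmAck h9 h2
      exact .inl ⟨_, _, h11, q, b, Q', hb, h10, rfl, rfl⟩

/-- CommitQCs of a slot agree on the cut. -/
theorem Genuine.commitQC_agree {i i' : ℕ} {Q Q' : CommitQC f Dig} (h : E.Genuine i Q.sigs)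
    (hQ : Q.Valid) (h' : E.Genuine i' Q'.sigs) (hQ' : Q'.Valid)
    (hs : Q.prop.slot = Q'.prop.slot) : Q.prop.cut = Q'.prop.cut := by
  obtain ⟨r, hr, h1⟩ := h.commitQC_voter' hQ
  obtain ⟨r', hr', h1'⟩ := h'.commitQC_voter' hQ'
  rcases lt_trichotomy Q.prop.view Q'.prop.view with hv | hv | hv
  · exact (h.commitQC_lock hQ h1' hs.symm hv).symm
  · congr 1
    have pq : ∀ {i} {Q : CommitQC f Dig}, E.Genuine i Q.sigs → Q.Valid →
        ∃ S : Finset (Replica f), 2 * f + 1 ≤ S.card ∧ ∃ k, ∀ r ∈ S, r ∉ E.byz →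
          E.Said k r (.prepVote Q.prop) := by
      intro i Q h hQ
      unfold CommitQC.Valid at hQ
      by_cases hf : Q.fast = true
      · rw [if_pos hf] at hQ
        refine ⟨Finset.univ, by simp; omega, i, fun r _ hr => ?_⟩
        have := h.commitQC_sig (hQ ▸ Finset.mem_univ r) hr
        rwa [if_pos hf] at this
      · rw [if_neg hf] at hQ
        obtain ⟨q, h5, h6⟩ := E.exists_correct (S := Q.signers) (by omega)
        have h7 := h.commitQC_sig h5 h6
        rw [if_neg hf] at h7
        obtain ⟨Q'', h8, h9, h10⟩ := h7.confirmAck_voter fun j _ => E.genuineInbox j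
        exact ⟨Q''.signers, h9, i, fun r hr hc =>
          h8 ▸ h10 r (.prepVote Q''.prop) _ ⟨hr, rfl⟩ hc rfl⟩
    obtain ⟨S, hS, k, h2⟩ := pq h hQ
    obtain ⟨S', hS', k', h2'⟩ := pq h' hQ'
    obtain ⟨q, h3, h4, h5⟩ := E.exists_correct_inter hS hS'
    exact (h2 q h3 h5).prepVote_unique (h2' q h4 h5) hs hv
  · exact h'.commitQC_lock hQ' h1 hs hv

theorem committed_agree {i i' s : ℕ} {r r' : Replica f} {Q Q' : CommitQC f Dig}
    (h : (E.st i r).committed s = some Q) (h' : (E.st i' r').committed s = some Q') :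
    Q.prop.cut = Q'.prop.cut :=
  Genuine.commitQC_agree (genuine_committed (E.genuineInbox i) h) (E.committed_origin h).1
    (genuine_committed (E.genuineInbox i') h') (E.committed_origin h').1
    ((E.committed_origin h).2.1.trans (E.committed_origin h').2.1.symm)

end Execution

end Autobahn

namespace Autobahn

variable {f : ℕ} {Req Dig : Type*} {cfg : Config f Req Dig}

/-! ### Views and timers -/

theorem exists_leader_eq (s N : ℕ) (r : Replica f) : ∃ v, N ≤ v ∧ leader s v = r := by
  refine ⟨(3 * f + 1) * (N + f * s) + r - f * s, ?_, ?_⟩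
  · have : N + f * s ≤ (3 * f + 1) * (N + f * s) := Nat.le_mul_of_pos_left _ (by omega)
    omega
  · have : N + f * s ≤ (3 * f + 1) * (N + f * s) := Nat.le_mul_of_pos_left _ (by omega)
    have h2 : f * s + ((3 * f + 1) * (N + f * s) + r - f * s) = (3 * f + 1) * (N + f * s) + r := by
      omega
    ext
    simp only [leader, h2, Fin.ofNat]
    rw [Nat.mul_add_mod]
    exact Nat.mod_eq_of_lt r.2

namespace Execution

variable {E : Execution cfg}

variable (E) in
theorem exists_correct_replica : ∃ r, r ∉ E.byz := by
  obtain ⟨r, hr⟩ := Finset.card_pos.1 (lt_of_lt_of_le (Nat.succ_pos _) E.card_correct)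
  exact ⟨r, (Finset.mem_sdiff.1 hr).2⟩

variable (E) in
/-- Before any point of an execution only finitely many messages were sent. -/
theorem exists_sent_bound (M : ℕ) (g : Msg f Req Dig → ℕ) :
    ∃ N, ∀ r q m, E.Sent M r q m → g m < N := by
  induction M with
  | zero => exact ⟨0, fun r q m ⟨j, hj, _⟩ => absurd hj (Nat.not_lt_zero j)⟩
  | succ M ih =>
    obtain ⟨N, hN⟩ := ih
    have hM : ∃ N', ∀ r out, E.ev M = .act r out → ∀ p ∈ out, g p.2 < N' := by
      by_cases h : ∃ r out, E.ev M = .act r out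
      · obtain ⟨r, out, he⟩ := h
        obtain ⟨m, hm⟩ := (E.act_step he).single
        refine ⟨g m + 1, fun r' out' he' p hp => ?_⟩
        rw [he] at he'
        cases he'
        rw [hm p hp]
        exact Nat.lt_succ_self _
      · exact ⟨0, fun r out he => absurd ⟨r, out, he⟩ h⟩
    obtain ⟨N', hN'⟩ := hM
    refine ⟨max N N', fun r q m ⟨j, hj, out, he, hm⟩ => ?_⟩
    rcases Nat.lt_succ_iff_lt_or_eq.1 hj with hj | rfl
    · exact lt_max_of_lt_left (hN r q m ⟨j, hj, out, he, hm⟩)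
    · exact lt_max_of_lt_right (hN' r out he _ hm)

theorem EntersAt.act {j s v : ℕ} {r : Replica f} (h : E.EntersAt j r s v) : ∃ T,
    (∀ q, E.Sent (j + 1) r q (.ticket s v T)) ∧ cfg.TicketValid s v T ∧ E.Genuine j T.sigs := by
  obtain ⟨T, out, he, hm⟩ := h
  obtain ⟨h1, -, h2, -⟩ := (E.act_step he).of_ticket hm
  exact ⟨T, fun q => Sent.now he (h1 q), ticketValid_of_sees h2,
    genuine_sees (E.genuineInbox j) h2⟩

theorem timeout_enters {s v : ℕ} (j : ℕ) : ∀ {r q : Replica f}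
    {out : Set (Replica f × Msg f Req Dig)} {b : Complaint f Dig}, E.ev j = .act r out →
    (q, Msg.timeout s v b) ∈ out →
    ∃ k < j, ∃ r', E.EntersAt k r' s v ∧ E.time k + 10 * cfg.Δ ≤ E.time j := by
  induction j using Nat.strong_induction_on with
  | _ j ih =>
    intro r q out b he hm
    obtain ⟨-, -, -, h1, -, -, ⟨h2, a, h3, h4⟩ | ⟨S, h2, h3⟩⟩ := (E.act_step he).of_timeout hm
    · rcases E.view_origin j s r with ⟨k, hk, h5, h6⟩ | h5 | ⟨-, h5⟩
      · rw [h6] at h3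
        cases h3
        exact ⟨k, hk, r, h2 ▸ h5, h4⟩
      · omega
      · rw [h5] at h3; cases h3
    · obtain ⟨p, hp, hc⟩ := E.exists_correct h2.ge
      obtain ⟨b', hb⟩ := h3 p hp
      obtain ⟨k, hk, out', he', hm'⟩ := E.sent_of_mem_inbox hb hc
      obtain ⟨k', hk', r', h5, h6⟩ := ih k hk he' hm'
      exact ⟨k', hk'.trans hk, r', h5, h6.trans (E.time_mono hk.le)⟩

theorem EntersAt.timeout {j s v : ℕ} {r : Replica f} (h : E.EntersAt j r s (v + 1)) :
    ∃ q b, E.Said j q (.timeout s v b) := by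
  obtain ⟨T, -, hT, hg⟩ := h.act
  cases T with
  | start prev gate => exact absurd hT.1 (Nat.succ_ne_zero v)
  | tc C =>
    obtain ⟨hC, rfl, hv⟩ := hT
    obtain rfl : C.view = v := by omega
    have hcard := hC.1
    obtain ⟨q, hq, hc⟩ := E.exists_correct (S := Finset.univ.filter
      fun r => (C.complaints r).isSome) (by omega)
    obtain ⟨b, hb⟩ := Option.isSome_iff_exists.1 (Finset.mem_filter.1 hq).2
    exact ⟨q, b, hg.tc_complaint hb hc⟩

theorem Said.timeout_enters {s v w : ℕ} (hw : v ≤ w) : ∀ {i : ℕ} {r : Replica f}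
    {b : Complaint f Dig}, E.Said i r (.timeout s w b) →
    ∃ j < i, ∃ k < j, ∃ r', E.EntersAt k r' s v ∧ E.time k + 10 * cfg.Δ ≤ E.time j := by
  induction w, hw using Nat.le_induction with
  | base =>
    rintro i r b ⟨q, j, hj, out, he, hm⟩
    exact ⟨j, hj, Execution.timeout_enters j he hm⟩
  | succ w _ ih =>
    rintro i r b ⟨q, j, hj, out, he, hm⟩
    obtain ⟨k, hk, r', h1, h2⟩ := Execution.timeout_enters j he hm
    obtain ⟨q', b', h3⟩ := h1.timeout
    obtain ⟨j', hj', h4⟩ := ih h3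
    exact ⟨j', by omega, h4⟩

theorem EntersAt.enters_le {j s v w : ℕ} {r : Replica f} (h : E.EntersAt j r s w) (hv : v ≤ w) :
    ∃ k ≤ j, ∃ r', E.EntersAt k r' s v := by
  rcases hv.eq_or_lt with rfl | hv
  · exact ⟨j, le_rfl, r, h⟩
  · obtain ⟨w, rfl⟩ := Nat.exists_eq_succ_of_ne_zero (Nat.ne_zero_of_lt hv)
    obtain ⟨q, b, h1⟩ := h.timeout
    obtain ⟨i, hi, k, hk, r', h2, -⟩ := h1.timeout_enters (Nat.le_of_lt_succ hv)
    exact ⟨k, by omega, r', h2⟩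

theorem enters_of_view {i s v : ℕ} {r : Replica f} (h : v < (E.st i r).view s) :
    ∃ q w b, v ≤ w ∧ E.Said i q (.timeout s w b) := by
  rcases E.view_origin i s r with ⟨j, hj, h1, -⟩ | h1 | ⟨h1, -⟩
  · obtain ⟨w, hw⟩ := Nat.exists_eq_succ_of_ne_zero (Nat.ne_zero_of_lt h)
    rw [hw] at h1 h
    obtain ⟨q, b, h2⟩ := h1.timeout
    exact ⟨q, w, b, Nat.le_of_lt_succ h, h2.mono hj.le⟩
  · obtain ⟨b, hb⟩ := E.givenUp_origin h1
    exact ⟨r, _, b, h.le, (hb r).said⟩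
  · omega

theorem EntersAt.spread {j s v : ℕ} {r' r : Replica f} (h : E.EntersAt j r' s v) (hr : r ∉ E.byz)
    {t : ℝ} (ht : E.late (E.time j) ≤ t) (hopen : (E.st (E.idx t) r).committed s = none) :
    v ≤ (E.st (E.idx t) r).view s ∧
      ((E.st (E.idx t) r).view s = 0 → (E.st (E.idx t) r).deadline s ≠ none) := by
  obtain ⟨T, h1, h2, -⟩ := h.act
  have h3 := ((h1 r).mono (Nat.succ_le_of_lt (E.lt_idx_time j))).arrives hr ht
  have h4 := fun σ' out => E.quiet (σ' := σ') (out := out)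
    ((E.time_nonneg j).trans ((E.lt_late _).le.trans ht)) hr
  by_contra hc
  refine h4 _ _ (Config.Act.enter _ s v T hopen (.forwarded h3 h2) ?_)
  by_contra h5
  push Not at h5
  apply hc
  refine ⟨h5.1, fun h6 => h5.2 (by omega) h6⟩

/-- The first replica enters view `v` of slot `s` with the event `j`. -/
def FirstEnter (E : Execution cfg) (j s v : ℕ) : Prop :=
  (∃ r, E.EntersAt j r s v) ∧ ∀ k r, E.EntersAt k r s v → j ≤ k

theorem EntersAt.exists_first {j s v : ℕ} {r : Replica f} (h : E.EntersAt j r s v) :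
    ∃ j, E.FirstEnter j s v := by
  classical
  have hex : ∃ j, ∃ r, E.EntersAt j r s v := ⟨j, r, h⟩
  exact ⟨Nat.find hex, Nat.find_spec hex, fun k r hk => Nat.find_min' hex ⟨r, hk⟩⟩

theorem FirstEnter.no_timeout {j s v w : ℕ} (h : E.FirstEnter j s v) (hw : v ≤ w) {t : ℝ}
    (ht : t < E.time j + 10 * cfg.Δ) {r : Replica f} {b : Complaint f Dig} :
    ¬ E.Said (E.idx t) r (.timeout s w b) := by
  intro h'
  obtain ⟨i, hi, k, hk, r', h1, h2⟩ := h'.timeout_enters hw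
  have h3 := E.time_mono (h.2 k r' h1)
  have h4 := E.lt_idx.1 hi
  linarith

theorem FirstEnter.in_view {j s v : ℕ} (h : E.FirstEnter j s v) {r : Replica f}
    (hr : r ∉ E.byz) {t : ℝ} (ht : E.late (E.time j) ≤ t) (ht' : t < E.time j + 10 * cfg.Δ)
    (hopen : (E.st (E.idx t) r).committed s = none) :
    (E.st (E.idx t) r).view s = v ∧ (E.st (E.idx t) r).givenUp s ≤ v ∧
      (E.st (E.idx t) r).deadline s ≠ none := by
  obtain ⟨r', h1⟩ := h.1
  obtain ⟨h2, h3⟩ := h1.spread hr ht hopen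
  have h4 : (E.st (E.idx t) r).view s = v := by
    refine le_antisymm (not_lt.1 fun hc => ?_) h2
    obtain ⟨q, w, b, h4, h5⟩ := enters_of_view hc
    exact h.no_timeout h4 ht' h5
  have h5 : (E.st (E.idx t) r).givenUp s ≠ v + 1 := fun hc => by
    obtain ⟨b, hb⟩ := E.givenUp_origin hc
    exact h.no_timeout le_rfl ht' (hb r).said
  have h6 := E.givenUp_le (E.idx t) s r
  refine ⟨h4, by omega, ?_⟩
  rcases E.view_origin (E.idx t) s r with ⟨k, -, -, h7⟩ | h7 | ⟨h7, -⟩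
  · rw [h7]; exact Option.some_ne_none _
  · rw [h4] at h7; exact absurd h7 h5
  · exact h3 h7

/-! ### A view of a correct leader after stabilization -/

theorem Sent.prepare_led {i : ℕ} {r q : Replica f} {P : Proposal f Dig} {T : Ticket f Dig}
    (h : E.Sent i r q (.prepare P T)) : (E.st i r).led P.slot P.view = some P := by
  obtain ⟨j, hj, out, he, hm, hact⟩ := h.act
  exact (E.le r (Nat.succ_le_of_lt hj)).led _ _ _ (hact.of_prepare hm).2.2.2.2.1

theorem Said.eq_of_led {i i' s v : ℕ} {r : Replica f} {P P' : Proposal f Dig}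
    (h : E.Said i r (.prepVote P')) (hs : P'.slot = s) (hv : P'.view = v)
    (hL : leader s v ∉ E.byz) (hled : (E.st i' (leader s v)).led s v = some P) : P' = P := by
  subst hs hv
  obtain ⟨j, hj, T, h1, -⟩ := h.prepVote_inbox
  have h2 := (E.sent_of_mem_inbox h1 hL).prepare_led
  have h3 := (E.le (leader P'.slot P'.view) (le_max_left j i')).led _ _ _ h2
  have h4 := (E.le (leader P'.slot P'.view) (le_max_right j i')).led _ _ _ hled
  rw [h3] at h4
  exact Option.some.inj h4

theorem FirstEnter.leader_proposes {j s v : ℕ} (h : E.FirstEnter j s v) (hv : 0 < v)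
    (hL : leader s v ∉ E.byz) {t : ℝ} (ht : E.late (E.time j) ≤ t)
    (ht' : t < E.time j + 10 * cfg.Δ) :
    (E.st (E.idx t) (leader s v)).committed s ≠ none ∨
      ∃ P, (E.st (E.idx t) (leader s v)).led s v = some P := by
  by_contra hc
  push Not at hc
  obtain ⟨hopen, hled⟩ := hc
  obtain ⟨h1, h2, h3⟩ := h.in_view hL ht ht' hopen
  obtain ⟨r, h4⟩ := h.1
  obtain ⟨T, h5, h6, -⟩ := h4.act
  have h7 := ((h5 (leader s v)).mono (Nat.succ_le_of_lt (E.lt_idx_time j))).arrives hL ht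
  have hq := fun σ' out => E.quiet (σ' := σ') (out := out)
    ((E.time_nonneg j).trans ((E.lt_late _).le.trans ht)) hL
  have h8 : (E.st (E.idx t) (leader s v)).led s v = none := by
    cases hl : (E.st (E.idx t) (leader s v)).led s v with
    | none => rfl
    | some P => exact absurd hl (hled P)
  cases T with
  | start prev gate => exact absurd h6.1 hv.ne'
  | tc C =>
    by_cases hw : ∃ cut, C.Wins cut
    · obtain ⟨cut, hw⟩ := hw
      exact hq _ _ (Config.Act.repropose _ s v C cut rfl hopen h1 h2 h8 (.forwarded h7 h6)
        (.inl hw))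
    · exact hq _ _ (Config.Act.repropose _ s v C _ rfl hopen h1 h2 h8 (.forwarded h7 h6)
        (.inr ⟨not_exists.1 hw, rfl⟩))

theorem FirstEnter.prepared {j s v : ℕ} (h : E.FirstEnter j s v) (hG : E.GST ≤ E.time j)
    (hL : leader s v ∉ E.byz) {P : Proposal f Dig}
    (hP : (E.st (E.idx (E.time j + cfg.Δ)) (leader s v)).led s v = some P) {r : Replica f}
    (hr : r ∉ E.byz) {t : ℝ} (ht : E.time j + 2 * cfg.Δ ≤ t) (ht' : t < E.time j + 10 * cfg.Δ)
    (hopen : (E.st (E.idx t) r).committed s = none) :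
    (E.st (E.idx t) r).prop s = some P := by
  have hΔ := cfg.Δ_pos
  obtain ⟨hs, hv, T, hT⟩ := E.led_origin hP
  have hl : E.late (E.time j) ≤ t := by rw [E.late_of_le hG]; linarith
  obtain ⟨h1, h2, h3⟩ := h.in_view hr hl ht' hopen
  have h4 := (hT r).arrives hr (t' := t) (by rw [E.late_of_le (by linarith)]; linarith)
  have h5 := (hT r).prepareValid
  subst hs hv
  by_cases h6 : ∀ P', (E.st (E.idx t) r).prop P.slot = some P' → P'.view < P.view
  · exact absurd (Config.Act.prepVote _ P T h4 h5 hopen h1 h3 h2 h6)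
      (E.quiet ((E.time_nonneg j).trans (by linarith)) hr)
  · push Not at h6
    obtain ⟨P', h6, h7⟩ := h6
    obtain ⟨h8, h9, h10⟩ := E.prop_origin h6
    rw [h1] at h9
    rw [h6, h10.said.eq_of_led h8 (le_antisymm h9 h7) hL hP]

/-- In a view of a correct leader after stabilization some correct replica commits. -/
theorem FirstEnter.exists_committed {j s v : ℕ} (h : E.FirstEnter j s v) (hv : 0 < v)
    (hG : E.GST ≤ E.time j) (hL : leader s v ∉ E.byz) :
    ∃ i r, r ∉ E.byz ∧ (E.st i r).committed s ≠ none := by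
  by_contra hN
  push Not at hN
  have hN : ∀ i r, r ∉ E.byz → (E.st i r).committed s = none := fun i r hr => hN i r hr
  have hΔ := cfg.Δ_pos
  have h0 := E.time_nonneg j
  set t₀ := E.time j with ht₀
  set L : Replica f := leader s v with hLdef
  have late : ∀ k : ℝ, 0 ≤ k → E.late (t₀ + k * cfg.Δ) = t₀ + (k + 1) * cfg.Δ := by
    intro k hk
    rw [E.late_of_le (hG.trans (by nlinarith))]
    ring
  have view : ∀ r, r ∉ E.byz → ∀ k : ℝ, 1 ≤ k → k < 10 →
      (E.st (E.idx (t₀ + k * cfg.Δ)) r).view s = v ∧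
      (E.st (E.idx (t₀ + k * cfg.Δ)) r).givenUp s ≤ v := by
    intro r hr k hk hk'
    have := h.in_view hr (t := t₀ + k * cfg.Δ) (by rw [E.late_of_le hG]; nlinarith) (by nlinarith)
      (hN _ r hr)
    exact ⟨this.1, this.2.1⟩
  have quiet : ∀ r, r ∉ E.byz → ∀ k : ℝ, 0 ≤ k → ∀ σ' out,
      ¬ cfg.Act (t₀ + k * cfg.Δ) r (E.st (E.idx (t₀ + k * cfg.Δ)) r) σ' out := by
    intro r hr k hk σ' out
    exact E.quiet (by nlinarith) hr
  have no_commit : ∀ (Q : CommitQC f Dig) (k : ℝ), 0 ≤ k → Q.Valid → Q.prop.slot = s →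
      ¬ E.Sent (E.idx (t₀ + k * cfg.Δ)) L L (.commit Q) := by
    intro Q k hk hQ hs hsent
    have h1 := hsent.arrives hL (t' := t₀ + (k + 1) * cfg.Δ) (late k hk).le
    exact quiet L hL (k + 1) (by linarith) _ _
      (Config.Act.commit _ L Q h1 hQ (by rw [hs]; exact hN _ L hL))
  obtain ⟨P, hP⟩ := (h.leader_proposes hv hL (t := t₀ + 1 * cfg.Δ)
    (by rw [E.late_of_le hG]; linarith) (by linarith)).resolve_left (not_not.2 (hN _ L hL))
  obtain ⟨hPs, hPv, -⟩ := E.led_origin hP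
  have hled : ∀ k : ℝ, 1 ≤ k → (E.st (E.idx (t₀ + k * cfg.Δ)) L).led P.slot P.view = some P := by
    intro k hk
    rw [hPs, hPv]
    exact (E.le L (E.idx_mono (by nlinarith))).led _ _ _ hP
  -- the votes
  have votes : ∀ r ∈ Finset.univ \ E.byz,
      (r, .prepVote P) ∈ (E.st (E.idx (t₀ + 3 * cfg.Δ)) L).inbox := by
    intro r hr
    rw [Finset.mem_sdiff] at hr
    have h1 := h.prepared hG hL (by rwa [one_mul] at hP) hr.2 (t := t₀ + 2 * cfg.Δ) le_rfl
      (by linarith) (hN _ r hr.2)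
    obtain ⟨-, -, h2⟩ := E.prop_origin h1
    rw [hPs, hPv] at h2
    exact h2.arrives hL (by rw [late 2 (by norm_num)]; norm_num)
  have h3 : ∃ a, (E.st (E.idx (t₀ + 3 * cfg.Δ)) L).fastAt P.slot P.view = some a := by
    rw [← Option.ne_none_iff_exists']
    intro hnone
    exact quiet L hL 3 (by norm_num) _ _ (Config.Act.awaitFast _ P _ (hled 3 (by norm_num))
      (by rw [hPs]; exact hN _ L hL)
      (by rw [hPs, hPv]; exact (view L hL 3 (by norm_num) (by norm_num)).1) hnone
      E.card_correct votes)
  have h4 : ∃ S, 2 * f + 1 ≤ S.card ∧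
      ∀ q, E.Sent (E.idx (t₀ + 4 * cfg.Δ)) L q (.confirm ⟨P, S⟩) := by
    have hset : (P.slot, P.view) ∈ (E.st (E.idx (t₀ + 4 * cfg.Δ)) L).settled := by
      by_contra hnew
      have hvotes : ∀ r ∈ Finset.univ \ E.byz,
          (r, .prepVote P) ∈ (E.st (E.idx (t₀ + 4 * cfg.Δ)) L).inbox := fun r hr =>
        E.inbox_mono L (E.idx_mono (by linarith)) (votes r hr)
      have hw : ∃ a, (E.st (E.idx (t₀ + 4 * cfg.Δ)) L).fastAt P.slot P.view = some a ∧
          a ≤ t₀ + 4 * cfg.Δ := by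
        obtain ⟨a, ha⟩ := h3
        obtain ⟨k, hk, rfl⟩ := E.fastAt_origin ha
        refine ⟨_, E.fastAt_mono (E.idx_mono (by linarith)) ha, ?_⟩
        have := E.lt_idx.1 hk
        have := cfg.fastWait_le
        linarith
      obtain ⟨a, ha, ha'⟩ := hw
      exact quiet L hL 4 (by norm_num) _ _ (Config.Act.confirm _ P _ a (hled 4 (by norm_num))
        (by rw [hPs]; exact hN _ L hL)
        (by rw [hPs, hPv]; exact (view L hL 4 (by norm_num) (by norm_num)).1) hnew ha ha'
        E.card_correct hvotes)
    obtain ⟨P', -, -, h5, h6⟩ := E.settled_origin hset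
    rw [hled 4 (by norm_num)] at h5
    cases h5
    refine h6.resolve_right fun h6 => ?_
    exact no_commit ⟨P, true, Finset.univ⟩ 4 (by norm_num) (by simp [CommitQC.Valid]) hPs (h6 L)
  obtain ⟨S, hS, h4⟩ := h4
  have acks : ∀ r ∈ Finset.univ \ E.byz,
      (r, .confirmAck P) ∈ (E.st (E.idx (t₀ + 6 * cfg.Δ)) L).inbox := by
    intro r hr
    rw [Finset.mem_sdiff] at hr
    have h5 := (h4 r).arrives hr.2 (t' := t₀ + 5 * cfg.Δ) (by rw [late 4 (by norm_num)]; norm_num)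
    obtain ⟨h6, h7⟩ := view r hr.2 5 (by norm_num) (by norm_num)
    have h8 : E.Sent (E.idx (t₀ + 5 * cfg.Δ)) r L (.confirmAck P) := by
      by_cases h8 : ∀ Q', (E.st (E.idx (t₀ + 5 * cfg.Δ)) r).conf P.slot = some Q' →
          Q'.prop.view < P.view
      · refine absurd (Config.Act.confirmAck _ ⟨P, S⟩ ?_ hS ?_ ?_ ?_ h8)
          (quiet r hr.2 5 (by norm_num) _ _)
        · rw [← hPs, ← hPv] at hLdef
          rw [← hLdef]
          exact h5
        · dsimp only
          rw [hPs]; exact hN _ r hr.2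
        · dsimp only
          rw [hPs, hPv]; exact h6
        · dsimp only
          rw [hPs, hPv]; exact h7
      · push Not at h8
        obtain ⟨Q', h8, h9⟩ := h8
        rw [hPs] at h8
        obtain ⟨-, h10, h11, h12, h13⟩ := E.conf_origin h8
        have h14 : Q'.prop.view = v := by omega
        rw [h10, h14] at h11 h13
        have h15 : Q'.prop = P := by
          obtain ⟨k, hk, out, -, hm, hact⟩ := (E.sent_of_mem_inbox h11 hL).act
          have h16 := (E.le L hk.le).led _ _ _ (hact.of_confirm hm).2.1
          rw [h10, h14, ← hPs, ← hPv, hled 5 (by norm_num)] at h16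
          exact (Option.some.inj h16).symm
        rw [h15] at h13
        exact h13
    exact h8.arrives hL (by rw [late 5 (by norm_num)]; norm_num)
  have hfin : (P.slot, P.view) ∈ (E.st (E.idx (t₀ + 6 * cfg.Δ)) L).finished := by
    by_contra hnew
    exact quiet L hL 6 (by norm_num) _ _ (Config.Act.slowCommit _ P _ (hled 6 (by norm_num))
      (by rw [hPs]; exact hN _ L hL)
      (by rw [hPs, hPv]; exact (view L hL 6 (by norm_num) (by norm_num)).1) hnew
      E.card_correct acks)
  obtain ⟨P', S', h5, -, h6, h7⟩ := E.finished_origin hfin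
  exact no_commit ⟨P', false, S'⟩ 6 (by norm_num) (by simpa [CommitQC.Valid] using h6)
    (h5.trans hPs) (h7 L)

end Execution

end Autobahn

namespace Autobahn

variable {f : ℕ} {Req Dig : Type*} {cfg : Config f Req Dig}

/-! ### Every slot is committed -/

namespace Execution

variable {E : Execution cfg}

theorem Said.timeout_act {i s v : ℕ} {r : Replica f} {b : Complaint f Dig}
    (h : E.Said i r (.timeout s v b)) : b.Valid s v ∧ (∀ q, E.Sent i r q (.timeout s v b)) ∧
      ∃ j < i, (E.st j r).committed s = none ∧ E.Sent (j + 1) r r (.timeout s v b) := by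
  obtain ⟨q, h⟩ := h
  obtain ⟨j, hj, out, he, hm, hact⟩ := h.act
  obtain ⟨h1, rfl, h2, -, -, h3, -⟩ := hact.of_timeout hm
  refine ⟨⟨fun Q hQ => ?_, fun P hP => ?_⟩, fun q => ⟨j, hj, out, he, h1 q⟩, j, hj, h2,
    Sent.now he (h1 r)⟩
  · obtain ⟨h4, h5, -, h6, -⟩ := E.conf_origin hQ
    exact ⟨h4, h5, h6.trans h3⟩
  · obtain ⟨h4, h5, -⟩ := E.prop_origin hP
    exact ⟨h4, h5.trans h3⟩

theorem exists_enters_of_view {i s : ℕ} {r : Replica f}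
    (h : (E.st i r).view s ≠ 0 ∨ (E.st i r).deadline s ≠ none) :
    ∃ j r v, E.EntersAt j r s v := by
  rcases h with h | h
  · obtain ⟨q, w, b, hw, h1⟩ := enters_of_view (Nat.pos_of_ne_zero h)
    obtain ⟨j, -, k, -, r', h2, -⟩ := h1.timeout_enters hw
    exact ⟨k, r', 0, h2⟩
  · obtain ⟨v, j, -, h⟩ := E.deadline_origin h
    exact ⟨j, r, v, h⟩

theorem Said.prepVote_enters {i : ℕ} {r : Replica f} {P : Proposal f Dig}
    (h : E.Said i r (.prepVote P)) : ∃ j r v, E.EntersAt j r P.slot v := by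
  obtain ⟨q, h⟩ := h
  obtain ⟨j, hj, out, he, hm, hact⟩ := h.act
  obtain ⟨-, -, -, -, h1, -⟩ := hact.of_prepVote hm
  exact exists_enters_of_view (.inr h1)

theorem committed_voter {i s : ℕ} {r : Replica f} {Q : CommitQC f Dig}
    (h : (E.st i r).committed s = some Q) :
    ∃ r', r' ∉ E.byz ∧ E.Said i r' (.prepVote Q.prop) :=
  (genuine_committed (E.genuineInbox i) h).commitQC_voter' (E.committed_origin h).1

/-- As long as nobody commits, the timers drive the replicas through all views. -/
theorem exists_enters {s : ℕ} (hN : ∀ i r, r ∉ E.byz → (E.st i r).committed s = none)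
    (h : ∃ j r v, E.EntersAt j r s v) (v : ℕ) : ∃ j r, E.EntersAt j r s v := by
  have hΔ := cfg.Δ_pos
  induction v with
  | zero =>
    obtain ⟨j, r, v, h⟩ := h
    obtain ⟨k, -, r', h⟩ := h.enters_le (Nat.zero_le v)
    exact ⟨k, r', h⟩
  | succ v ih =>
    obtain ⟨j, r₀, h⟩ := ih
    by_contra hc
    have h0 := E.time_nonneg j
    have hto : ∀ i r w b, v < w → ¬ E.Said i r (.timeout s w b) := fun i r w b hw h' => by
      obtain ⟨-, -, k, -, r', h2, -⟩ := h'.timeout_enters hw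
      exact hc ⟨k, r', h2⟩
    have hview : ∀ i r, (E.st i r).view s ≤ v := fun i r => by
      by_contra hlt
      push Not at hlt
      rcases E.view_origin i s r with ⟨k, -, h1, -⟩ | h1 | ⟨h1, -⟩
      · obtain ⟨k, -, r', h2⟩ := h1.enters_le hlt
        exact hc ⟨k, r', h2⟩
      · obtain ⟨b, hb⟩ := E.givenUp_origin h1
        exact hto i r _ b hlt (hb r).said
      · omega
    set t₁ := E.late (E.time j) with ht₁
    have ht₁0 : 0 ≤ t₁ := h0.trans (E.lt_late _).le
    have hsp : ∀ r, r ∉ E.byz → ∀ t, t₁ ≤ t → (E.st (E.idx t) r).view s = v ∧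
        (v = 0 → (E.st (E.idx t) r).deadline s ≠ none) := fun r hr t ht => by
      obtain ⟨h1, h2⟩ := h.spread hr ht (hN _ r hr)
      have h3 := le_antisymm (hview _ r) h1
      exact ⟨h3, fun hv => h2 (h3.trans hv)⟩
    set t₂ := t₁ + 10 * cfg.Δ with ht₂
    have hup : ∀ r, r ∉ E.byz → (E.st (E.idx t₂) r).givenUp s = v + 1 := fun r hr => by
      have h1 := E.givenUp_le (E.idx t₂) s r
      obtain ⟨h2, h3⟩ := hsp r hr t₂ (by linarith)
      obtain ⟨h2', h3'⟩ := hsp r hr t₁ le_rfl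
      have hle := E.le r (E.idx_mono (show t₁ ≤ t₂ by linarith))
      rw [h2] at h1
      refine le_antisymm h1 ?_
      rcases E.view_origin (E.idx t₁) s r with ⟨k, hk, -, h4⟩ | h4 | ⟨h4, h5⟩
      · have h5 := hle.deadline_eq s (h2.trans h2'.symm) _ h4
        by_contra hg
        refine E.quiet (show 0 ≤ t₂ by linarith) hr (Config.Act.timeout _ s _ (hN _ r hr) h5 ?_ ?_)
        · have := E.lt_idx.1 hk
          linarith
        · rw [h2]; omega
      · rw [← h2', ← h4]
        exact hle.givenUp s
      · exact absurd h5 (h3' (h2' ▸ h4))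
    choose b hb using fun (r : {r // r ∉ E.byz}) => E.givenUp_origin (hup r.1 r.2)
    obtain ⟨S, hS, hcard⟩ := Finset.exists_subset_card_eq E.card_correct
    have hSc : ∀ r ∈ S, r ∉ E.byz := fun r hr => (Finset.mem_sdiff.1 (hS hr)).2
    classical
    let C : TC f Dig := ⟨s, v, fun r => if hr : r ∈ S then some (b ⟨r, hSc r hr⟩) else none⟩
    have hCs : ∀ r b', C.complaints r = some b' → ∃ hr : r ∈ S, b ⟨r, hSc r hr⟩ = b' := by
      intro r b' h1
      by_cases hr : r ∈ S
      · exact ⟨hr, by simpa [C, hr] using h1⟩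
      · simp [C, hr] at h1
    have hC : C.Valid := by
      constructor
      · rw [← hcard]
        congr 1
        ext r
        by_cases hr : r ∈ S <;> simp [C, hr]
      · intro r b' h1
        obtain ⟨hr, rfl⟩ := hCs r b' h1
        exact (hb ⟨r, hSc r hr⟩ r).said.timeout_act.1
    obtain ⟨r, hr⟩ := E.exists_correct_replica
    have ht₃ := E.lt_late t₂
    refine E.quiet (t := E.late t₂) (by linarith) hr
      (Config.Act.enter _ s (v + 1) (.tc C) (hN _ r hr) (.timeouts ⟨hC, rfl, rfl⟩ ?_) (.inl ?_))
    · intro q b' h1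
      obtain ⟨hq, rfl⟩ := hCs q b' h1
      exact (hb ⟨q, hSc q hq⟩ r).arrives hr le_rfl
    · rw [(hsp r hr _ (by linarith)).1]
      exact Nat.lt_succ_self v

/-- If a slot is entered, some correct replica commits it. -/
theorem exists_committed {s : ℕ} (h : ∃ j r v, E.EntersAt j r s v) :
    ∃ i r, r ∉ E.byz ∧ (E.st i r).committed s ≠ none := by
  by_contra hN
  push Not at hN
  obtain ⟨N, hb⟩ := E.exists_sent_bound (E.idx E.GST)
    (fun m => match m with | .ticket _ v _ => v | _ => 0)
  obtain ⟨L, hL⟩ := E.exists_correct_replica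
  obtain ⟨v, hv, rfl⟩ := exists_leader_eq s (N + 1) L
  obtain ⟨j, r, hj⟩ := exists_enters hN h v
  obtain ⟨j₀, h0⟩ := hj.exists_first
  obtain ⟨i, r', h1, h2⟩ := h0.exists_committed (by omega) (by
    by_contra hlt
    obtain ⟨r', T, out, he, hm⟩ := h0.1
    have := hb r' r' (.ticket s v T) ⟨j₀, E.lt_idx.2 (not_le.1 hlt).le, out, he, hm⟩
    dsimp only at this
    omega) hL
  exact h2 (hN i r' h1)

/-- A replica that complains about a committed slot is helped. -/
theorem Said.timeout_committed {i s v : ℕ} {q r : Replica f} {b : Complaint f Dig}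
    (h : E.Said i q (.timeout s v b)) {i' : ℕ} (hr : r ∉ E.byz)
    (hc : (E.st i' r).committed s ≠ none) : ∃ k, (E.st k q).committed s ≠ none := by
  have hq := h.correct
  obtain ⟨-, hs, -⟩ := h.timeout_act
  set t := E.time (max i i') with ht
  have hi : max i i' ≤ E.idx t := (E.lt_idx_time _).le
  have h0 : 0 ≤ t := E.time_nonneg _
  have h1 := ((hs r).mono ((le_max_left _ _).trans hi)).arrives hr le_rfl
  have hlt := E.lt_late t
  obtain ⟨Q, hQ⟩ := Option.ne_none_iff_exists'.1 hc
  have h2 := (E.le r ((le_max_right i i').trans (hi.trans (E.idx_mono hlt.le)))).committed _ _ hQ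
  have h3 : (q, s, v) ∈ (E.st (E.idx (E.late t)) r).helped := by
    by_contra hnew
    exact E.quiet (h0.trans hlt.le) hr (Config.Act.help _ q s v b Q h1 h2 hnew)
  obtain ⟨Q', h4, h5⟩ := E.helped_origin h3
  have h6 := h5.arrives hq le_rfl
  obtain ⟨h7, h8, -⟩ := E.committed_origin h4
  refine ⟨E.idx (E.late (E.late t)), fun hnone => E.quiet ((h0.trans hlt.le).trans (E.lt_late (E.late t)).le) hq
    (Config.Act.commit _ r Q' h6 h7 ?_)⟩
  rw [h8]
  exact hnone

/-- If a slot is committed by some correct replica, all correct replicas commit it. -/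
theorem committed_of_committed {s i₀ : ℕ} {r₀ r : Replica f} (hr₀ : r₀ ∉ E.byz)
    (hc : (E.st i₀ r₀).committed s ≠ none) (hr : r ∉ E.byz) :
    ∃ i, (E.st i r).committed s ≠ none := by
  by_contra hN
  push Not at hN
  have hΔ := cfg.Δ_pos
  have hent : ∃ j r v, E.EntersAt j r s v := by
    obtain ⟨Q, hQ⟩ := Option.ne_none_iff_exists'.1 hc
    obtain ⟨r', -, h1⟩ := committed_voter hQ
    obtain ⟨-, rfl, -⟩ := E.committed_origin hQ
    exact h1.prepVote_enters
  have hto : ∀ i v b, ¬ E.Said i r (.timeout s v b) := fun i v b h => by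
    obtain ⟨k, hk⟩ := h.timeout_committed hr₀ hc
    exact hk (hN k)
  have hb : ∀ q, ∃ N, ∀ i v b, E.Said i q (.timeout s v b) → v < N := by
    intro q
    by_cases hq : ∃ k, (E.st k q).committed s ≠ none
    · obtain ⟨k, hk⟩ := hq
      obtain ⟨N, hN⟩ := E.exists_sent_bound k (fun m => match m with | .timeout _ v _ => v | _ => 0)
      refine ⟨N, fun i v b h => ?_⟩
      obtain ⟨-, -, j, hj, h1, h2⟩ := h.timeout_act
      refine hN q q (.timeout s v b) (h2.mono ?_)
      by_contra hlt
      obtain ⟨Q, hQ⟩ := Option.ne_none_iff_exists'.1 hk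
      rw [(E.le q (show k ≤ j by omega)).committed _ _ hQ] at h1
      cases h1
    · refine ⟨0, fun i v b h => ?_⟩
      exact absurd (h.timeout_committed hr₀ hc) hq
  choose N hN' using hb
  have hview : ∀ i, (E.st i r).view s ≤ Finset.univ.sup N := by
    intro i
    rcases E.view_origin i s r with ⟨k, -, h1, -⟩ | h1 | ⟨h1, -⟩
    · rcases Nat.eq_zero_or_pos ((E.st i r).view s) with h2 | h2
      · omega
      · obtain ⟨w, hw⟩ := Nat.exists_eq_succ_of_ne_zero h2.ne'
        rw [hw] at h1 ⊢
        obtain ⟨q, b, h3⟩ := h1.timeout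
        exact (Nat.succ_le_of_lt (hN' q _ _ _ h3)).trans (Finset.le_sup (f := N) (Finset.mem_univ q))
    · obtain ⟨b, hb⟩ := E.givenUp_origin h1
      exact absurd (hb r).said (hto i _ b)
    · omega
  have hbdd : BddAbove (Set.range fun i => (E.st i r).view s) :=
    ⟨_, by rintro _ ⟨i, rfl⟩; exact hview i⟩
  obtain ⟨i₁, hi₁⟩ := Nat.sSup_mem (Set.range_nonempty fun i => (E.st i r).view s) hbdd
  have hmax : ∀ i, (E.st i r).view s ≤ (E.st i₁ r).view s := fun i => by
    dsimp only at hi₁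
    rw [hi₁]
    exact le_csSup hbdd ⟨i, rfl⟩
  obtain ⟨j, r', v, hj⟩ := hent
  set t := max (E.late (E.time j)) (E.time i₁) with ht
  have ht0 : 0 ≤ t := le_max_of_le_right (E.time_nonneg _)
  obtain ⟨-, h1⟩ := hj.spread hr (le_max_left _ _ : _ ≤ t) (hN _)
  have heq : ∀ t', t ≤ t' → (E.st (E.idx t') r).view s = (E.st i₁ r).view s := fun t' ht' =>
    le_antisymm (hmax _) ((E.le r ((E.lt_idx_time i₁).le.trans
      (E.idx_mono ((le_max_right _ _).trans ht')))).view s)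
  rcases E.view_origin (E.idx t) s r with ⟨k, hk, -, h2⟩ | h2 | ⟨h2, h3⟩
  · have htt : t ≤ t + 10 * cfg.Δ := by linarith
    have h3 := (E.le r (E.idx_mono htt)).deadline_eq s ((heq _ htt).trans (heq t le_rfl).symm) _ h2
    refine E.quiet (ht0.trans htt) hr (Config.Act.timeout _ s _ (hN _) h3 ?_ ?_)
    · have := E.lt_idx.1 hk
      linarith
    · by_contra hg
      have h4 := E.givenUp_le (E.idx (t + 10 * cfg.Δ)) s r
      have h5 : (E.st (E.idx (t + 10 * cfg.Δ)) r).givenUp s =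
          (E.st (E.idx (t + 10 * cfg.Δ)) r).view s + 1 := by omega
      obtain ⟨b, hb⟩ := E.givenUp_origin h5
      exact hto _ _ b (hb r).said
  · obtain ⟨b, hb⟩ := E.givenUp_origin h2
    exact hto _ _ b (hb r).said
  · exact h1 h2 h3

theorem exists_enters_of_sees {s i : ℕ} {T : Ticket f Dig} {r : Replica f} (hr : r ∉ E.byz)
    (h : cfg.Sees (E.st (E.idx (E.time i)) r) s 0 T) : ∃ j r v, E.EntersAt j r s v := by
  cases hc : (E.st (E.idx (E.time i)) r).committed s with
  | some Q =>
    obtain ⟨r', -, h1⟩ := committed_voter hc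
    obtain ⟨-, rfl, -⟩ := E.committed_origin hc
    exact h1.prepVote_enters
  | none =>
    apply exists_enters_of_view (i := E.idx (E.time i)) (r := r)
    by_contra hv
    push Not at hv
    exact E.quiet (E.time_nonneg i) hr
      (Config.Act.enter _ s 0 T hc h (.inr ⟨rfl, hv.1, hv.2⟩))

variable (E)

/-- Every correct replica commits every slot. -/
theorem all_committed (s : ℕ) : ∀ r, r ∉ E.byz → ∃ i, (E.st i r).committed s ≠ none := by
  induction s using Nat.strong_induction_on with
  | _ s ih =>
    suffices hent : ∃ j r v, E.EntersAt j r s v by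
      obtain ⟨i, r', h1, h2⟩ := exists_committed hent
      exact fun r hr => committed_of_committed h1 h2 hr
    have gate : ∀ r, r ∉ E.byz → ∃ i₀ gate, ∀ i, i₀ ≤ i → cfg.GateValid s gate ∧
        ∀ Q, gate = some Q → (E.st i r).committed Q.prop.slot = some Q := by
      intro r hr
      unfold Config.GateValid
      cases hk : cfg.maxParallel with
      | none => exact ⟨0, none, fun i _ => ⟨rfl, fun Q hQ => by cases hQ⟩⟩
      | some k =>
        have hk1 := cfg.maxParallel_pos k hk
        by_cases hs : s < k
        · refine ⟨0, none, fun i _ => ⟨?_, fun Q hQ => by cases hQ⟩⟩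
          dsimp only
          rw [if_pos hs]
        · obtain ⟨i₀, h1⟩ := ih (s - k) (by omega) r hr
          obtain ⟨Q, hQ⟩ := Option.ne_none_iff_exists'.1 h1
          obtain ⟨h2, h3, -⟩ := E.committed_origin hQ
          refine ⟨i₀, some Q, fun i hi => ⟨?_, fun Q' hQ' => ?_⟩⟩
          · dsimp only
            rw [if_neg hs]
            exact ⟨Q, rfl, h2, by omega⟩
          · cases hQ'
            rw [h3]
            exact (E.le r hi).committed _ _ hQ
    rcases Nat.eq_zero_or_pos s with rfl | hs
    · obtain ⟨r, hr⟩ := E.exists_correct_replica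
      obtain ⟨i₀, g, h1⟩ := gate r hr
      obtain ⟨h2, h3⟩ := h1 (E.idx (E.time i₀)) (E.lt_idx_time i₀).le
      exact exists_enters_of_sees (i := i₀) hr (.preceding (prev := none) (gate := g)
        ⟨rfl, h2, by simp⟩ (fun P hP => by cases hP) h3)
    · obtain ⟨r₀, hr₀⟩ := E.exists_correct_replica
      obtain ⟨i, h1⟩ := ih (s - 1) (by omega) r₀ hr₀
      obtain ⟨Q, hQ⟩ := Option.ne_none_iff_exists'.1 h1
      obtain ⟨r, hr, h2⟩ := committed_voter hQ
      obtain ⟨-, hQs, -⟩ := E.committed_origin hQ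
      obtain ⟨j, -, T, h3, h4⟩ := h2.prepVote_inbox
      obtain ⟨i₀, g, h5⟩ := gate r hr
      have hle : max i₀ j ≤ E.idx (E.time (max i₀ j)) := (E.lt_idx_time _).le
      obtain ⟨h6, h7⟩ := h5 _ ((le_max_left _ _).trans hle)
      refine exists_enters_of_sees (i := max i₀ j) hr (.preceding (prev := some Q.prop) (gate := g)
        ⟨rfl, h6, ?_⟩ (fun P hP => ?_) h7)
      · rw [if_neg hs.ne']
        exact ⟨_, rfl, by omega, h4.2.1⟩
      · cases hP
        exact ⟨T, h4, E.inbox_mono r ((le_max_right _ _).trans hle) h3⟩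

end Execution

end Autobahn

namespace Autobahn

variable {f : ℕ} {Req Dig : Type*} {cfg : Config f Req Dig}

/-! ### Slots whose first two leaders are correct -/

namespace Execution

variable {E : Execution cfg}

variable (E) in
theorem exists_correct_leaders (N : ℕ) :
    ∃ s, N ≤ s ∧ (leader s 0 : Replica f) ∉ E.byz ∧ (leader s 1 : Replica f) ∉ E.byz := by
  have h1 : ∃ a : Replica f, a ∉ E.byz ∧ a + 1 ∉ E.byz := by
    by_contra hc
    push Not at hc
    have h2 : (Finset.univ : Finset (Replica f)) ⊆
        E.byz ∪ Finset.univ.filter fun a => a + 1 ∈ E.byz := by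
      intro a _
      by_cases ha : a ∈ E.byz
      · exact Finset.mem_union_left _ ha
      · exact Finset.mem_union_right _ (Finset.mem_filter.2 ⟨Finset.mem_univ a, hc a ha⟩)
    have h3 := Finset.card_le_card_of_injOn (s := Finset.univ.filter fun a => a + 1 ∈ E.byz)
      (t := E.byz) (fun a => a + 1) (fun a ha => (Finset.mem_filter.1 ha).2)
      (add_left_injective 1).injOn
    have h4 := (Finset.card_le_card h2).trans (Finset.card_union_le _ _)
    have h5 := E.byz_card
    rw [Finset.card_univ, Fintype.card_fin] at h4
    omega
  obtain ⟨a, h1, h2⟩ := h1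
  have ha := a.2
  obtain ⟨c, hc⟩ : ∃ c, f * (3 * ((3 * f + 1) * (N + 1) - a)) = (3 * f + 1) * c + a := by
    have h3 : N + 1 + a ≤ (3 * f + 1) * (N + 1) := by nlinarith
    obtain ⟨m, hm⟩ := Nat.exists_eq_add_of_le h3
    refine ⟨m, ?_⟩
    rw [show (3 * f + 1) * (N + 1) - a = N + 1 + m by omega]
    nlinarith
  refine ⟨3 * ((3 * f + 1) * (N + 1) - a), ?_, ?_, ?_⟩
  · have : N + 1 + a ≤ (3 * f + 1) * (N + 1) := by nlinarith
    omega
  · convert h1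
    ext
    simp only [leader, Fin.ofNat, hc]
    rw [add_zero, Nat.mul_add_mod, Nat.mod_eq_of_lt ha]
  · convert h2
    ext
    simp only [leader, Fin.ofNat, hc]
    rw [add_assoc, Nat.mul_add_mod, Fin.val_add]
    simp

/-- If the leaders of the first two views of a slot are correct and take part in it only once their
tips for lane `h` and the network are good, then the committed cut contains a good tip. -/
theorem tipPos_of_correct_leaders {s p M : ℕ} {h : Replica f}
    (hL₀ : (leader s 0 : Replica f) ∉ E.byz) (hL₁ : (leader s 1 : Replica f) ∉ E.byz)
    (hprep : ∀ r q P T, E.Sent M r q (.prepare P T) → P.slot ≠ s)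
    (htick : ∀ r q v T, ¬ E.Sent M r q (.ticket s v T))
    (hG : E.idx E.GST ≤ M)
    (htips : ∀ i r, M ≤ i → r ∉ E.byz → p ≤ tipPos ((E.st i r).tips h))
    {i : ℕ} {r : Replica f} {Q : CommitQC f Dig} (hQ : (E.st i r).committed s = some Q) :
    p ≤ tipPos (Q.prop.cut h) := by
  have hΔ := cfg.Δ_pos
  have prep : ∀ {i r q P T}, E.Sent i r q (.prepare P T) → P.slot = s →
      p ≤ tipPos (P.cut h) ∨ ∃ k r' P', E.Said k r' (.prepVote P') ∧
        P'.cut = P.cut ∧ P'.slot = s ∧ P'.view < P.view := by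
    intro i r q P T h1 hs
    obtain ⟨j, hj, out, he, hm, hact⟩ := h1.act
    have hMj : M ≤ j := by
      by_contra hlt
      exact hprep r q P T ⟨j, not_le.1 hlt, out, he, hm⟩ hs
    obtain ⟨-, -, h2, -, -, ⟨h3, -⟩ | ⟨C, rfl, h3⟩⟩ := hact.of_prepare hm
    · exact .inl (h3 ▸ htips j r hMj h1.correct)
    · have h4 := genuine_sees (E.genuineInbox j) h2
      obtain ⟨h5, h6, h7⟩ := ticketValid_of_sees h2
      obtain ⟨r', P', -, h8, h9, h10, h11⟩ := TC.Wins.voter h3 h4 h5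
      exact .inr ⟨j, r', P', h8, h9, by omega, by omega⟩
  have vote0 : ∀ {i r P}, E.Said i r (.prepVote P) → P.slot = s → P.view = 0 →
      p ≤ tipPos (P.cut h) := by
    intro i r P h1 hs hv
    obtain ⟨j, hj, T, h2, -⟩ := h1.prepVote_inbox
    rw [hs, hv] at h2
    rcases prep (E.sent_of_mem_inbox h2 hL₀) hs with h3 | ⟨k, r', P', h3, h4, h5, h6⟩
    · exact h3
    · omega
  have prep1 : ∀ {i r q P T}, E.Sent i r q (.prepare P T) → P.slot = s → P.view = 1 →
      p ≤ tipPos (P.cut h) := by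
    intro i r q P T h1 hs hv
    rcases prep h1 hs with h3 | ⟨k, r', P', h2, h3, h4, h5⟩
    · exact h3
    · rw [← h3]
      exact vote0 h2 h4 (by omega)
  have vote1 : ∀ {i r P}, E.Said i r (.prepVote P) → P.slot = s → P.view ≤ 1 →
      p ≤ tipPos (P.cut h) := by
    intro i r P h1 hs hv
    rcases Nat.le_one_iff_eq_zero_or_eq_one.1 hv with hv | hv
    · exact vote0 h1 hs hv
    · obtain ⟨j, hj, T, h2, -⟩ := h1.prepVote_inbox
      rw [hs, hv] at h2
      exact prep1 (E.sent_of_mem_inbox h2 hL₁) hs hv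
  have late : ∀ {i r P}, E.Said i r (.prepVote P) → P.slot = s → 1 < P.view →
      ∃ q w b, 1 ≤ w ∧ E.Said i q (.timeout s w b) := by
    intro i r P h1 hs hv
    obtain ⟨j, hj, C, hC, hg, h2, h3, -⟩ := h1.prepVote_tc (by omega)
    have hcard := hC.1
    obtain ⟨q, hq, hc⟩ := E.exists_correct (S := Finset.univ.filter
      fun r => (C.complaints r).isSome) (by omega)
    obtain ⟨b, hb⟩ := Option.isSome_iff_exists.1 (Finset.mem_filter.1 hq).2
    exact ⟨q, C.view, b, by omega, (h2.trans hs) ▸ (hg.tc_complaint hb hc).mono hj.le⟩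
  obtain ⟨-, hs, -⟩ := E.committed_origin hQ
  obtain ⟨r', -, hvote⟩ := committed_voter hQ
  by_cases hv : Q.prop.view ≤ 1
  · exact vote1 hvote hs hv
  push Not at hv
  obtain ⟨q, w, b, hw, h1⟩ := late hvote hs hv
  obtain ⟨-, -, k, -, r'', h2, -⟩ := h1.timeout_enters hw
  obtain ⟨j, hj⟩ := h2.exists_first
  have hGj : E.GST ≤ E.time j := by
    by_contra hlt
    obtain ⟨r₁, h3⟩ := hj.1
    obtain ⟨T, out, he, hm⟩ := h3
    exact htick r₁ r₁ 1 T ⟨j, (E.lt_idx.2 (not_le.1 hlt).le).trans_le hG, out, he, hm⟩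
  rcases hj.leader_proposes one_pos hL₁ (t := E.time j + cfg.Δ) (E.late_of_le hGj).le
    (by linarith) with hc | ⟨P, hP⟩
  · obtain ⟨Q₀, hQ₀⟩ := Option.ne_none_iff_exists'.1 hc
    rw [committed_agree hQ hQ₀]
    obtain ⟨-, hs₀, -⟩ := E.committed_origin hQ₀
    obtain ⟨r₀, -, hvote₀⟩ := committed_voter hQ₀
    by_cases hv₀ : Q₀.prop.view ≤ 1
    · exact vote1 hvote₀ hs₀ hv₀
    · obtain ⟨q, w, b, hw, h1⟩ := late hvote₀ hs₀ (not_le.1 hv₀)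
      exact absurd h1 (hj.no_timeout hw (by linarith))
  · obtain ⟨hPs, hPv, T, hT⟩ := E.led_origin hP
    have huniq : ∀ i r P', E.Said i r (.prepVote P') → P'.slot = s → P'.view = 1 →
        P'.cut = P.cut := fun i r P' h3 h4 h5 => by
      rw [h3.eq_of_led h4 h5 hL₁ hP]
    rw [lock (X := P.cut) (s := s) (w₀ := 1) ?_ ?_ Q.prop.view i r' Q.prop hvote hs rfl hv]
    · exact prep1 (hT r) hPs hPv
    · intro i Q' h3 h4 h5 h6
      obtain ⟨q, -, -, h7⟩ := h4.prepareQC_voter h3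
      exact huniq i q _ h7 h5 h6
    · rintro i C hC hg rfl h3
      refine .inr ⟨huniq, fun q b hq hb => ?_⟩
      obtain ⟨q', h4⟩ := hg.tc_complaint hb hq
      obtain ⟨k, hk, out, he, hm, hact⟩ := h4.act
      obtain ⟨-, rfl, hopen, -⟩ := hact.of_timeout hm
      have hle : E.idx (E.time j + 2 * cfg.Δ) ≤ k := by
        by_contra hlt
        exact hj.no_timeout h3 (t := E.time j + 2 * cfg.Δ) (by linarith)
          ((Sent.now he hm).said.mono (by omega))
      have hopen' : (E.st (E.idx (E.time j + 2 * cfg.Δ)) q).committed C.slot = none := by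
        by_contra hne
        obtain ⟨Q', hQ'⟩ := Option.ne_none_iff_exists'.1 hne
        rw [(E.le q hle).committed _ _ hQ'] at hopen
        cases hopen
      have h5 := hj.prepared hGj hL₁ hP hq le_rfl (by linarith) hopen'
      obtain ⟨P', h6, h7⟩ := (E.le q hle).prop _ _ h5
      exact ⟨P', h6, by omega⟩

/-- If the tips of lane `h` eventually reach position `p` everywhere, then some slot is committed
with such a tip. -/
theorem exists_slot_tipPos {p M₀ : ℕ} {h : Replica f}
    (htips : ∀ i r, M₀ ≤ i → r ∉ E.byz → p ≤ tipPos ((E.st i r).tips h)) :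
    ∃ s, ∀ i r Q, (E.st i r).committed s = some Q → p ≤ tipPos (Q.prop.cut h) := by
  obtain ⟨N, hN⟩ := E.exists_sent_bound (max M₀ (E.idx E.GST)) (fun m => match m with
    | .ticket s _ _ => s
    | .prepare P _ => P.slot
    | _ => 0)
  obtain ⟨s, hs, h0, h1⟩ := E.exists_correct_leaders N
  refine ⟨s, fun i r Q hQ => tipPos_of_correct_leaders h0 h1 ?_ ?_ (le_max_right M₀ _)
    (fun i r hi hr => htips i r ((le_max_left _ _).trans hi) hr) hQ⟩
  · intro r q P T h he
    have := hN _ _ _ h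
    dsimp only at this
    omega
  · intro r q v T h
    have := hN _ _ _ h
    dsimp only at this
    omega

end Execution

end Autobahn

namespace Autobahn

variable {f : ℕ} {Req Dig : Type*} {cfg : Config f Req Dig}

/-! ### The lanes of correct replicas -/

theorem Config.Act.pool {t : ℝ} {r : Replica f} {σ σ' : RState f Req Dig}
    {out : Set (Replica f × Msg f Req Dig)} (h : cfg.Act t r σ σ' out) :
    (σ'.pool = σ.pool ∧ σ'.own = σ.own) ∨ ∃ B rest, B ≠ [] ∧ σ.pool = B ++ rest ∧
      σ'.pool = rest ∧ σ'.own = σ.own ++ [cfg.newCar r σ B] := by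
  cases h
  case proposeCar B rest hB hpool hready => exact .inr ⟨B, rest, hB, hpool, rfl, rfl⟩
  all_goals exact .inl ⟨rfl, rfl⟩

namespace Execution

variable {E : Execution cfg}

theorem exists_uniform {p : Replica f → ℕ → Prop} (h : ∀ r, r ∉ E.byz → ∃ j, p r j) :
    ∃ J, ∀ r, r ∉ E.byz → ∃ j ≤ J, p r j := by
  have : ∀ r, ∃ j, r ∉ E.byz → p r j := fun r => by
    by_cases hr : r ∈ E.byz
    · exact ⟨0, fun h => absurd hr h⟩
    · exact (h r hr).imp fun j hj _ => hj
  choose j hj using this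
  exact ⟨Finset.univ.sup j, fun r hr => ⟨j r, Finset.le_sup (Finset.mem_univ r), hj r hr⟩⟩

theorem own_mono {i j k : ℕ} (hij : i ≤ j) {r : Replica f} {d : DataProp f Req Dig}
    (h : (E.st i r).own[k]? = some d) : (E.st j r).own[k]? = some d := by
  obtain ⟨hk, -⟩ := List.getElem?_eq_some_iff.1 h
  obtain ⟨t, ht⟩ := (E.le r hij).own
  rw [← ht, List.getElem?_append_left hk, h]

theorem own_unique {i j k : ℕ} {r : Replica f} {d d' : DataProp f Req Dig}
    (h : (E.st i r).own[k]? = some d) (h' : (E.st j r).own[k]? = some d') : d = d' := by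
  have h1 := own_mono (le_max_left i j) h
  have h2 := own_mono (le_max_right i j) h'
  rw [h1] at h2
  exact Option.some.inj h2

theorem lanes_own {i p : ℕ} {r h : Replica f} (hh : h ∉ E.byz) {d : DataProp f Req Dig}
    (hd : (E.st i r).lanes h p = some d) : ∃ k, p = k + 1 ∧ (E.st i h).own[k]? = some d := by
  obtain ⟨-, rfl, ⟨cert, h1⟩, -, -⟩ := E.lanes_origin hd
  obtain ⟨j, hj, out, he, hm, hact⟩ := (E.sent_of_mem_inbox h1 hh).act
  obtain ⟨B, rest, h2, -, -, h3⟩ := hact.of_car hm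
  refine ⟨(E.st j h).own.length, ?_, own_mono (Nat.succ_le_of_lt hj) ?_⟩
  · rw [h2]; rfl
  · rw [h3]; simp

/-- All correct replicas vote for the cars of a correct replica. -/
theorem own_voted {h : Replica f} (hh : h ∉ E.byz) (k : ℕ) : ∀ {i : ℕ} {d : DataProp f Req Dig},
    (E.st i h).own[k]? = some d → ∀ r, r ∉ E.byz →
      ∃ j, (E.st j r).lanes h (k + 1) = some d := by
  induction k using Nat.strong_induction_on with
  | _ k ih =>
    intro i d hd r hr
    obtain ⟨h1, h2, cert, h3, h4⟩ := E.own_origin.1 k d hd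
    have key : ∃ j, ∀ σ, (E.st j r).Le σ → cfg.FollowsParent σ d cert := by
      rcases h4 with ⟨rfl, h5, h6⟩ | ⟨k', p, c, rfl, h6, h7, h8, h9, h10, h11, h12⟩
      · exact ⟨0, fun _ _ => .inl ⟨h2, h5, h6⟩⟩
      · obtain ⟨j, hj⟩ := ih k' (Nat.lt_succ_self _) h6 r hr
        exact ⟨j, fun σ hσ => .inr ⟨k' + 1, p, c, h1 ▸ hσ.lanes _ _ _ hj, h2, h7, h8, h9,
          h10.trans h1.symm, h11, h12⟩⟩
    obtain ⟨j, hj⟩ := key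
    set t := E.time (max i j) with ht
    have hle : max i j ≤ E.idx t := (E.lt_idx_time _).le
    have hlt := E.lt_late t
    have h5 := ((h3 r).mono ((le_max_left _ _).trans hle)).arrives hr le_rfl
    have h6 := hj _ (E.le r ((le_max_right _ _).trans (hle.trans (E.idx_mono hlt.le))))
    refine ⟨E.idx (E.late t), ?_⟩
    cases hl : (E.st (E.idx (E.late t)) r).lanes h (k + 1) with
    | none =>
      refine absurd (Config.Act.voteCar _ d cert ?_ ?_ h6)
        (E.quiet ((E.time_nonneg _).trans hlt.le) hr)
      · rw [h1]; exact h5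
      · rw [h1, h2]; exact hl
    | some d' =>
      obtain ⟨k', h7, h8⟩ := lanes_own hh hl
      obtain rfl : k = k' := by omega
      rw [own_unique h8 hd]

/-- The cars of a correct replica are certified. -/
theorem own_certified {h : Replica f} (hh : h ∉ E.byz) {i k : ℕ}
    (hk : (E.st i h).own.length = k + 1) :
    ∃ j, i ≤ j ∧ (k + 1 < (E.st j h).own.length ∨ (E.st j h).ownCert ≠ none) := by
  obtain ⟨d, hd⟩ : ∃ d, (E.st i h).own[k]? = some d :=
    ⟨_, List.getElem?_eq_getElem (by omega : k < (E.st i h).own.length)⟩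
  obtain ⟨J, hJ⟩ := exists_uniform (own_voted hh k hd)
  set t := E.time (max i J) with ht
  have hle : max i J ≤ E.idx t := (E.lt_idx_time _).le
  have hlt := E.lt_late t
  have hvotes : ∀ r, r ∉ E.byz →
      (r, .carVote h (k + 1) (cfg.hash d)) ∈ (E.st (E.idx (E.late t)) h).inbox := by
    intro r hr
    obtain ⟨j, hj, h0⟩ := hJ r hr
    obtain ⟨-, -, -, -, h1⟩ := E.lanes_origin h0
    exact (h1.mono (hj.trans ((le_max_right _ _).trans hle))).arrives hh le_rfl
  refine ⟨E.idx (E.late t), (le_max_left _ _).trans (hle.trans (E.idx_mono hlt.le)), ?_⟩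
  by_contra hc
  push Not at hc
  have hle' := E.le h ((le_max_left _ _).trans (hle.trans (E.idx_mono hlt.le)))
  have h1 : (E.st (E.idx (E.late t)) h).own.length = k + 1 := by
    have := hle'.own.length_le
    omega
  have h2 := own_mono ((le_max_left _ _).trans (hle.trans (E.idx_mono hlt.le))) hd
  obtain ⟨-, h3, -⟩ := E.own_origin.1 k d hd
  obtain ⟨S, hS, hcard⟩ := Finset.exists_subset_card_eq (s := Finset.univ \ E.byz) (n := f + 1)
    (by have := E.card_correct; omega)
  refine E.quiet ((E.time_nonneg _).trans hlt.le) hh (Config.Act.certifyCar _ d S ∅ ?_ hc.2 hcard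
    (fun q hq => ?_) (.inl rfl))
  · rw [List.getLast?_eq_getElem?, h1]
    exact h2
  · rw [h3]
    exact hvotes q (Finset.mem_sdiff.1 (hS hq)).2

theorem request_step {i : ℕ} {r : Replica f} {x : Req} (h : E.ev i = .request r x) :
    E.st (i + 1) r = { E.st i r with pool := (E.st i r).pool ++ [x] } := by
  have := E.step i
  rw [h] at this
  have hs' : E.st (i + 1) = _ := this
  rw [hs', Function.update_self]

/-- The lane of a correct replica that keeps receiving requests grows forever. -/
theorem own_unbounded {h : Replica f} (hh : h ∉ E.byz)
    (hs : ∃ᶠ i in Filter.atTop, ∃ x, E.ev i = .request h x) (n : ℕ) :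
    ∃ i, n ≤ (E.st i h).own.length := by
  induction n with
  | zero => exact ⟨0, Nat.zero_le _⟩
  | succ n ih =>
    obtain ⟨i, hi⟩ := ih
    by_contra hc
    push Not at hc
    have hlen : ∀ j, i ≤ j → (E.st j h).own.length = n := fun j hj => by
      have := (E.le h hj).own.length_le
      have := hc j
      omega
    have hready : ∃ J, i ≤ J ∧ ∀ j, J ≤ j → (E.st j h).own = [] ∨ (E.st j h).ownCert ≠ none := by
      rcases Nat.eq_zero_or_pos n with rfl | hn
      · exact ⟨i, le_rfl, fun j hj => .inl (List.eq_nil_of_length_eq_zero (hlen j hj))⟩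
      · obtain ⟨J, hiJ, hJ⟩ := own_certified hh (i := i) (k := n - 1)
          (by rw [hlen i le_rfl]; omega)
        obtain ⟨c, hcert⟩ := Option.ne_none_iff_exists'.1
          (hJ.resolve_left (by have := hc J; omega))
        refine ⟨J, hiJ, fun j hj => .inr ?_⟩
        have := (E.le h hj).own_eq (by rw [hlen J hiJ, hlen j (hiJ.trans hj)]) c hcert
        exact fun hn => by rw [hn] at this; cases this
    obtain ⟨J, hiJ, hJ⟩ := hready
    obtain ⟨i', hi', x, hx⟩ := Filter.frequently_atTop.1 hs J
    have hpool : ∀ j, i' + 1 ≤ j → (E.st j h).pool ≠ [] := by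
      intro j hj
      induction j, hj using Nat.le_induction with
      | base => rw [request_step hx]; simp
      | succ j hj ihj =>
        rcases E.step_cases j h with h1 | ⟨src, m, -, h1⟩ | ⟨y, -, h1⟩ | ⟨out, -, h1⟩
        · rwa [h1]
        · rwa [h1]
        · rw [h1]; simp
        · rcases h1.pool with ⟨h2, -⟩ | ⟨B, rest, -, -, -, h2⟩
          · rwa [h2]
          · have h3 := congrArg List.length h2
            rw [hlen _ (by omega), List.length_append, hlen _ (by omega)] at h3
            simp at h3
    have hlt := E.lt_idx_time i'
    exact E.quiet (E.time_nonneg i') hh (Config.Act.proposeCar _ _ [] (hpool _ hlt) (by simp)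
      (hJ _ (by omega)))

/-- A request received by a correct replica is put into a later car of its lane. -/
theorem request_in_own {h : Replica f} (hh : h ∉ E.byz)
    (hs : ∃ᶠ i in Filter.atTop, ∃ x, E.ev i = .request h x) {i : ℕ} {x : Req}
    (hx : E.ev i = .request h x) :
    ∃ j k d, (E.st i h).own.length ≤ k ∧ (E.st j h).own[k]? = some d ∧ x ∈ d.batch := by
  by_contra hc
  push Not at hc
  have hinv : ∀ j, i + 1 ≤ j → ∃ pre post, (E.st j h).pool = pre ++ x :: post ∧
      pre.length + (E.st j h).own.length ≤ (E.st i h).pool.length + (E.st i h).own.length := by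
    intro j hj
    induction j, hj using Nat.le_induction with
    | base => exact ⟨(E.st i h).pool, [], by rw [request_step hx]; exact ⟨rfl, le_rfl⟩⟩
    | succ j hj ih =>
      obtain ⟨pre, post, h1, h2⟩ := ih
      rcases E.step_cases j h with h3 | ⟨src, m, -, h3⟩ | ⟨y, -, h3⟩ | ⟨out, -, h3⟩
      · rw [h3]; exact ⟨pre, post, h1, h2⟩
      · rw [h3]; exact ⟨pre, post, h1, h2⟩
      · rw [h3]; exact ⟨pre, post ++ [y], by simp [h1], h2⟩
      · rcases h3.pool with ⟨h4, h5⟩ | ⟨B, rest, h4, h5, h6, h7⟩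
        · rw [h4, h5]; exact ⟨pre, post, h1, h2⟩
        · have hB := List.length_pos_of_ne_nil h4
          have hshort : ∀ a', pre = B ++ a' → rest = a' ++ x :: post →
              ∃ pre post, (E.st (j + 1) h).pool = pre ++ x :: post ∧
              pre.length + (E.st (j + 1) h).own.length ≤
                (E.st i h).pool.length + (E.st i h).own.length := by
            intro a' h8 h9
            refine ⟨a', post, h6.trans h9, ?_⟩
            rw [h7]
            rw [h8] at h2
            simp only [List.length_append, List.length_singleton] at h2 ⊢
            omega
          rw [h5] at h1
          rcases List.append_eq_append_iff.1 h1 with ⟨a', h8, h9⟩ | ⟨c', h8, h9⟩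
          · exact hshort a' h8 h9
          · cases c' with
            | nil => exact hshort [] (by simpa using h8.symm) (by simpa using h9.symm)
            | cons y c' =>
              simp only [List.cons_append, List.cons.injEq] at h9
              refine absurd ?_ (hc (j + 1) (E.st j h).own.length (cfg.newCar h (E.st j h) B)
                (E.le h (show i ≤ j by omega)).own.length_le (by rw [h7]; simp))
              change x ∈ B
              rw [h8, ← h9.1]
              simp
  obtain ⟨j, hj⟩ := own_unbounded hh hs ((E.st i h).pool.length + (E.st i h).own.length + 1)
  obtain ⟨pre, post, -, h1⟩ := hinv (max j (i + 1)) (le_max_right _ _)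
  have := (E.le h (le_max_left j (i + 1))).own.length_le
  omega

/-- The tips of the lane of a correct replica advance at all correct replicas. -/
theorem tips_advance {h : Replica f} (hh : h ∉ E.byz)
    (hs : ∃ᶠ i in Filter.atTop, ∃ x, E.ev i = .request h x) (p : ℕ) :
    ∃ M, ∀ i r, M ≤ i → r ∉ E.byz → p ≤ tipPos ((E.st i r).tips h) := by
  obtain ⟨i, hi⟩ := own_unbounded hh hs (p + 1)
  obtain ⟨J, hJ⟩ := exists_uniform (own_voted hh p
    (List.getElem?_eq_getElem (by omega : p < (E.st i h).own.length)))
  refine ⟨J, fun k r hk hr => ?_⟩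
  obtain ⟨j, hj, h1⟩ := hJ r hr
  have h2 := (E.le r (hj.trans hk)).tips h
  rcases (E.lanes_origin h1).2.2.2.1 with ⟨h3, -⟩ | ⟨k', d', h3, -, -, h4⟩
  · omega
  · omega

end Execution

end Autobahn

namespace Autobahn

variable {f : ℕ} {Req Dig : Type*} {cfg : Config f Req Dig}

/-! ### Segments of a lane -/

namespace Config.Segment

variable {l : Replica f} {lo : ℕ} {tip : Option (PoA f Dig)} {ds ds' : List (DataProp f Req Dig)}

theorem tip_ne_none (h : cfg.Segment l lo tip ds) (hd : ds ≠ []) : ∃ c, tip = some c := by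
  cases tip with
  | some c => exact ⟨c, rfl⟩
  | none =>
    have := h.1
    rw [show tipPos (none : Option (PoA f Dig)) = 0 from rfl] at this
    exact absurd (List.eq_nil_of_length_eq_zero (by omega)) hd

theorem unique (h : cfg.Segment l lo tip ds) (h' : cfg.Segment l lo tip ds') : ds = ds' := by
  have hlen : ds.length = ds'.length := h.1.trans h'.1.symm
  have key : ∀ k < ds.length, ds[ds.length - 1 - k]? = ds'[ds.length - 1 - k]? := by
    intro k
    induction k with
    | zero =>
      intro hk
      obtain ⟨c, rfl⟩ := h.tip_ne_none (List.ne_nil_of_length_pos hk)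
      have h1 : ds[ds.length - 1 - 0]? = some (ds[ds.length - 1]'(by omega)) :=
        List.getElem?_eq_getElem _
      have h2 : ds'[ds.length - 1 - 0]? = some (ds'[ds.length - 1]'(by omega)) :=
        List.getElem?_eq_getElem _
      have h3 := h.2.2.2 _ c (by rw [List.getLast?_eq_getElem?]; exact h1) rfl
      have h4 := h'.2.2.2 _ c (by rw [List.getLast?_eq_getElem?, ← hlen]; exact h2) rfl
      rw [h1, h2, cfg.hash_injective (h3.trans h4.symm)]
    | succ k ih =>
      intro hk
      have h0 := ih (by omega)
      obtain ⟨m, hm⟩ : ∃ m, ds.length - 1 - k = m + 1 := ⟨ds.length - 1 - (k + 1), by omega⟩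
      rw [show ds.length - 1 - (k + 1) = m by omega]
      rw [hm] at h0
      have h1 : ds[m]? = some (ds[m]'(by omega)) := List.getElem?_eq_getElem _
      have h2 : ds'[m]? = some (ds'[m]'(by omega)) := List.getElem?_eq_getElem _
      have h3 : ds[m + 1]? = some (ds[m + 1]'(by omega)) := List.getElem?_eq_getElem _
      have h4 := h.2.2.1 m _ _ h1 h3
      have h5 := h'.2.2.1 m _ _ h2 (h0.symm.trans h3)
      rw [h4] at h5
      rw [h1, h2, cfg.hash_injective (Option.some.inj h5)]
  refine List.ext_getElem? fun i => ?_
  by_cases hi : i < ds.length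
  · have := key (ds.length - 1 - i) (by omega)
    rwa [show ds.length - 1 - (ds.length - 1 - i) = i by omega] at this
  · rw [List.getElem?_eq_none (by omega), List.getElem?_eq_none (by omega)]

theorem drop (h : cfg.Segment l lo tip ds) {lo' : ℕ} (hlo : lo ≤ lo') :
    cfg.Segment l lo' tip (ds.drop (lo' - lo)) := by
  obtain ⟨h1, h2, h3, h4⟩ := h
  refine ⟨?_, fun i d hd => ?_, fun i d e hd he => ?_, fun d c hd hc => ?_⟩
  · rw [List.length_drop, h1]; omega
  · rw [List.getElem?_drop] at hd
    obtain ⟨h5, h6⟩ := h2 _ _ hd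
    exact ⟨h5, by omega⟩
  · rw [List.getElem?_drop] at hd he
    exact h3 _ d e hd (by rw [← he]; congr 1)
  · refine h4 d c ?_ hc
    rw [List.getLast?_drop] at hd
    split_ifs at hd
    exact hd

end Config.Segment

namespace Execution

variable {E : Execution cfg}

theorem lanes_downward {i q p : ℕ} {r l : Replica f} {d : DataProp f Req Dig}
    (h : (E.st i r).lanes l p = some d) (hq : 0 < q) (hqp : q ≤ p) :
    ∃ d, (E.st i r).lanes l q = some d := by
  induction p generalizing d with
  | zero => omega
  | succ p ih =>
    rcases hqp.eq_or_lt with rfl | hlt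
    · exact ⟨d, h⟩
    · rcases (E.lanes_origin h).2.2.2.1 with ⟨h1, -⟩ | ⟨k, d', h1, h2, -⟩
      · omega
      · obtain rfl : p = k := by omega
        exact ih h2 (by omega)

/-- The votes of a replica for a lane form a segment. -/
theorem segment_of_lanes {i : ℕ} {r : Replica f} {c : PoA f Dig} {d : DataProp f Req Dig}
    (h : (E.st i r).lanes c.lane c.pos = some d) (hd : cfg.hash d = c.dig) (lo : ℕ) :
    cfg.Segment c.lane lo (some c)
        ((List.range' (lo + 1) (c.pos - lo)).filterMap ((E.st i r).lanes c.lane)) ∧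
      ∀ e ∈ (List.range' (lo + 1) (c.pos - lo)).filterMap ((E.st i r).lanes c.lane),
        (E.st i r).lanes c.lane e.pos = some e := by
  set F := (E.st i r).lanes c.lane with hF
  let g : ℕ → DataProp f Req Dig := fun p => (F p).getD d
  have hg : ∀ p, 0 < p → p ≤ c.pos → F p = some (g p) := by
    intro p h1 h2
    obtain ⟨e, he⟩ := lanes_downward h h1 h2
    simp only [g, hF, he, Option.getD_some]
  have hmap : (List.range' (lo + 1) (c.pos - lo)).filterMap F =
      (List.range' (lo + 1) (c.pos - lo)).map g := by
    rw [← List.filterMap_eq_map]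
    refine List.filterMap_congr fun p hp => ?_
    rw [List.mem_range'_1] at hp
    exact hg p (by omega) (by omega)
  have hget : ∀ k e, ((List.range' (lo + 1) (c.pos - lo)).map g)[k]? = some e →
      k < c.pos - lo ∧ e = g (lo + 1 + k) := by
    intro k e he
    obtain ⟨hk, he⟩ := List.getElem?_eq_some_iff.1 he
    rw [List.length_map, List.length_range'] at hk
    rw [List.getElem_map, List.getElem_range'] at he
    exact ⟨hk, by rw [← he]; congr 1; omega⟩
  rw [hmap]
  refine ⟨⟨?_, fun k e he => ?_, fun k e e' he he' => ?_, fun e c' he hc => ?_⟩, fun e he => ?_⟩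
  · rw [List.length_map, List.length_range']; rfl
  · obtain ⟨hk, rfl⟩ := hget k e he
    obtain ⟨h1, h2, -⟩ := E.lanes_origin (hg (lo + 1 + k) (by omega) (by omega))
    exact ⟨h1, h2⟩
  · obtain ⟨hk, rfl⟩ := hget k e he
    obtain ⟨hk', rfl⟩ := hget (k + 1) e' he'
    have h0 := hg (lo + 1 + k) (by omega) (by omega)
    rcases (E.lanes_origin (hg (lo + 1 + (k + 1)) (by omega) (by omega))).2.2.2.1 with
      ⟨h1, -⟩ | ⟨k', d', h1, h2, h3, -⟩
    · omega
    · obtain rfl : k' = lo + 1 + k := by omega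
      rw [← hF, h0] at h2
      rw [Option.some.inj h2]
      exact h3
  · cases hc
    rw [List.getLast?_eq_getElem?, List.length_map, List.length_range'] at he
    obtain ⟨hk, rfl⟩ := hget _ e he
    have h1 := hg c.pos (by omega) le_rfl
    rw [h] at h1
    rw [show lo + 1 + (c.pos - lo - 1) = c.pos by omega, ← Option.some.inj h1]
    exact hd
  · obtain ⟨p, hp, rfl⟩ := List.mem_map.1 he
    rw [List.mem_range'_1] at hp
    have h1 := hg p (by omega) (by omega)
    rw [(E.lanes_origin h1).2.1]
    exact h1

theorem Genuine.poa_lanes {i : ℕ} {c : PoA f Dig} (hg : E.Genuine i c.sigs) (hc : c.Valid) :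
    ∃ q, q ∈ c.signers ∧ q ∉ E.byz ∧
      ∃ d, (E.st i q).lanes c.lane c.pos = some d ∧ cfg.hash d = c.dig := by
  obtain ⟨q, hq, hcq⟩ := E.exists_correct hc
  obtain ⟨q', h⟩ := hg q (.carVote c.lane c.pos c.dig) _ ⟨hq, rfl⟩ hcq rfl
  obtain ⟨j, hj, out, he, hm, hact⟩ := h.act
  obtain ⟨d, h1, h2⟩ := hact.of_carVote hm
  exact ⟨q, hq, hcq, d, (E.le q (Nat.succ_le_of_lt hj)).lanes _ _ _ h1, h2⟩

theorem Said.prepVote_cut {i : ℕ} {r l : Replica f} {P : Proposal f Dig} {c : PoA f Dig}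
    (h : E.Said i r (.prepVote P)) (hc : P.cut l = some c) :
    c.lane = l ∧ c.Valid ∧ E.Genuine i c.sigs := by
  obtain ⟨j, hj, T, -, h1⟩ := h.prepVote_inbox
  obtain ⟨h2, h3⟩ := h1.2.1 l c hc
  exact ⟨h2, h3, (h.prepVote_sigs fun j _ => E.genuineInbox j).poa_of_cut hc⟩

theorem committed_cut {i s : ℕ} {r l : Replica f} {Q : CommitQC f Dig} {c : PoA f Dig}
    (h : (E.st i r).committed s = some Q) (hc : Q.prop.cut l = some c) :
    c.lane = l ∧ c.Valid ∧ E.Genuine i c.sigs := by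
  obtain ⟨r', -, h1⟩ := committed_voter h
  exact h1.prepVote_cut hc

/-! ### Synchronization and execution -/

theorem exists_history {i s : ℕ} {r : Replica f} (hr : r ∉ E.byz) {Q : CommitQC f Dig}
    (h : (E.st i r).committed s = some Q) (l : Replica f) :
    ∃ j, ∀ k, j ≤ k → ∃ ds, cfg.Segment l ((E.st k r).lastCommit l) (Q.prop.cut l) ds ∧
      ∀ d ∈ ds, d ∈ (E.st k r).store := by
  suffices hs : ∃ j lo ds, lo ≤ (E.st j r).lastCommit l ∧
      cfg.Segment l lo (Q.prop.cut l) ds ∧ ∀ d ∈ ds, d ∈ (E.st j r).store by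
    obtain ⟨j, lo, ds, h1, h2, h3⟩ := hs
    refine ⟨j, fun k hk => ?_⟩
    have hle := E.le r hk
    exact ⟨_, h2.drop (h1.trans (hle.lastCommit l)),
      fun d hd => hle.store (h3 d (List.drop_subset _ _ hd))⟩
  cases hc : Q.prop.cut l with
  | none =>
    exact ⟨0, _, [], le_rfl, ⟨by simp [tipPos], by simp, by simp, by simp⟩, by simp⟩
  | some c =>
    set t := E.time i with ht
    have ht0 : 0 ≤ t := E.time_nonneg i
    have hi : i ≤ E.idx t := (E.lt_idx_time i).le
    have hlt := E.lt_late t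
    have hlt' := E.lt_late (E.late t)
    have hcom := (E.le r hi).committed _ _ h
    obtain ⟨-, hQs, -⟩ := E.committed_origin h
    by_cases hmiss : ∃ ds, cfg.Segment l ((E.st (E.idx t) r).lastCommit l) (some c) ds ∧
        ∀ d ∈ ds, d ∈ (E.st (E.idx t) r).store
    · obtain ⟨ds, h1, h2⟩ := hmiss
      exact ⟨E.idx t, _, ds, le_rfl, h1, h2⟩
    · have hask : c ∈ (E.st (E.idx t) r).asked := by
        by_contra hnew
        exact E.quiet ht0 hr (Config.Act.sync _ Q.prop l c
          (.inr ⟨Q, by rw [hQs]; exact hcom, rfl⟩) hc hnew hmiss)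
      obtain ⟨hcl, hcv, hcg⟩ := committed_cut hcom hc
      obtain ⟨P, l', lo, h1, h2, h3, h4⟩ := E.asked_origin hask
      have hl' : c.lane = l' := by
        rcases h4 with h4 | ⟨Q', h4, rfl⟩
        · exact (h4.said.prepVote_cut h1).1
        · exact (committed_cut h4 h1).1
      obtain rfl : l' = l := hl'.symm.trans hcl
      obtain ⟨q, hq, hqc, d, hd, hdig⟩ := hcg.poa_lanes hcv
      have h5 := (h3 q hq).arrives hqc le_rfl
      have h6 := (E.le q (E.idx_mono hlt.le)).lanes _ _ _ hd
      have h7 : (r, c, lo) ∈ (E.st (E.idx (E.late t)) q).answered := by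
        by_contra hnew
        exact E.quiet (ht0.trans hlt.le) hqc (Config.Act.syncReply _ r c lo d h5 h6 hdig hnew)
      obtain ⟨j, hj, ⟨d', h8⟩, h9⟩ := E.answered_origin h7
      have h10 := (E.le q hj).lanes _ _ _ h8
      rw [h6] at h10
      cases h10
      have h11 := (segment_of_lanes h8 hdig lo).1
      rw [hcl] at h11
      refine ⟨E.idx (E.late (E.late t)), lo, _,
        h2.trans ((E.le r (E.idx_mono (hlt.trans hlt').le)).lastCommit _), h11, fun e he => ?_⟩
      rw [← hcl] at he
      exact .inr ⟨q, _, h9.arrives hr le_rfl, he⟩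

/-- Every correct replica executes all slots. -/
theorem next_unbounded {r : Replica f} (hr : r ∉ E.byz) (n : ℕ) :
    ∃ i, n ≤ (E.st i r).next := by
  induction n with
  | zero => exact ⟨0, Nat.zero_le _⟩
  | succ n ih =>
    obtain ⟨i, hi⟩ := ih
    by_contra hc
    push Not at hc
    obtain ⟨i', hi'⟩ := E.all_committed n r hr
    obtain ⟨Q, hQ⟩ := Option.ne_none_iff_exists'.1 hi'
    choose j hj using exists_history hr hQ
    set M := max (max i i') (Finset.univ.sup j) with hM
    have hlt := E.lt_idx_time M
    have hn : (E.st (E.idx (E.time M)) r).next = n := by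
      have h1 := (E.le r (show i ≤ E.idx (E.time M) by omega)).next
      have h2 := hc (E.idx (E.time M))
      omega
    choose segs h1 h2 using fun l => hj l (E.idx (E.time M))
      ((Finset.le_sup (Finset.mem_univ l)).trans ((le_max_right _ _).trans hlt.le))
    refine E.quiet (E.time_nonneg M) hr (Config.Act.execute _ Q segs ?_ h1 h2)
    rw [hn]
    exact (E.le r (show i' ≤ E.idx (E.time M) by omega)).committed _ _ hQ

/-- The state after executing a slot comes from the state before by executing it. -/
theorem next_origin {i n : ℕ} {r : Replica f} (h : (E.st i r).next = n + 1) :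
    ∃ j < i, ∃ Q segs, (E.st j r).next = n ∧ (E.st j r).committed n = some Q ∧
      (∀ l, cfg.Segment l ((E.st j r).lastCommit l) (Q.prop.cut l) (segs l)) ∧
      (E.st i r).lastCommit = (fun l => max ((E.st j r).lastCommit l) (tipPos (Q.prop.cut l))) ∧
      (E.st i r).log = (E.st j r).log ++ cfg.zip segs := by
  have key := E.induct r (I := fun i σ => ∀ n, σ.next = n + 1 →
    ∃ j < i, ∃ Q segs, (E.st j r).next = n ∧ (E.st j r).committed n = some Q ∧
      (∀ l, cfg.Segment l ((E.st j r).lastCommit l) (Q.prop.cut l) (segs l)) ∧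
      σ.lastCommit = (fun l => max ((E.st j r).lastCommit l) (tipPos (Q.prop.cut l))) ∧
      σ.log = (E.st j r).log ++ cfg.zip segs) ?_ ?_ ?_ ?_ ?_ i
  · exact key n h
  · intro n h; cases h
  · intro i σ h n hn
    obtain ⟨j, hj, h⟩ := h n hn
    exact ⟨j, by omega, h⟩
  · exact fun i σ src m h => h
  · exact fun i σ x h => h
  · intro i σ σ' out he hact hst hst' hI
    have hI : ∀ n, σ.next = n + 1 →
        ∃ j < i + 1, ∃ Q segs, (E.st j r).next = n ∧ (E.st j r).committed n = some Q ∧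
        (∀ l, cfg.Segment l ((E.st j r).lastCommit l) (Q.prop.cut l) (segs l)) ∧
        σ.lastCommit = (fun l => max ((E.st j r).lastCommit l) (tipPos (Q.prop.cut l))) ∧
        σ.log = (E.st j r).log ++ cfg.zip segs := by
      intro n hn
      obtain ⟨j, hj, h⟩ := hI n hn
      exact ⟨j, by omega, h⟩
    cases hact
    case execute Q segs hcom hseg hstore =>
      intro n hn
      subst hst
      obtain rfl : (E.st i r).next = n := Nat.succ.inj hn
      exact ⟨i, Nat.lt_succ_self i, Q, segs, rfl, hcom, hseg, rfl, rfl⟩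
    all_goals exact hI

theorem next_zero {i : ℕ} {r : Replica f} (h : (E.st i r).next = 0) :
    (E.st i r).lastCommit = (fun _ => 0) ∧ (E.st i r).log = [] := by
  have key := E.induct r (I := fun _ σ => σ.next = 0 → σ.lastCommit = (fun _ => 0) ∧ σ.log = [])
    ?_ ?_ ?_ ?_ ?_ i
  · exact key h
  · exact fun _ => ⟨rfl, rfl⟩
  · exact fun i σ h => h
  · exact fun i σ src m h => h
  · exact fun i σ x h => h
  · intro i σ σ' out he hact hst hst' hI
    cases hact
    case execute => exact fun h => absurd h (Nat.succ_ne_zero _)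
    all_goals exact hI

/-- Replicas that executed the same slots have the same logs. -/
theorem log_agree (n : ℕ) : ∀ {i i' : ℕ} {r r' : Replica f}, (E.st i r).next = n →
    (E.st i' r').next = n → (E.st i r).lastCommit = (E.st i' r').lastCommit ∧
      (E.st i r).log = (E.st i' r').log := by
  induction n with
  | zero =>
    intro i i' r r' h h'
    rw [(next_zero h).1, (next_zero h').1, (next_zero h).2, (next_zero h').2]
    exact ⟨rfl, rfl⟩
  | succ n ih =>
    intro i i' r r' h h'
    obtain ⟨j, -, Q, segs, h1, h2, h3, h4, h5⟩ := next_origin h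
    obtain ⟨j', -, Q', segs', h1', h2', h3', h4', h5'⟩ := next_origin h'
    obtain ⟨h6, h7⟩ := ih h1 h1'
    have h8 := committed_agree h2 h2'
    have h9 : segs = segs' := by
      funext l
      have := h3 l
      rw [h6, h8] at this
      exact this.unique (h3' l)
    rw [h4, h5, h4', h5', h6, h7, h8, h9]
    exact ⟨rfl, rfl⟩

theorem exists_next_eq {r : Replica f} {i n : ℕ} (h : n ≤ (E.st i r).next) :
    ∃ j, (E.st j r).next = n := by
  obtain ⟨m, hm⟩ := Nat.exists_eq_add_of_le h
  induction m generalizing i with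
  | zero => exact ⟨i, hm⟩
  | succ m ih =>
    obtain ⟨j, -, Q, segs, h1, -⟩ := next_origin (n := n + m) hm
    exact ih (by omega) h1

theorem committedData_of_log {i : ℕ} {r : Replica f} {d : DataProp f Req Dig}
    (h : d ∈ (E.st i r).log) : (E.st i r).CommittedData cfg d := by
  have key := E.induct r (I := fun _ σ => ∀ d ∈ σ.log, σ.CommittedData cfg d) ?_ ?_ ?_ ?_ ?_ i
  · exact key d h
  · intro d h; cases h
  · exact fun i σ h => h
  · exact fun i σ src m h => h
  · exact fun i σ x h => h
  · intro i σ σ' out he hact hst hst' hI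
    have hle := hact.le
    have hI : ∀ d ∈ σ.log, σ'.CommittedData cfg d := fun d hd => by
      obtain ⟨s, Q, l, c, h1, h2⟩ := hI d hd
      exact ⟨s, Q, l, c, hle.committed _ _ h1, h2⟩
    cases hact
    case execute Q segs hcom hseg hstore =>
      intro d hd
      rcases List.mem_append.1 hd with hd | hd
      · exact hI d hd
      · obtain ⟨l, -, hmem⟩ := List.mem_flatMap.1 ((cfg.zip_perm segs).mem_iff.1 hd)
        obtain ⟨c, hc⟩ := (hseg l).tip_ne_none (List.ne_nil_of_mem hmem)
        have h1 := hseg l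
        subst hst
        have hl := (committed_cut hcom hc).1
        refine ⟨_, Q, l, c, hcom, hc, hl, (E.st i r).lastCommit l, segs l, ?_, hmem⟩
        rw [hl, ← hc]
        exact h1
    all_goals exact hI

/-- The executed part of the lane of a correct replica is in the log. -/
theorem own_in_log {h : Replica f} (hh : h ∉ E.byz) {i k : ℕ} {r : Replica f}
    (hk : k < (E.st i r).lastCommit h) :
    ∃ d, (E.st i h).own[k]? = some d ∧ d ∈ (E.st i r).log := by
  have key := E.induct r (I := fun i σ => ∀ k < σ.lastCommit h,
    ∃ d, (E.st i h).own[k]? = some d ∧ d ∈ σ.log) ?_ ?_ ?_ ?_ ?_ i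
  · exact key k hk
  · intro k hk; cases hk
  · intro i σ h k hk
    obtain ⟨d, h1, h2⟩ := h k hk
    exact ⟨d, own_mono (Nat.le_succ i) h1, h2⟩
  · exact fun i σ src m h => h
  · exact fun i σ x h => h
  · intro i σ σ' out he hact hst hst' hI
    have hI : ∀ k < σ.lastCommit h, ∃ d, (E.st (i + 1) h).own[k]? = some d ∧ d ∈ σ.log := by
      intro k hk
      obtain ⟨d, h1, h2⟩ := hI k hk
      exact ⟨d, own_mono (Nat.le_succ i) h1, h2⟩
    cases hact
    case execute Q segs hcom hseg hstore =>
      intro k hk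
      by_cases hlo : k < σ.lastCommit h
      · obtain ⟨d, h1, h2⟩ := hI k hlo
        exact ⟨d, h1, List.mem_append_left _ h2⟩
      · have hk' : k < tipPos (Q.prop.cut h) := (lt_max_iff.1 hk).resolve_left hlo
        have h1 := hseg h
        have hlen : k - σ.lastCommit h < (segs h).length := by rw [h1.1]; omega
        have h2 := List.getElem?_eq_getElem hlen
        have hmem := List.getElem_mem hlen
        set d := (segs h)[k - σ.lastCommit h]
        obtain ⟨-, h3⟩ := h1.2.1 _ _ h2
        obtain ⟨c, hc⟩ := h1.tip_ne_none (List.ne_nil_of_mem hmem)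
        subst hst
        obtain ⟨hcl, hcv, hcg⟩ := committed_cut hcom hc
        obtain ⟨q, -, -, d', hd', hdig⟩ := hcg.poa_lanes hcv
        obtain ⟨h4, h5⟩ := segment_of_lanes hd' hdig ((E.st i r).lastCommit h)
        rw [hc] at h1
        rw [hcl] at h4 h5
        rw [h1.unique h4] at hmem
        obtain ⟨k', h6, h7⟩ := lanes_own hh (h5 d hmem)
        obtain rfl : k = k' := by omega
        refine ⟨d, own_mono (Nat.le_succ i) h7, List.mem_append_right _ ?_⟩
        refine (cfg.zip_perm segs).mem_iff.2 (List.mem_flatMap.2 ⟨h, List.mem_finRange h, ?_⟩)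
        rw [h1.unique h4]
        exact hmem
    all_goals exact hI

theorem finalized_of_log {d : DataProp f Req Dig}
    (h : ∀ r, r ∉ E.byz → ∃ j, d ∈ (E.st j r).log) : E.Finalized d := by
  intro r hr
  obtain ⟨j, hj⟩ := h r hr
  filter_upwards [Filter.eventually_ge_atTop j] with k hk
  have hd := (E.le r hk).log.subset hj
  exact ⟨committedData_of_log hd, hd⟩

/-- What one replica executes is finalized. -/
theorem finalized_of_mem_log {i : ℕ} {r : Replica f} {d : DataProp f Req Dig}
    (h : d ∈ (E.st i r).log) : E.Finalized d := by
  refine finalized_of_log fun r' hr' => ?_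
  obtain ⟨j, hj⟩ := next_unbounded hr' (E.st i r).next
  obtain ⟨k, hk⟩ := exists_next_eq hj
  exact ⟨k, (log_agree _ rfl hk).2 ▸ h⟩

/-- The cars of a correct replica are finalized. -/
theorem own_finalized {h : Replica f} (hh : h ∉ E.byz)
    (hs : ∃ᶠ i in Filter.atTop, ∃ x, E.ev i = .request h x) {i k : ℕ} {d : DataProp f Req Dig}
    (hd : (E.st i h).own[k]? = some d) : E.Finalized d := by
  obtain ⟨M, hM⟩ := tips_advance hh hs (k + 1)
  obtain ⟨s, hs⟩ := exists_slot_tipPos hM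
  obtain ⟨j, hj⟩ := next_unbounded hh (s + 1)
  obtain ⟨n, hn⟩ := exists_next_eq hj
  obtain ⟨j', -, Q, segs, -, h1, -, h2, -⟩ := next_origin hn
  have h3 := hs _ _ _ h1
  obtain ⟨d', h4, h5⟩ := own_in_log hh (i := n) (r := h) (k := k)
    (by rw [h2]; exact lt_max_of_lt_right h3)
  rw [own_unique hd h4]
  exact finalized_of_mem_log h5

/-- Every request received by a correct replica ends up in a finalized car. -/
theorem request_finalized (hstream : E.ContinuousStream) {i : ℕ} {h : Replica f} {x : Req}
    (hh : h ∉ E.byz) (hx : E.ev i = .request h x) :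
    ∃ d : DataProp f Req Dig, x ∈ d.batch ∧ d ∉ (E.st i h).own ∧ (∃ j, d ∈ (E.st j h).own) ∧
      E.Finalized d := by
  obtain ⟨j, k, d, h1, h2, h3⟩ := request_in_own hh (hstream h hh) hx
  refine ⟨d, h3, fun hmem => ?_, ⟨j, List.mem_of_getElem? h2⟩,
    own_finalized hh (hstream h hh) h2⟩
  obtain ⟨k', h4⟩ := List.mem_iff_getElem?.1 hmem
  have h5 := (E.own_origin.1 k d h2).2.1
  have h6 := (E.own_origin.1 k' d h4).2.1
  obtain ⟨h7, -⟩ := List.getElem?_eq_some_iff.1 h4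
  omega

/-- The request of a correct client is answered or reaches a correct replica. -/
theorem CorrectClient.answered_or_received {x : Req} (h : E.CorrectClient x) :
    E.Answered x ∨ ∃ i r, r ∉ E.byz ∧ E.ev i = .request r x := by
  classical
  by_contra hc
  push Not at hc
  obtain ⟨⟨i, r, hi⟩, hnext⟩ := h
  obtain ⟨r₁, hr₁⟩ := E.exists_correct_replica
  have key : ∀ n, ∃ i r, E.ev i = .request r x ∧
      ∃ S : Finset (Replica f), n ≤ S.card ∧ ∀ r ∈ S, ∃ k ≤ i, E.ev k = .request r x := by
    intro n
    induction n with
    | zero => exact ⟨i, r, hi, ∅, le_rfl, by simp⟩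
    | succ n ih =>
      obtain ⟨i, r, hi, S, hS, h1⟩ := ih
      rcases hnext i r hi with h | ⟨j, r', hj, h2⟩ | h
      · exact absurd h hc.1
      · have hij : i ≤ j := by
          by_contra hlt
          exact h2 j (not_le.1 hlt).le hj
        refine ⟨j, r', hj, insert r' S, ?_, fun q hq => ?_⟩
        · rw [Finset.card_insert_of_notMem]
          · omega
          · intro hmem
            obtain ⟨k, hk, h3⟩ := h1 r' hmem
            exact h2 k hk h3
        · rcases Finset.mem_insert.1 hq with rfl | hq
          · exact ⟨j, le_rfl, hj⟩
          · obtain ⟨k, hk, h3⟩ := h1 q hq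
            exact ⟨k, hk.trans hij, h3⟩
      · obtain ⟨k, -, hk⟩ := h r₁
        exact absurd hk (hc.2 k r₁ hr₁)
  obtain ⟨i, r, -, S, hS, -⟩ := key (3 * f + 2)
  have := Finset.card_le_univ S
  rw [Fintype.card_fin] at this
  omega

end Execution

end Autobahn

theorem mainTheorem2 {f : ℕ} {Req Dig : Type*} (cfg : Autobahn.Config f Req Dig)
    (E : Autobahn.Execution cfg) (hstream : E.ContinuousStream) :
    -- every request received by a correct replica is put into a car of its lane,
    -- which is committed and executed by all correct replicas
    (∀ i h x, h ∉ E.byz → E.ev i = .request h x →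
      ∃ d : Autobahn.DataProp f Req Dig, x ∈ d.batch ∧ d ∉ (E.st i h).own ∧
        (∃ j, d ∈ (E.st j h).own) ∧ E.Finalized d) ∧
    -- every request of a correct client is committed and executed by all correct replicas
    (∀ x, E.CorrectClient x →
      ∃ d : Autobahn.DataProp f Req Dig, x ∈ d.batch ∧ E.Finalized d) := by
  refine ⟨fun i h x hh hx => Autobahn.Execution.request_finalized hstream hh hx, fun x hx => ?_⟩
  rcases Autobahn.Execution.CorrectClient.answered_or_received hx with
    ⟨j, r, hr, d, hd, hxd⟩ | ⟨i, r, hr, he⟩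
  · exact ⟨d, hxd, Autobahn.Execution.finalized_of_mem_log hd⟩
  · obtain ⟨d, h1, -, -, h2⟩ := Autobahn.Execution.request_finalized hstream hr he
    exact ⟨d, h1, h2⟩
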